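/- For a real-valued $f\in L^2(\mathbb R)$ with Fourier transform $\widehat f(k)=(2\pi)^{-1/2}\int f(\tau)e^{-ik\tau}\,d\tau$ (in the sense of Plancherel) and $s\ge 0$, write $\|f\|_{H^s}^2=\int_{\mathbb R}(1+k^2)^s|\widehat f(k)|^2\,dk$ and $\|\partial_\tau^{-1}f\|_{H^s}^2=\int_{\mathbb R}(1+k^2)^s\left|\widehat f(k)/(ik)\right|^2dk$ (both with values in $[0,\infty]$). Fix $s_A>\frac{17}{2}$, $\rho_1>\rho_0>0$ and $C_1>0$. Then there exist $\varepsilon_0>0$ and $C_0>0$ such that for all $\varepsilon\in(0,\varepsilon_0)$ the following holds. Let $A\in C^0([\rho_0,\rho_1],H^{s_A}(\mathbb R))$ be a real-valued solution $A=A(\rho,\tau)$ of the cylindrical KdV equation $$2\partial_\rho A+\rho^{-1}A+\partial_\tau^3A=\partial_\tau(A^2),\qquad \rho\in[\rho_0,\rho_1],\ \tau\in\mathbb R,$$ with $$\sup_{\rho\in[\rho_0,\rho_1]}\left(\|A(\rho,\cdot)\|_{H^{s_A}}+\|\partial_\tau^{-1}A(\rho,\cdot)\|_{H^{s_A-2}}\right)\le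 C_1 .$$ Then for every $s>\frac12$ there is a real-valued solution $u=u(r,t)$ with $(u,\partial_ru)\in C^0([\rho_0\varepsilon^{-3},\rho_1\varepsilon^{-3}],H^s(\mathbb R)\times H^s(\mathbb R))$ of the radial Boussinesq equation $$(\partial_r^2+r^{-1}\partial_r)(u-\partial_t^2u+u^2)=\partial_t^2u$$ ($t$-derivatives being understood in the sense of distributions) satisfying $$\sup_{r\in[\rho_0\varepsilon^{-3},\rho_1\varepsilon^{-3}]}\ \sup_{t\in\mathbb R}\left|u(r,t)-\varepsilon^2A(\varepsilon^3r,\varepsilon(t-r))\right|\le C_0\,\varepsilon^{7/2}.$$ -/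

import Mathlib

open MeasureTheory Filter Topology Set
open scoped ENNReal ContDiff FourierTransform

noncomputable section

/-- The element of complex `L²(ℝ)` given by a real-valued square-integrable function. -/
def toComplexL2 (f : ℝ → ℝ) (hf : MemLp f 2 (volume : Measure ℝ)) :
    Lp ℂ 2 (volume : Measure ℝ) :=
  (hf.ofReal (K := ℂ)).toLp (fun t => (f t : ℂ))

/-- The square of the `H^s(ℝ)` norm of `m(D) f`, for `f ∈ L²(ℝ)` and a Fourier symbol `m`:
`∫ (1 + k²)^s |m(k) f̂(k)|²`, where `f̂` is the Plancherel transform of `f`. Mathlib's Fourier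
transform uses the kernel `exp (-2 π i ξ t)`, so the wave number is `k = 2 π ξ`; with this
normalization the value for `s = 1`, `m = 1` is `‖f‖² + ‖f'‖²`. -/
def sobolevSq (s : ℝ) (m : ℝ → ℂ) (f : Lp ℂ 2 (volume : Measure ℝ)) : ℝ≥0∞ :=
  ∫⁻ ξ : ℝ, ENNReal.ofReal
    ((1 + (2 * Real.pi * ξ) ^ 2) ^ s * ‖m (2 * Real.pi * ξ) * (𝓕 f : Lp ℂ 2 volume) ξ‖ ^ 2)

open Classical in
/-- The `H^s(ℝ)` norm (`s ≥ 0`) of a real-valued function. It is `⊤` exactly when the function is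
not in `H^s(ℝ)`. -/
def sobolevNorm (s : ℝ) (f : ℝ → ℝ) : ℝ≥0∞ :=
  if hf : MemLp f 2 (volume : Measure ℝ) then
    sobolevSq s (fun _ => 1) (toComplexL2 f hf) ^ (1 / 2 : ℝ)
  else ⊤

open Classical in
/-- The `H^s(ℝ)` norm (`s ≥ 0`) of `∂⁻¹ f`, where `∂⁻¹` is the Fourier multiplier with the symbol
`1 / (i k)`, for `f ∈ L²(ℝ)`. It is `⊤` exactly when `∂⁻¹ f` is not in `H^s(ℝ)`. -/
def sobolevNormAntideriv (s : ℝ) (f : ℝ → ℝ) : ℝ≥0∞ :=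
  if hf : MemLp f 2 (volume : Measure ℝ) then
    sobolevSq s (fun k => (Complex.I * (k : ℂ))⁻¹) (toComplexL2 f hf) ^ (1 / 2 : ℝ)
  else ⊤

/-- `f ∈ C⁰(I, H^s(ℝ))`. -/
def ContinuousInSobolev (s : ℝ) (I : Set ℝ) (f : ℝ → ℝ → ℝ) : Prop :=
  ∀ r ∈ I, sobolevNorm s (f r) < ⊤ ∧
    Tendsto (fun r' => sobolevNorm s (fun t => f r' t - f r t)) (𝓝[I] r) (𝓝 0)

/-- `g = ∂_r f` on `I`, the derivative of the curve `r ↦ f(r, ·)` being taken in `H^s(ℝ)`. -/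
def HasDerivInSobolev (s : ℝ) (I : Set ℝ) (f g : ℝ → ℝ → ℝ) : Prop :=
  ∀ r ∈ I, Tendsto (fun r' => sobolevNorm s (fun t => (f r' t - f r t) / (r' - r) - g r t))
    (𝓝[I \ {r}] r) (𝓝 0)

/-- `A ∈ C⁰([ρ₀, ρ₁], H^s(ℝ))` is a solution of the cylindrical KdV equation
`2 ∂_ρ A + ρ⁻¹ A + ∂_τ³ A = ∂_τ (A²)` on `[ρ₀, ρ₁] × ℝ`. For `s > 7/2`, solutions in this space
(continuous representatives) are classical ones, so the equation is required pointwise, with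
one-sided `ρ`-derivatives at the two ends. -/
structure IsCKdVSolution (s ρ₀ ρ₁ : ℝ) (A : ℝ → ℝ → ℝ) : Prop where
  continuous_curve : ContinuousInSobolev s (Icc ρ₀ ρ₁) A
  contDiff : ∀ ρ ∈ Icc ρ₀ ρ₁, ContDiff ℝ 3 (A ρ)
  equation : ∀ ρ ∈ Icc ρ₀ ρ₁, ∀ τ : ℝ, ∃ Aρ : ℝ,
    HasDerivWithinAt (fun ρ' => A ρ' τ) Aρ (Icc ρ₀ ρ₁) ρ ∧
      2 * Aρ + ρ⁻¹ * A ρ τ + iteratedDeriv 3 (A ρ) τ = deriv (fun x => A ρ x ^ 2) τ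

/-- `(u, ∂_r u) ∈ C⁰([r₀, r₁], H^s(ℝ) × H^s(ℝ))` solves the radial Boussinesq equation
`(∂_r² + r⁻¹ ∂_r) (u - σ ∂_t² u + u²) = ∂_t² u` on `[r₀, r₁] × ℝ`. As `s > 1/2` allows functions
that are not twice differentiable in `t`, derivatives in `t` are in the sense of distributions: for
every test function `φ`, the function `r ↦ ⟨u - σ ∂_t² u + u², φ⟩` is twice differentiable, with
first derivative `P`, and satisfies the equation tested with `φ`. -/
structure IsRadialBoussinesqSolution (σ s r₀ r₁ : ℝ) (u : ℝ → ℝ → ℝ) : Prop where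
  continuous_rep : ∀ r ∈ Icc r₀ r₁, Continuous (u r)
  continuous_curve : ContinuousInSobolev s (Icc r₀ r₁) u
  deriv_curve : ∃ ur : ℝ → ℝ → ℝ, ContinuousInSobolev s (Icc r₀ r₁) ur ∧
    HasDerivInSobolev s (Icc r₀ r₁) u ur
  equation : ∀ φ : ℝ → ℝ, ContDiff ℝ ∞ φ → HasCompactSupport φ → ∃ P : ℝ → ℝ,
    ∀ r ∈ Icc r₀ r₁,
      HasDerivWithinAt
        (fun r' => ∫ t, ((u r' t + u r' t ^ 2) * φ t - σ * u r' t * iteratedDeriv 2 φ t))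
        (P r) (Icc r₀ r₁) r ∧
      ∃ P' : ℝ, HasDerivWithinAt P P' (Icc r₀ r₁) r ∧
        P' + r⁻¹ * P r = ∫ t, u r t * iteratedDeriv 2 φ t

end

/-! Put J = (1 - ∂²)^(-1/2), K = ∂J and u = J f. The Boussinesq equation becomes the first-order
system f' + 2 J((J f')(J f)) = K q, q' + q/r = K f on L²(ℝ), in which every operator is bounded. For
small f the factor multiplying f' is invertible by a Neumann series, so the problem in r is a
Lipschitz ODE; truncating f and q outside a ball makes it globally solvable
(`exists_solution_of_small`).

The approximation is ψ with J ψ = ε²A(ε³r, ε(t-r)), together with the flux Q = -ε²A + ε⁴k, where k =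
(∂²A - A² - ρ⁻¹∂⁻¹A)/2. In both equations the terms of order ε³ cancel identically and those of
order ε⁵ cancel exactly by cylindrical KdV. The residuals are ε⁷ times a fixed profile of the slow
variables, hence O(ε^(13/2)) in L² because stretching by ε⁻¹ costs ε^(-1/2) (`approx_implicit`,
`approx_flux`). The term ∂⁻¹A in k is why a bound on the antiderivative is needed.

For the error R = f - ψ, Z = q - Q, the energy ½‖R‖² + ½‖Z‖² + ∫(Jψ)(JR)² + ⅔∫(JR)³ is chosen so
that everything containing R' cancels, by the antisymmetry of K and the symmetry of the cubic form
(`energy_identity`). What remains is ∂_r(Jψ)(JR)², of size ε³‖R‖², a damping term and the residuals.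
Grönwall over a length O(ε⁻³) gives ‖R‖² = O(ε⁷), and a continuity argument shows that the
truncation never acts (`exists_solution_near`). The embedding of H¹ into bounded functions turns
this into the uniform bound of order ε^(7/2).

The estimate uses only the L² norm of f, whereas u may be required in any H^s. The initial data of ψ
and Q are therefore replaced by nearby elements of the range of J^m, and smoothness of the data
persists because the quadratic term is smoothing (`IsSolutionOn.regOn`). The constants do not depend
on m. -/

open MeasureTheory Filter Topology Set
open scoped ENNReal ContDiff FourierTransform NNReal RealInnerProductSpace

/-! ### Truncation onto a ball. -/

section RadialRetraction

variable {X : Type*} [NormedAddCommGroup X] [NormedSpace ℝ X]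

/-- The radial retraction of a normed space onto the closed ball of radius `R`. -/
noncomputable def radialRetract (R : ℝ) (x : X) : X := (max 1 (‖x‖ / R))⁻¹ • x

theorem norm_radialRetract_le {R : ℝ} (hR : 0 < R) (x : X) : ‖radialRetract R x‖ ≤ R := by
  have h1 : (0 : ℝ) < max 1 (‖x‖ / R) := lt_max_of_lt_left one_pos
  rw [radialRetract, norm_smul, Real.norm_of_nonneg (inv_nonneg.2 h1.le), inv_mul_le_iff₀ h1]
  have := le_max_right 1 (‖x‖ / R)
  rwa [div_le_iff₀ hR] at this

theorem norm_radialRetract_le_self (R : ℝ) (x : X) : ‖radialRetract R x‖ ≤ ‖x‖ := by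
  have h1 : (1 : ℝ) ≤ max 1 (‖x‖ / R) := le_max_left _ _
  rw [radialRetract, norm_smul, Real.norm_of_nonneg (by positivity)]
  exact mul_le_of_le_one_left (norm_nonneg _) (inv_le_one_of_one_le₀ h1)

theorem radialRetract_of_norm_le {R : ℝ} (hR : 0 < R) {x : X} (hx : ‖x‖ ≤ R) :
    radialRetract R x = x := by
  rw [radialRetract, max_eq_left ((div_le_one hR).2 hx), inv_one, one_smul]

/-- The difference of the images is the rescaled difference x - y plus the change of the scaling
factor acting on y. The second part is bounded by ‖x - y‖ as well, because the rescaled y has norm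
at most R. No inner product is needed, at the price of the constant 2. -/
theorem lipschitzWith_radialRetract {R : ℝ} (hR : 0 < R) :
    LipschitzWith 2 (radialRetract R : X → X) := by
  refine LipschitzWith.of_dist_le_mul fun x y => ?_
  rw [dist_eq_norm, dist_eq_norm]
  have hmx : (1 : ℝ) ≤ max 1 (‖x‖ / R) := le_max_left _ _
  have hmy : (1 : ℝ) ≤ max 1 (‖y‖ / R) := le_max_left _ _
  set a := max 1 (‖x‖ / R) with ha
  set b := max 1 (‖y‖ / R) with hb
  have hab : |a - b| ≤ ‖x - y‖ / R := by
    calc |a - b| ≤ |‖x‖ / R - ‖y‖ / R| := by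
          rw [ha, hb, max_comm 1, max_comm 1]; exact abs_max_sub_max_le_abs _ _ _
      _ = |‖x‖ - ‖y‖| / R := by rw [← sub_div, abs_div, abs_of_pos hR]
      _ ≤ _ := by gcongr; exact abs_norm_sub_norm_le x y
  have hyb : b⁻¹ * ‖y‖ ≤ R := by
    rw [inv_mul_le_iff₀ (by linarith), ← div_le_iff₀ hR]; exact le_max_right _ _
  have e : radialRetract R x - radialRetract R y = a⁻¹ • (x - y) + (a⁻¹ - b⁻¹) • y := by
    simp only [radialRetract, ← ha, ← hb]; module
  have hinv : a⁻¹ - b⁻¹ = a⁻¹ * (b - a) * b⁻¹ := by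
    have : a ≠ 0 := by positivity
    have : b ≠ 0 := by positivity
    field_simp
  have ha1 : a⁻¹ ≤ 1 := inv_le_one_of_one_le₀ hmx
  rw [e]
  calc _ ≤ ‖a⁻¹ • (x - y)‖ + ‖(a⁻¹ - b⁻¹) • y‖ := norm_add_le _ _
    _ = a⁻¹ * ‖x - y‖ + a⁻¹ * (|a - b| * (b⁻¹ * ‖y‖)) := by
        rw [norm_smul, norm_smul, hinv, norm_mul, norm_mul, Real.norm_of_nonneg (by positivity),
          Real.norm_of_nonneg (r := b⁻¹) (by positivity), Real.norm_eq_abs, abs_sub_comm]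
        ring
    _ ≤ 1 * ‖x - y‖ + 1 * (‖x - y‖ / R * R) := by gcongr
    _ = _ := by
        rw [div_mul_cancel₀ _ hR.ne']; simp; ring

end RadialRetraction

/-! ### Ordinary differential equations in Banach spaces. -/

section ODE

variable {X : Type*} [NormedAddCommGroup X] [NormedSpace ℝ X]

theorem HasDerivWithinAt.Ici_of_Icc {f : ℝ → X} {f' : X} {a b t : ℝ} (ht : t ∈ Ico a b)
    (h : HasDerivWithinAt f f' (Icc a b) t) : HasDerivWithinAt f f' (Ici t) t :=
  h.mono_of_mem_nhdsWithin (Icc_mem_nhdsGE_of_mem ht)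

/-- For a bounded field the ball in the Picard–Lindelöf theorem may have radius B(b - a), so the
interval of existence need not be shortened. -/
theorem exists_solution_of_lipschitz_of_bounded [CompleteSpace X] {a b : ℝ} (hab : a ≤ b)
    {f : ℝ → X → X} {K : ℝ≥0} (hf : ∀ t ∈ Icc a b, LipschitzWith K (f t))
    (hc : ∀ x, ContinuousOn (fun t => f t x) (Icc a b)) {B : ℝ≥0}
    (hB : ∀ t ∈ Icc a b, ∀ x, ‖f t x‖ ≤ B) (x₀ : X) :
    ∃ α : ℝ → X, α a = x₀ ∧ ∀ t ∈ Icc a b, HasDerivWithinAt α (f t (α t)) (Icc a b) t := by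
  have hpl : IsPicardLindelof f (⟨a, left_mem_Icc.2 hab⟩ : Icc a b) x₀
      (B * ⟨b - a, sub_nonneg.2 hab⟩) 0 B K :=
    { lipschitzOnWith := fun t ht => (hf t ht).lipschitzOnWith
      continuousOn := fun x _ => hc x
      norm_le := fun t ht x _ => hB t ht x
      mul_max_le := by simp [hab]; rfl }
  exact hpl.exists_eq_forall_mem_Icc_hasDerivWithinAt₀

/-- A vector field that is globally Lipschitz in space has solutions on the whole interval. -/
theorem exists_solution_of_lipschitz [CompleteSpace X] {a b : ℝ} (hab : a ≤ b)
    {f : ℝ → X → X} {K : ℝ≥0} (hf : ∀ t ∈ Icc a b, LipschitzWith K (f t))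
    (hc : ∀ x, ContinuousOn (fun t => f t x) (Icc a b)) (x₀ : X) :
    ∃ α : ℝ → X, α a = x₀ ∧ ∀ t ∈ Icc a b, HasDerivWithinAt α (f t (α t)) (Icc a b) t := by
  obtain ⟨C, hC⟩ := isCompact_Icc.exists_bound_of_continuousOn (hc 0)
  have hC0 : 0 ≤ C := (norm_nonneg _).trans (hC a (left_mem_Icc.2 hab))
  have hgrow : ∀ t ∈ Icc a b, ∀ x, ‖f t x‖ ≤ K * ‖x‖ + C := fun t ht x => by
    have h1 := (hf t ht).dist_le_mul x 0
    rw [dist_eq_norm, dist_zero_right] at h1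
    calc ‖f t x‖ = ‖(f t x - f t 0) + f t 0‖ := by rw [sub_add_cancel]
      _ ≤ _ := (norm_add_le _ _).trans (add_le_add h1 (hC t ht))
  -- Beyond the a priori Grönwall bound for the untruncated equation. The truncated field has the
  -- same growth bound, so its solution stays inside this ball and solves the original equation.
  set R : ℝ := gronwallBound ‖x₀‖ K C (b - a) + 1 with hR
  have hR0 : 0 < R := by
    have : ‖x₀‖ ≤ gronwallBound ‖x₀‖ K C (b - a) := by
      conv_lhs => rw [← gronwallBound_x0 ‖x₀‖ (K : ℝ) C]
      exact gronwallBound_mono (norm_nonneg _) hC0 K.2 (sub_nonneg.2 hab)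
    linarith [norm_nonneg x₀]
  obtain ⟨α, hα0, hα⟩ := exists_solution_of_lipschitz_of_bounded hab
    (f := fun t x => f t (radialRetract R x)) (K := K * 2)
    (fun t ht => (hf t ht).comp (lipschitzWith_radialRetract hR0)) (fun x => hc _)
    (B := ⟨K * R + C, by positivity⟩)
    (fun t ht x => (hgrow t ht _).trans (by
      have := norm_radialRetract_le hR0 x
      change _ ≤ (K : ℝ) * R + C
      gcongr)) x₀
  refine ⟨α, hα0, fun t ht => ?_⟩
  have hb := norm_le_gronwallBound_of_norm_deriv_right_le (f := α) (a := a) (b := b)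
    (δ := ‖x₀‖) (K := K) (ε := C)
    (fun t ht => (hα t ht).continuousWithinAt)
    (fun t ht => (hα t (Ico_subset_Icc_self ht)).Ici_of_Icc ht) (by rw [hα0])
    (fun t ht => (hgrow t (Ico_subset_Icc_self ht) _).trans (by
      have := norm_radialRetract_le_self R (α t)
      gcongr)) t ht
  have hmono : gronwallBound ‖x₀‖ K C (t - a) ≤ gronwallBound ‖x₀‖ K C (b - a) :=
    gronwallBound_mono (norm_nonneg _) hC0 K.2 (by linarith [ht.2])
  have := hα t ht
  rwa [radialRetract_of_norm_le hR0 (by linarith)] at this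

theorem eqOn_of_lipschitz_of_hasDerivWithinAt {a b : ℝ} {f : ℝ → X → X} {K : ℝ≥0}
    (hf : ∀ t ∈ Icc a b, LipschitzWith K (f t)) {α β : ℝ → X}
    (hα : ∀ t ∈ Icc a b, HasDerivWithinAt α (f t (α t)) (Icc a b) t)
    (hβ : ∀ t ∈ Icc a b, HasDerivWithinAt β (f t (β t)) (Icc a b) t) (h0 : α a = β a) :
    EqOn α β (Icc a b) :=
  ODE_solution_unique_of_mem_Icc_right (v := f) (s := fun _ => univ)
    (fun t ht => (hf t (Ico_subset_Icc_self ht)).lipschitzOnWith)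
    (fun t ht => (hα t ht).continuousWithinAt)
    (fun t ht => (hα t (Ico_subset_Icc_self ht)).Ici_of_Icc ht) (fun _ _ => trivial)
    (fun t ht => (hβ t ht).continuousWithinAt)
    (fun t ht => (hβ t (Ico_subset_Icc_self ht)).Ici_of_Icc ht) (fun _ _ => trivial) h0

/-- A curve whose images under a separating family of bounded operators are differentiable, with
derivatives that come from a continuous curve, is differentiable. -/
theorem hasDerivWithinAt_of_separating [CompleteSpace X] {ι : Type*} {Y : ι → Type*}
    [∀ i, NormedAddCommGroup (Y i)] [∀ i, NormedSpace ℝ (Y i)] [∀ i, CompleteSpace (Y i)]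
    (T : ∀ i, X →L[ℝ] Y i) (hT : ∀ x, (∀ i, T i x = 0) → x = 0) {a b : ℝ} {F F' : ℝ → X}
    (hF' : ContinuousOn F' (Icc a b))
    (h : ∀ i, ∀ t ∈ Icc a b, HasDerivWithinAt (fun r => T i (F r)) (T i (F' t)) (Icc a b) t) :
    ∀ t ∈ Icc a b, HasDerivWithinAt F (F' t) (Icc a b) t := by
  intro t ht
  have hab : a ≤ b := ht.1.trans ht.2
  set G : ℝ → X := fun r => F' (projIcc a b hab r) with hG
  have hGc : Continuous G := by
    exact (continuousOn_iff_continuous_domRestrict.1 hF').comp (continuous_projIcc (h := hab))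
  have hGe : ∀ r ∈ Icc a b, G r = F' r := fun r hr => by simp [hG, projIcc_of_mem hab hr]
  have hD : ∀ r, HasDerivAt (fun r => F a + ∫ x in a..r, G x) (G r) r := fun r =>
    (intervalIntegral.integral_hasDerivAt_right (hGc.intervalIntegrable _ _)
      (hGc.stronglyMeasurableAtFilter _ _) hGc.continuousAt).const_add _
  -- Under each operator, F and the primitive of F' have the same derivative and the same value at
  -- a; the family separates points. No continuity of F is assumed.
  have key : ∀ r ∈ Icc a b, F r = F a + ∫ x in a..r, G x := fun r hr => by
    rw [← sub_eq_zero]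
    refine hT _ fun i => ?_
    have hcl := eqOn_of_lipschitz_of_hasDerivWithinAt (X := Y i) (a := a) (b := b) (K := 0)
      (f := fun t _ => T i (F' t)) (fun t _ => LipschitzWith.const _)
      (α := fun r => T i (F r)) (β := fun r => T i (F a + ∫ x in a..r, G x))
      (h i) (fun s hs => by
        have := ((T i).hasFDerivAt.comp_hasDerivAt s (hD s)).hasDerivWithinAt (s := Icc a b)
        rwa [hGe s hs] at this) (by simp)
    rw [map_sub, sub_eq_zero]
    exact hcl hr
  have := (hD t).hasDerivWithinAt (s := Icc a b)
  rw [hGe t ht] at this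
  exact this.congr key (key t ht)

/-- The continuity method on an interval. -/
theorem lt_of_continuity_method {a b η : ℝ} {φ : ℝ → ℝ} (hφ : ContinuousOn φ (Icc a b))
    (h : ∀ r ∈ Icc a b, (∀ s ∈ Ico a r, φ s < η) → φ r < η) : ∀ r ∈ Icc a b, φ r < η := by
  by_contra! hcon
  set S := Icc a b ∩ φ ⁻¹' Ici η with hS
  have hScl : IsClosed S := hφ.preimage_isClosed_of_isClosed isClosed_Icc isClosed_Ici
  have hne : S.Nonempty := let ⟨r, hr, h⟩ := hcon; ⟨r, hr, h⟩
  have hbd : BddBelow S := ⟨a, fun x hx => hx.1.1⟩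
  have hmem := hScl.csInf_mem hne hbd
  -- At the first bad time, which exists as the bad set is closed, all earlier times are good.
  refine (h _ hmem.1 fun s hs => ?_).not_ge hmem.2
  by_contra! hs'
  exact (csInf_le hbd (show s ∈ S from ⟨⟨hs.1, hs.2.le.trans hmem.1.2⟩, hs'⟩)).not_gt hs.2

/-- Grönwall's inequality for a differentiable function. -/
theorem gronwall_of_hasDerivWithinAt {a b c d : ℝ} (hc : 0 < c) {E E' : ℝ → ℝ}
    (hE : ∀ r ∈ Icc a b, HasDerivWithinAt E (E' r) (Icc a b) r)
    (hbound : ∀ r ∈ Ico a b, E' r ≤ c * E r + d) :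
    ∀ r ∈ Icc a b, E r ≤ E a * Real.exp (c * (r - a)) + d / c * (Real.exp (c * (r - a)) - 1) := by
  intro r hr
  have := le_gronwallBound_of_liminf_deriv_right_le (f := E) (f' := E') (δ := E a) (K := c)
    (ε := d) (fun t ht => (hE t ht).continuousWithinAt)
    (fun x hx s hs => by
      have h1 := ((hE x (Ico_subset_Icc_self hx)).Ici_of_Icc hx).liminf_right_slope_le hs
      simpa [slope_def_field, div_eq_inv_mul] using h1) le_rfl hbound r hr
  rwa [gronwallBound_of_K_ne_0 hc.ne'] at this

end ODE

/-! ### The abstract calculus of (1 - ∂²)^(-1/2) and persistence of regularity. -/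

theorem denseRange_of_symmetric_of_injective {L : Type*} [NormedAddCommGroup L]
    [InnerProductSpace ℝ L] [CompleteSpace L] {T : L →L[ℝ] L}
    (hT : ∀ x y, ⟪T x, y⟫ = ⟪x, T y⟫) (hinj : ∀ x, T x = 0 → x = 0) : DenseRange T := by
  -- If x is orthogonal to the range, testing with T (T x) gives ‖T x‖² = 0.
  have h : (LinearMap.range T.toLinearMap)ᗮ = ⊥ := by
    rw [Submodule.eq_bot_iff]
    intro x hx
    refine hinj x ?_
    have h := (Submodule.mem_orthogonal _ _).1 hx (T (T x)) ⟨_, rfl⟩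
    rwa [hT, inner_self_eq_zero] at h
  have := Submodule.topologicalClosure_eq_top_iff.2 h
  rw [DenseRange, dense_iff_closure_eq]
  have h2 := congrArg (SetLike.coe) this
  rwa [Submodule.topologicalClosure_coe] at h2

/-- The operators `J = (1 - ∂²)^(-1/2)` and `K = ∂ (1 - ∂²)^(-1/2)` on a Hilbert space `L` playing
the role of `L²(ℝ)`, with the product `M a g = a · (J g)`, and the rules that they obey. -/
structure BesselCalculus (L : Type*) [NormedAddCommGroup L] [InnerProductSpace ℝ L] where
  J : L →L[ℝ] L
  K : L →L[ℝ] L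
  M : L →L[ℝ] L →L[ℝ] L
  inner_J : ∀ x y, ⟪J x, y⟫ = ⟪x, J y⟫
  inner_K : ∀ x y, ⟪K x, y⟫ = -⟪x, K y⟫
  J_K : ∀ x, J (K x) = K (J x)
  J_J_sub_K_K : ∀ x, J (J x) - K (K x) = x
  J_injective : ∀ x, J x = 0 → x = 0
  M_J_comm : ∀ x y, M (J x) y = M (J y) x
  inner_M : ∀ a b g, ⟪M a g, b⟫ = ⟪a, M b g⟫
  K_M : ∀ x y, K (M (J x) y) = J (M (K x) y + M (K y) x)

namespace BesselCalculus

variable {L : Type*} [NormedAddCommGroup L] [InnerProductSpace ℝ L] (𝒞 : BesselCalculus L)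

theorem norm_sq_J_add_norm_sq_K (x : L) : ‖𝒞.J x‖ ^ 2 + ‖𝒞.K x‖ ^ 2 = ‖x‖ ^ 2 := by
  have h : ⟪𝒞.J (𝒞.J x) - 𝒞.K (𝒞.K x), x⟫ = ⟪x, x⟫ := by rw [𝒞.J_J_sub_K_K]
  rw [inner_sub_left, 𝒞.inner_J, 𝒞.inner_K] at h
  simp only [real_inner_self_eq_norm_sq] at h
  linarith

theorem norm_J_le (x : L) : ‖𝒞.J x‖ ≤ ‖x‖ := by
  refine le_of_pow_le_pow_left₀ two_ne_zero (norm_nonneg _) ?_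
  nlinarith [𝒞.norm_sq_J_add_norm_sq_K x, sq_nonneg ‖𝒞.K x‖]

theorem norm_K_le (x : L) : ‖𝒞.K x‖ ≤ ‖x‖ := by
  refine le_of_pow_le_pow_left₀ two_ne_zero (norm_nonneg _) ?_
  nlinarith [𝒞.norm_sq_J_add_norm_sq_K x, sq_nonneg ‖𝒞.J x‖]

theorem norm_M_J_le (x y : L) : ‖𝒞.M (𝒞.J x) y‖ ≤ ‖𝒞.M‖ * ‖x‖ * ‖y‖ :=
  (𝒞.M.le_opNorm₂ _ _).trans (by gcongr; exact 𝒞.norm_J_le x)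

theorem J_pow_K (m : ℕ) (x : L) : (𝒞.J ^ m) (𝒞.K x) = 𝒞.K ((𝒞.J ^ m) x) := by
  induction m generalizing x with
  | zero => simp
  | succ m ih => rw [pow_succ, mul_apply_eq_comp, mul_apply_eq_comp,
      𝒞.J_K, ih]

theorem J_pow_succ (m : ℕ) (x : L) : (𝒞.J ^ (m + 1)) x = (𝒞.J ^ m) (𝒞.J x) := by
  rw [pow_succ, mul_apply_eq_comp]

theorem J_pow_succ' (m : ℕ) (x : L) : (𝒞.J ^ (m + 1)) x = 𝒞.J ((𝒞.J ^ m) x) := by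
  rw [pow_succ', mul_apply_eq_comp]

theorem J_pow_injective (m : ℕ) (x : L) (h : (𝒞.J ^ m) x = 0) : x = 0 := by
  induction m generalizing x with
  | zero => simpa using h
  | succ m ih => exact 𝒞.J_injective x (ih _ (by rwa [J_pow_succ] at h))

theorem inner_J_pow (m : ℕ) (x y : L) : ⟪(𝒞.J ^ m) x, y⟫ = ⟪x, (𝒞.J ^ m) y⟫ := by
  induction m generalizing x y with
  | zero => simp
  | succ m ih => rw [J_pow_succ, ih, inner_J, J_pow_succ']

theorem denseRange_J_pow [CompleteSpace L] (m : ℕ) : DenseRange (𝒞.J ^ m) :=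
  denseRange_of_symmetric_of_injective (𝒞.inner_J_pow m) (𝒞.J_pow_injective m)

/-- `g'` is the derivative of `g`, in the sense that `∂ (1 - ∂²)^(-1/2) g = (1 - ∂²)^(-1/2) g'`. -/
def IsDeriv (g g' : L) : Prop := 𝒞.K g = 𝒞.J g'

variable {𝒞}

/-- The identity J² - K² = 1 gives g = J (J g) - K (K g), and K g = J g'. An element of L² with
derivative in L² is thus J of an explicit element of L²; this is how membership in H¹ is used
throughout. -/
theorem IsDeriv.J_lift {g g' : L} (h : 𝒞.IsDeriv g g') : 𝒞.J (𝒞.J g - 𝒞.K g') = g := by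
  rw [map_sub, 𝒞.J_K, ← h, 𝒞.J_J_sub_K_K]

theorem IsDeriv.K_lift {g g' : L} (h : 𝒞.IsDeriv g g') : 𝒞.K (𝒞.J g - 𝒞.K g') = g' := by
  rw [map_sub, ← 𝒞.J_K, h, 𝒞.J_J_sub_K_K]

variable (𝒞)

theorem isDeriv_M (x y : L) :
    𝒞.IsDeriv (𝒞.M (𝒞.J x) y) (𝒞.M (𝒞.K x) y + 𝒞.M (𝒞.K y) x) := 𝒞.K_M x y

/-- The product maps the range of `J ^ m` to itself. -/
theorem exists_M_J_pow (m : ℕ) : ∃ N : L →L[ℝ] L →L[ℝ] L,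
    ∀ a g, 𝒞.M ((𝒞.J ^ m) a) ((𝒞.J ^ m) g) = (𝒞.J ^ m) (N a g) := by
  induction m with
  | zero => exact ⟨𝒞.M, by simp⟩
  | succ m ih =>
    obtain ⟨N, hN⟩ := ih
    -- By `J_lift` the product P equals J (J P - K P'). Both P and, by the Leibniz rule, P' are sums
    -- of products to which the induction hypothesis applies, so the outer J supplies the extra
    -- power.
    refine ⟨(ContinuousLinearMap.compL ℝ L L L 𝒞.J) ∘L N.bilinearComp 𝒞.J 𝒞.J
      - (ContinuousLinearMap.compL ℝ L L L 𝒞.K) ∘L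
        (N.bilinearComp 𝒞.K 𝒞.J + N.bilinearComp 𝒞.J 𝒞.K), fun a g => ?_⟩
    have h := (𝒞.isDeriv_M ((𝒞.J ^ m) a) (𝒞.J ((𝒞.J ^ m) g))).J_lift
    have h1 : 𝒞.M (𝒞.J ((𝒞.J ^ m) a)) (𝒞.J ((𝒞.J ^ m) g)) = (𝒞.J ^ m) (N (𝒞.J a) (𝒞.J g)) := by
      rw [← hN, ← J_pow_succ', ← J_pow_succ', ← J_pow_succ, ← J_pow_succ]
    have h2 : 𝒞.M (𝒞.K ((𝒞.J ^ m) a)) (𝒞.J ((𝒞.J ^ m) g)) = (𝒞.J ^ m) (N (𝒞.K a) (𝒞.J g)) := by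
      rw [← hN, ← J_pow_succ', ← J_pow_succ, J_pow_K]
    have h3 : 𝒞.M (𝒞.K (𝒞.J ((𝒞.J ^ m) g))) ((𝒞.J ^ m) a) = (𝒞.J ^ m) (N (𝒞.J a) (𝒞.K g)) := by
      rw [← hN, ← 𝒞.J_K, ← J_pow_K, 𝒞.M_J_comm, ← J_pow_succ, J_pow_succ']
    rw [J_pow_succ', J_pow_succ', ← h, h1, h2, h3, J_pow_succ']
    simp only [sub_apply, ContinuousLinearMap.coe_comp, Function.comp_apply,
      ContinuousLinearMap.compL_apply, ContinuousLinearMap.bilinearComp_apply,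
      add_apply, map_sub, map_add, J_pow_K]
    rw [← J_pow_succ, J_pow_succ']

/-- The curve `f` is continuous on `I` with values in the range of `J ^ m`, with the norm of that
range as a copy of `L`. -/
def RegOn (m : ℕ) (I : Set ℝ) (f : ℝ → L) : Prop :=
  ∃ F : ℝ → L, ContinuousOn F I ∧ ∀ r ∈ I, f r = (𝒞.J ^ m) (F r)

variable {𝒞} {m n : ℕ} {I : Set ℝ} {f g : ℝ → L}

theorem RegOn.congr (hf : 𝒞.RegOn m I f) (h : ∀ r ∈ I, g r = f r) : 𝒞.RegOn m I g := by
  obtain ⟨F, hF, hfF⟩ := hf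
  exact ⟨F, hF, fun r hr => by rw [h r hr, hfF r hr]⟩

theorem RegOn.sub (hf : 𝒞.RegOn m I f) (hg : 𝒞.RegOn m I g) :
    𝒞.RegOn m I (fun r => f r - g r) := by
  obtain ⟨F, hF, hfF⟩ := hf
  obtain ⟨G, hG, hgG⟩ := hg
  exact ⟨fun r => F r - G r, hF.sub hG, fun r hr => by beta_reduce; rw [hfF r hr, hgG r hr, map_sub]⟩

theorem RegOn.const_smul (c : ℝ) (hf : 𝒞.RegOn m I f) : 𝒞.RegOn m I (fun r => c • f r) := by
  obtain ⟨F, hF, hfF⟩ := hf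
  exact ⟨fun r => c • F r, hF.const_smul c, fun r hr => by beta_reduce; rw [hfF r hr, map_smul]⟩

theorem RegOn.K (hf : 𝒞.RegOn m I f) : 𝒞.RegOn m I (fun r => 𝒞.K (f r)) := by
  obtain ⟨F, hF, hfF⟩ := hf
  exact ⟨fun r => 𝒞.K (F r), 𝒞.K.continuous.comp_continuousOn hF,
    fun r hr => by beta_reduce; rw [hfF r hr, J_pow_K]⟩

theorem RegOn.J (hf : 𝒞.RegOn m I f) : 𝒞.RegOn (m + 1) I (fun r => 𝒞.J (f r)) := by
  obtain ⟨F, hF, hfF⟩ := hf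
  exact ⟨F, hF, fun r hr => by beta_reduce; rw [hfF r hr, J_pow_succ']⟩

theorem RegOn.mono (hf : 𝒞.RegOn m I f) (h : n ≤ m) : 𝒞.RegOn n I f := by
  obtain ⟨F, hF, hfF⟩ := hf
  refine ⟨fun r => (𝒞.J ^ (m - n)) (F r), (𝒞.J ^ (m - n)).continuous.comp_continuousOn hF,
    fun r hr => ?_⟩
  rw [hfF r hr, ← mul_apply_eq_comp, ← pow_add, Nat.add_sub_cancel' h]

theorem RegOn.M (hf : 𝒞.RegOn m I f) (hg : 𝒞.RegOn m I g) :
    𝒞.RegOn m I (fun r => 𝒞.M (f r) (g r)) := by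
  obtain ⟨F, hF, hfF⟩ := hf
  obtain ⟨G, hG, hgG⟩ := hg
  obtain ⟨N, hN⟩ := 𝒞.exists_M_J_pow m
  exact ⟨fun r => N (F r) (G r),
    (N.continuous.comp_continuousOn hF).clm_apply hG,
    fun r hr => by beta_reduce; rw [hfF r hr, hgG r hr, hN]⟩

/-- The linear system `w' = K q`, `q' = -q / r + K w - K h` preserves the regularity of its data. -/
theorem regOn_of_linear_system [CompleteSpace L] {a b : ℝ} (ha : 0 < a) (hab : a ≤ b)
    {w q h : ℝ → L} (hh : 𝒞.RegOn m (Icc a b) h)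
    (hw : ∀ r ∈ Icc a b, HasDerivWithinAt w (𝒞.K (q r)) (Icc a b) r)
    (hq : ∀ r ∈ Icc a b, HasDerivWithinAt q (-(r⁻¹ • q r) + 𝒞.K (w r) - 𝒞.K (h r)) (Icc a b) r)
    (hwa : w a ∈ Set.range (𝒞.J ^ m)) (hqa : q a ∈ Set.range (𝒞.J ^ m)) :
    𝒞.RegOn m (Icc a b) w ∧ 𝒞.RegOn m (Icc a b) q := by
  obtain ⟨H, hH, hhH⟩ := hh
  obtain ⟨w₀, hw₀⟩ := hwa
  obtain ⟨q₀, hq₀⟩ := hqa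
  set V : (ℝ → L) → ℝ → L × L → L × L := fun k r x =>
    (𝒞.K x.2, -(r⁻¹ • x.2) + 𝒞.K x.1 - 𝒞.K (k r)) with hV
  have hlip : ∀ k, ∀ r ∈ Icc a b, LipschitzWith (⟨a⁻¹ + 1, by positivity⟩) (V k r) := by
    intro k r hr
    refine LipschitzWith.of_dist_le_mul fun x y => ?_
    have h1 : ‖x.1 - y.1‖ ≤ ‖x - y‖ := norm_fst_le (x - y)
    have h2 : ‖x.2 - y.2‖ ≤ ‖x - y‖ := norm_snd_le (x - y)
    have hr' : r⁻¹ ≤ a⁻¹ := inv_anti₀ ha hr.1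
    have hr0 : 0 ≤ r⁻¹ := inv_nonneg.2 (ha.le.trans hr.1)
    have ha0 : 0 ≤ a⁻¹ := inv_nonneg.2 ha.le
    rw [dist_eq_norm, dist_eq_norm, Prod.norm_def]
    change max ‖𝒞.K x.2 - 𝒞.K y.2‖ ‖(-(r⁻¹ • x.2) + 𝒞.K x.1 - 𝒞.K (k r)) -
      (-(r⁻¹ • y.2) + 𝒞.K y.1 - 𝒞.K (k r))‖ ≤ (a⁻¹ + 1) * ‖x - y‖
    refine max_le ?_ ?_
    · rw [← map_sub]
      refine (𝒞.norm_K_le _).trans (h2.trans ?_)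
      nlinarith [norm_nonneg (x - y)]
    · have e : (-(r⁻¹ • x.2) + 𝒞.K x.1 - 𝒞.K (k r)) - (-(r⁻¹ • y.2) + 𝒞.K y.1 - 𝒞.K (k r))
          = -(r⁻¹ • (x.2 - y.2)) + 𝒞.K (x.1 - y.1) := by rw [map_sub]; module
      rw [e]
      calc _ ≤ r⁻¹ * ‖x.2 - y.2‖ + ‖x.1 - y.1‖ := by
            refine (norm_add_le _ _).trans ?_
            rw [norm_neg, norm_smul, Real.norm_of_nonneg hr0]
            gcongr; exact 𝒞.norm_K_le _
        _ ≤ a⁻¹ * ‖x - y‖ + ‖x - y‖ := by gcongr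
        _ = _ := by ring
  have hinv : ContinuousOn (fun r : ℝ => r⁻¹) (Icc a b) :=
    continuousOn_inv₀.mono fun r hr => (ha.trans_le hr.1).ne'
  -- The system is solved for the lifted data. Since J^m commutes with K, its image under J^m solves
  -- the original system, and uniqueness identifies it with (w, q).
  obtain ⟨α, hα0, hα⟩ := exists_solution_of_lipschitz hab (f := V H) (hlip H)
    (fun x => continuousOn_const.prodMk (((hinv.smul continuousOn_const).neg.add
      continuousOn_const).sub (𝒞.K.continuous.comp_continuousOn hH))) (w₀, q₀)
  have hα1 : ∀ r ∈ Icc a b, HasDerivWithinAt (fun r => (α r).1) (𝒞.K (α r).2) (Icc a b) r :=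
    fun r hr => (hα r hr).fst
  have hα2 : ∀ r ∈ Icc a b, HasDerivWithinAt (fun r => (α r).2)
      (-(r⁻¹ • (α r).2) + 𝒞.K (α r).1 - 𝒞.K (H r)) (Icc a b) r :=
    fun r hr => (hα r hr).snd
  have hJ : ∀ {u : ℝ → L} {u' : L} {r : ℝ}, HasDerivWithinAt u u' (Icc a b) r →
      HasDerivWithinAt (fun r => (𝒞.J ^ m) (u r)) ((𝒞.J ^ m) u') (Icc a b) r :=
    fun hu => (𝒞.J ^ m).hasFDerivAt.comp_hasDerivWithinAt _ hu
  have huniq := eqOn_of_lipschitz_of_hasDerivWithinAt (f := V h) (hlip h)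
    (α := fun r => (w r, q r)) (β := fun r => ((𝒞.J ^ m) (α r).1, (𝒞.J ^ m) (α r).2))
    (fun r hr => (hw r hr).prodMk (hq r hr))
    (fun r hr => by
      have h1 := hJ (hα1 r hr)
      have h2 := hJ (hα2 r hr)
      have := h1.prodMk h2
      rw [J_pow_K, map_sub, map_add, map_neg, map_smul, J_pow_K, J_pow_K, ← hhH r hr] at this
      exact this)
    (by simp [hα0, hw₀, hq₀])
  have hαc : ContinuousOn α (Icc a b) := fun r hr => (hα r hr).continuousWithinAt
  exact ⟨⟨fun r => (α r).1, continuous_fst.comp_continuousOn hαc,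
      fun r hr => congrArg Prod.fst (huniq hr)⟩,
    ⟨fun r => (α r).2, continuous_snd.comp_continuousOn hαc,
      fun r hr => congrArg Prod.snd (huniq hr)⟩⟩

variable (𝒞)

/-- `f`, with the derivative `g`, and `q` solve the first-order form
`∂_r (u - ∂_t² u + u²) = ∂_t q`, `∂_r q + q / r = ∂_t u` of the radial Boussinesq equation, where
`u = J f`. -/
structure IsSolutionOn (I : Set ℝ) (f g q : ℝ → L) : Prop where
  deriv_fst : ∀ r ∈ I, HasDerivWithinAt f (g r) I r
  deriv_snd : ∀ r ∈ I, HasDerivWithinAt q (-(r⁻¹ • q r) + 𝒞.K (f r)) I r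
  implicit : ∀ r ∈ I, g r + (2 : ℝ) • 𝒞.J (𝒞.M (𝒞.J (g r)) (f r)) = 𝒞.K (q r)

variable {𝒞} {q : ℝ → L}

theorem IsSolutionOn.hasDerivWithinAt (h : 𝒞.IsSolutionOn I f g q) {r : ℝ} (hr : r ∈ I) :
    HasDerivWithinAt (fun r => f r + 𝒞.J (𝒞.M (𝒞.J (f r)) (f r))) (𝒞.K (q r)) I r := by
  have h1 := h.deriv_fst r hr
  have h2 : HasDerivWithinAt (fun r => 𝒞.M (𝒞.J (f r)) (f r))
      (𝒞.M (𝒞.J (g r)) (f r) + 𝒞.M (𝒞.J (f r)) (g r)) I r :=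
    ((𝒞.M ∘L 𝒞.J).hasFDerivAt.comp_hasDerivWithinAt r h1).clm_apply h1
  have h3 := h1.add (𝒞.J.hasFDerivAt.comp_hasDerivWithinAt r h2)
  rw [𝒞.M_J_comm (f r) (g r), ← two_smul ℝ, map_smul, h.implicit r hr] at h3
  exact h3

/-- Persistence of regularity. -/
theorem IsSolutionOn.regOn [CompleteSpace L] {a b : ℝ} (ha : 0 < a) (hab : a ≤ b)
    (h : 𝒞.IsSolutionOn (Icc a b) f g q) (hg : ContinuousOn g (Icc a b))
    (hfa : f a ∈ Set.range (𝒞.J ^ m)) (hqa : q a ∈ Set.range (𝒞.J ^ m)) :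
    𝒞.RegOn m (Icc a b) f ∧ 𝒞.RegOn m (Icc a b) q ∧ 𝒞.RegOn m (Icc a b) g := by
  have hrange : ∀ {x : L} {j : ℕ}, j ≤ m → x ∈ Set.range (𝒞.J ^ m) → x ∈ Set.range (𝒞.J ^ j) := by
    rintro _ j hj ⟨y, rfl⟩
    exact ⟨(𝒞.J ^ (m - j)) y, by
      rw [← mul_apply_eq_comp, ← pow_add, Nat.add_sub_cancel' hj]⟩
  have hfq : ∀ j ≤ m, 𝒞.RegOn j (Icc a b) f ∧ 𝒞.RegOn j (Icc a b) q := by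
    intro j
    induction j with
    | zero =>
      exact fun _ => ⟨⟨f, fun r hr => (h.deriv_fst r hr).continuousWithinAt, by simp⟩,
        ⟨q, fun r hr => (h.deriv_snd r hr).continuousWithinAt, by simp⟩⟩
    | succ j ih =>
      intro hj
      obtain ⟨hf, -⟩ := ih (by omega)
      -- The quadratic term carries an outer J, so it is one degree more regular than f. As a source
      -- in the linear system it lets the induction advance by one.
      have hM : 𝒞.RegOn (j + 1) (Icc a b) (fun r => 𝒞.J (𝒞.M (𝒞.J (f r)) (f r))) :=
        ((hf.J.mono (Nat.le_succ j)).M hf).J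
      obtain ⟨hw, hq⟩ := regOn_of_linear_system ha hab hM (fun r hr => h.hasDerivWithinAt hr)
        (fun r hr => by
          have := h.deriv_snd r hr
          rwa [map_add, ← add_assoc, add_sub_cancel_right])
        (by
          obtain ⟨F, -, hF⟩ := hM
          obtain ⟨y, hy⟩ := hrange hj hfa
          exact ⟨y + F a, by rw [map_add, hy, ← hF a (left_mem_Icc.2 hab)]⟩)
        (hrange hj hqa)
      exact ⟨(hw.sub hM).congr fun r _ => by simp, hq⟩
  refine ⟨(hfq m le_rfl).1, (hfq m le_rfl).2, ?_⟩
  have hgj : ∀ j ≤ m, 𝒞.RegOn j (Icc a b) g := by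
    intro j
    induction j with
    | zero => exact fun _ => ⟨g, hg, by simp⟩
    | succ j ih =>
      intro hj
      have hgj := ih (by omega)
      -- The implicit equation is solved for g = K q - 2 J(...), whose last term again gains one
      -- degree.
      refine ((hfq (j + 1) hj).2.K.sub
        (((hgj.J.mono (Nat.le_succ j)).M (hfq j (by omega)).1).J.const_smul 2)).congr fun r hr => ?_
      rw [← h.implicit r hr, add_sub_cancel_right]
  exact hgj m le_rfl

end BesselCalculus

/-! ### The truncated flow and the energy of the error. -/

namespace BesselCalculus

variable {L : Type*} [NormedAddCommGroup L] [InnerProductSpace ℝ L] (𝒞 : BesselCalculus L)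

/-- The operator `x ↦ 2 (1 - ∂²)⁻¹ (u ·)` for `u = J f`, in terms of `J⁻¹`. -/
noncomputable def nonlin (f : L) : L →L[ℝ] L := (2 : ℝ) • (𝒞.J ∘L 𝒞.M.flip f ∘L 𝒞.J)

theorem nonlin_apply (f x : L) : 𝒞.nonlin f x = (2 : ℝ) • 𝒞.J (𝒞.M (𝒞.J x) f) := rfl

theorem nonlin_sub_apply (f f' x : L) :
    𝒞.nonlin (f - f') x = 𝒞.nonlin f x - 𝒞.nonlin f' x := by
  simp only [nonlin_apply, map_sub, smul_sub]

theorem norm_nonlin_le (f : L) : ‖𝒞.nonlin f‖ ≤ 2 * ‖𝒞.M‖ * ‖f‖ := by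
  refine ContinuousLinearMap.opNorm_le_bound _ (by positivity) fun x => ?_
  rw [nonlin_apply, norm_smul, Real.norm_of_nonneg zero_le_two]
  calc 2 * ‖𝒞.J (𝒞.M (𝒞.J x) f)‖ ≤ 2 * (‖𝒞.M‖ * ‖x‖ * ‖f‖) := by
        gcongr; exact (𝒞.norm_J_le _).trans (𝒞.norm_M_J_le x f)
    _ = _ := by ring

theorem add_nonlin_inverse_apply [CompleteSpace L] {f : L} (hf : 2 * ‖𝒞.M‖ * ‖f‖ ≤ 1 / 2) (x : L) :
    Ring.inverse (1 + 𝒞.nonlin f) x + 𝒞.nonlin f (Ring.inverse (1 + 𝒞.nonlin f) x) = x := by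
  have hu : IsUnit (1 + 𝒞.nonlin f) := by
    have := isUnit_one_sub_of_norm_lt_one (x := -𝒞.nonlin f)
      (by rw [norm_neg]; linarith [𝒞.norm_nonlin_le f])
    rwa [sub_neg_eq_add] at this
  have := congrArg (fun T : L →L[ℝ] L => T x) (Ring.mul_inverse_cancel _ hu)
  simpa [mul_apply_eq_comp] using this

theorem norm_le_of_add_nonlin {f x y : L} (hf : 2 * ‖𝒞.M‖ * ‖f‖ ≤ 1 / 2)
    (h : y + 𝒞.nonlin f y = x) : ‖y‖ ≤ 2 * ‖x‖ := by
  have h1 : ‖𝒞.nonlin f y‖ ≤ 1 / 2 * ‖y‖ :=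
    (𝒞.nonlin f).le_of_opNorm_le ((𝒞.norm_nonlin_le f).trans hf) y
  have h2 : ‖y‖ ≤ ‖x‖ + ‖𝒞.nonlin f y‖ := by
    rw [← h]; simpa using norm_sub_le (y + 𝒞.nonlin f y) (𝒞.nonlin f y)
  linarith

/-- Truncating f and q makes the implicit relation uniquely solvable for g, with g Lipschitz in (f,
q). The flow is then global, and it is the true one wherever f and q are small. The threshold is
independent of the interval and of the data. -/
theorem exists_solution_of_small [CompleteSpace L] : ∃ δ > 0, ∀ a b : ℝ, 0 < a → a ≤ b →
    ∀ f₀ q₀ : L, ∃ f g q : ℝ → L, f a = f₀ ∧ q a = q₀ ∧ ContinuousOn g (Icc a b) ∧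
      (∀ r ∈ Icc a b, HasDerivWithinAt f (g r) (Icc a b) r) ∧
      (∀ r ∈ Icc a b, HasDerivWithinAt q (-(r⁻¹ • q r) + 𝒞.K (f r)) (Icc a b) r) ∧
      ∀ r ∈ Icc a b, ‖f r‖ ≤ δ → ‖q r‖ ≤ δ →
        g r + (2 : ℝ) • 𝒞.J (𝒞.M (𝒞.J (g r)) (f r)) = 𝒞.K (q r) := by
  -- Makes the norm of `nonlin` at most 1/2 on the ball of radius δ.
  set δ : ℝ := 1 / (4 * (‖𝒞.M‖ + 1)) with hδ
  have hδ0 : 0 < δ := by positivity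
  have hsmall : ∀ f : L, 2 * ‖𝒞.M‖ * ‖radialRetract δ f‖ ≤ 1 / 2 := fun f => by
    have h1 := norm_radialRetract_le hδ0 f
    have h2 : 2 * (‖𝒞.M‖ + 1) * δ = 1 / 2 := by rw [hδ]; field_simp; norm_num
    nlinarith [norm_nonneg 𝒞.M, norm_nonneg (radialRetract δ f)]
  refine ⟨δ, hδ0, fun a b ha hab f₀ q₀ => ?_⟩
  set Y : L × L → L := fun x =>
    Ring.inverse (1 + 𝒞.nonlin (radialRetract δ x.1)) (𝒞.K (radialRetract δ x.2)) with hY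
  have hYeq : ∀ x, Y x + 𝒞.nonlin (radialRetract δ x.1) (Y x) = 𝒞.K (radialRetract δ x.2) :=
    fun x => 𝒞.add_nonlin_inverse_apply (hsmall _) _
  have hYb : ∀ x, ‖Y x‖ ≤ 2 * δ := fun x =>
    (𝒞.norm_le_of_add_nonlin (hsmall _) (hYeq x)).trans (by
      gcongr; exact (𝒞.norm_K_le _).trans (norm_radialRetract_le hδ0 _))
  set c : ℝ := 4 + 16 * ‖𝒞.M‖ * δ with hc
  have hYlip : ∀ x y, ‖Y x - Y y‖ ≤ c * ‖x - y‖ := by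
    intro x y
    have h1 : ‖x.1 - y.1‖ ≤ ‖x - y‖ := norm_fst_le (x - y)
    have h2 : ‖x.2 - y.2‖ ≤ ‖x - y‖ := norm_snd_le (x - y)
    have r1 : ‖radialRetract δ y.1 - radialRetract δ x.1‖ ≤ 2 * ‖x - y‖ := by
      have := (lipschitzWith_radialRetract (X := L) hδ0).dist_le_mul x.1 y.1
      rw [dist_comm, dist_eq_norm, dist_eq_norm] at this
      exact this.trans (by simpa using h1)
    have r2 : ‖radialRetract δ x.2 - radialRetract δ y.2‖ ≤ 2 * ‖x - y‖ := by
      have := (lipschitzWith_radialRetract (X := L) hδ0).dist_le_mul x.2 y.2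
      rw [dist_eq_norm, dist_eq_norm] at this
      exact this.trans (by simpa using h2)
    -- The difference of two solutions solves the same implicit equation, with the change of the
    -- data and of the coefficient on the right.
    have e : (Y x - Y y) + 𝒞.nonlin (radialRetract δ x.1) (Y x - Y y) =
        𝒞.K (radialRetract δ x.2 - radialRetract δ y.2) +
          𝒞.nonlin (radialRetract δ y.1 - radialRetract δ x.1) (Y y) := by
      rw [map_sub 𝒞.K, ← hYeq x, ← hYeq y, nonlin_sub_apply, map_sub]; abel
    refine (𝒞.norm_le_of_add_nonlin (hsmall _) e).trans ?_
    have hn : ‖𝒞.nonlin (radialRetract δ y.1 - radialRetract δ x.1) (Y y)‖ ≤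
        2 * ‖𝒞.M‖ * (2 * ‖x - y‖) * (2 * δ) :=
      ((𝒞.nonlin _).le_opNorm _).trans (by
        gcongr
        · exact (𝒞.norm_nonlin_le _).trans (by gcongr)
        · exact hYb y)
    calc _ ≤ 2 * (2 * ‖x - y‖ + 2 * ‖𝒞.M‖ * (2 * ‖x - y‖) * (2 * δ)) := by
          gcongr
          exact (norm_add_le _ _).trans (add_le_add ((𝒞.norm_K_le _).trans r2) hn)
      _ = c * ‖x - y‖ := by rw [hc]; ring
  have hc0 : 0 ≤ c := by positivity
  obtain ⟨α, hα0, hα⟩ := exists_solution_of_lipschitz hab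
    (f := fun r (x : L × L) => (Y x, -(r⁻¹ • x.2) + 𝒞.K x.1))
    (K := ⟨c + a⁻¹ + 1, by positivity⟩)
    (fun r hr => by
      refine LipschitzWith.of_dist_le_mul fun x y => ?_
      have h1 : ‖x.1 - y.1‖ ≤ ‖x - y‖ := norm_fst_le (x - y)
      have h2 : ‖x.2 - y.2‖ ≤ ‖x - y‖ := norm_snd_le (x - y)
      have hr' : r⁻¹ ≤ a⁻¹ := inv_anti₀ ha hr.1
      have hr0 : 0 ≤ r⁻¹ := inv_nonneg.2 (ha.le.trans hr.1)
      have ha0 : 0 ≤ a⁻¹ := inv_nonneg.2 ha.le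
      rw [dist_eq_norm, dist_eq_norm, Prod.norm_def]
      change max ‖Y x - Y y‖ ‖(-(r⁻¹ • x.2) + 𝒞.K x.1) - (-(r⁻¹ • y.2) + 𝒞.K y.1)‖ ≤
        (c + a⁻¹ + 1) * ‖x - y‖
      refine max_le ?_ ?_
      · refine (hYlip x y).trans ?_
        nlinarith [norm_nonneg (x - y)]
      · have e : (-(r⁻¹ • x.2) + 𝒞.K x.1) - (-(r⁻¹ • y.2) + 𝒞.K y.1)
            = -(r⁻¹ • (x.2 - y.2)) + 𝒞.K (x.1 - y.1) := by rw [map_sub]; module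
        rw [e]
        calc _ ≤ r⁻¹ * ‖x.2 - y.2‖ + ‖x.1 - y.1‖ := by
              refine (norm_add_le _ _).trans ?_
              rw [norm_neg, norm_smul, Real.norm_of_nonneg hr0]
              gcongr; exact 𝒞.norm_K_le _
          _ ≤ a⁻¹ * ‖x - y‖ + ‖x - y‖ := by gcongr
          _ ≤ _ := by nlinarith [norm_nonneg (x - y), mul_nonneg hc0 (norm_nonneg (x - y))])
    (fun x => continuousOn_const.prodMk (((continuousOn_inv₀.mono
      fun r hr => (ha.trans_le hr.1).ne').smul continuousOn_const).neg.add continuousOn_const))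
    (f₀, q₀)
  have hαc : ContinuousOn α (Icc a b) := fun r hr => (hα r hr).continuousWithinAt
  have hYc : Continuous Y :=
    (LipschitzWith.of_dist_le_mul (K := ⟨c, hc0⟩) fun x y => by
      rw [dist_eq_norm, dist_eq_norm]; exact hYlip x y).continuous
  refine ⟨fun r => (α r).1, fun r => Y (α r), fun r => (α r).2, by simp [hα0], by simp [hα0],
    hYc.comp_continuousOn hαc, fun r hr => (hα r hr).fst, fun r hr => (hα r hr).snd,
    fun r hr hf hq => ?_⟩
  have := hYeq (α r)
  rwa [radialRetract_of_norm_le hδ0 hf, radialRetract_of_norm_le hδ0 hq] at this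

/-- The trilinear form `∫ (J x) (J y) (J z)`. -/
noncomputable def tri (x y z : L) : ℝ := ⟪𝒞.M (𝒞.J x) y, 𝒞.J z⟫

theorem tri_swap_left (x y z : L) : 𝒞.tri x y z = 𝒞.tri y x z := by
  rw [tri, tri, 𝒞.M_J_comm]

theorem tri_swap_outer (x y z : L) : 𝒞.tri x y z = 𝒞.tri z y x := by
  rw [tri, tri, 𝒞.inner_M, real_inner_comm]

theorem tri_swap_right (x y z : L) : 𝒞.tri x y z = 𝒞.tri x z y := by
  rw [tri_swap_left, tri_swap_outer, tri_swap_left]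

/-- One factor is measured by the norm of multiplication by it, the others in L². For the
approximate solution this yields sup bounds of order ε² and, for its r-derivative, ε³. The L² norm
of that derivative is larger by ε^(-1/2), too large for Grönwall over a length ε⁻³. -/
theorem abs_tri_le {x y z : L} {c : ℝ} (hy : ∀ a, ‖𝒞.M a y‖ ≤ c * ‖a‖) :
    |𝒞.tri x y z| ≤ c * ‖x‖ * ‖z‖ := by
  have h1 : ‖𝒞.M (𝒞.J x) y‖ ≤ c * ‖x‖ := by
    rcases eq_or_ne x 0 with rfl | hx
    · simp
    · have hc : 0 ≤ c := by
        have := (norm_nonneg _).trans (hy x)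
        exact nonneg_of_mul_nonneg_left this (norm_pos_iff.2 hx)
      exact (hy _).trans (by gcongr; exact 𝒞.norm_J_le x)
  exact (abs_real_inner_le_norm _ _).trans
    (mul_le_mul h1 (𝒞.norm_J_le z) (norm_nonneg _) ((norm_nonneg _).trans h1))

variable {𝒞} in
theorem hasDerivWithinAt_tri {x y z : ℝ → L} {x' y' z' : L} {I : Set ℝ} {r : ℝ}
    (hx : HasDerivWithinAt x x' I r) (hy : HasDerivWithinAt y y' I r)
    (hz : HasDerivWithinAt z z' I r) :
    HasDerivWithinAt (fun r => 𝒞.tri (x r) (y r) (z r))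
      (𝒞.tri x' (y r) (z r) + 𝒞.tri (x r) y' (z r) + 𝒞.tri (x r) (y r) z') I r := by
  have h1 : HasDerivWithinAt (fun r => 𝒞.M (𝒞.J (x r)) (y r))
      (𝒞.M (𝒞.J x') (y r) + 𝒞.M (𝒞.J (x r)) y') I r :=
    ((𝒞.M ∘L 𝒞.J).hasFDerivAt.comp_hasDerivWithinAt r hx).clm_apply hy
  have h2 := h1.inner ℝ (𝒞.J.hasFDerivAt.comp_hasDerivWithinAt r hz)
  refine h2.congr_deriv ?_
  simp only [tri, inner_add_left, Function.comp_apply]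
  ring

/-- The energy of an error `(R, Z)` about an approximation `ψ`. -/
noncomputable def energy (ψ R Z : L) : ℝ :=
  1 / 2 * ⟪R, R⟫ + 1 / 2 * ⟪Z, Z⟫ + 𝒞.tri ψ R R + 2 / 3 * 𝒞.tri R R R

variable {𝒞} in
theorem hasDerivWithinAt_energy {ψ R Z : ℝ → L} {ψ' R' Z' : L} {I : Set ℝ} {r : ℝ}
    (hψ : HasDerivWithinAt ψ ψ' I r) (hR : HasDerivWithinAt R R' I r)
    (hZ : HasDerivWithinAt Z Z' I r) :
    HasDerivWithinAt (fun r => 𝒞.energy (ψ r) (R r) (Z r))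
      (⟪R r, R'⟫ + ⟪Z r, Z'⟫ + 𝒞.tri ψ' (R r) (R r) + 2 * 𝒞.tri (ψ r) R' (R r)
        + 2 * 𝒞.tri (R r) R' (R r)) I r := by
  have h := ((((hR.inner ℝ hR).const_mul (1 / 2)).add ((hZ.inner ℝ hZ).const_mul (1 / 2))).add
    (hasDerivWithinAt_tri (𝒞 := 𝒞) hψ hR hR)).add
    ((hasDerivWithinAt_tri (𝒞 := 𝒞) hR hR hR).const_mul (2 / 3))
  refine h.congr_deriv ?_
  rw [real_inner_comm (R r) R', real_inner_comm (Z r) Z', 𝒞.tri_swap_right (ψ r) (R r) R',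
    𝒞.tri_swap_right (R r) (R r) R', 𝒞.tri_swap_left R' (R r) (R r)]
  ring

/-- The energy identity. -/
theorem energy_identity {f g q ψ ψ' Q Q' F G : L} {r : ℝ}
    (hg : g + (2 : ℝ) • 𝒞.J (𝒞.M (𝒞.J g) f) = 𝒞.K q)
    (hψ : ψ' + (2 : ℝ) • 𝒞.J (𝒞.M (𝒞.J ψ') ψ) = 𝒞.K Q + 𝒞.J F)
    (hQ : Q' = -(r⁻¹ • Q) + 𝒞.K ψ + G) :
    ⟪f - ψ, g - ψ'⟫ + ⟪q - Q, (-(r⁻¹ • q) + 𝒞.K f) - Q'⟫ + 𝒞.tri ψ' (f - ψ) (f - ψ)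
        + 2 * 𝒞.tri ψ (g - ψ') (f - ψ) + 2 * 𝒞.tri (f - ψ) (g - ψ') (f - ψ) =
      -𝒞.tri ψ' (f - ψ) (f - ψ) - r⁻¹ * ‖q - Q‖ ^ 2 - ⟪𝒞.J (f - ψ), F⟫ - ⟪q - Q, G⟫ := by
  obtain ⟨R, rfl⟩ : ∃ R, f = ψ + R := ⟨f - ψ, by abel⟩
  obtain ⟨Z, rfl⟩ : ∃ Z, q = Q + Z := ⟨q - Q, by abel⟩
  obtain ⟨R', rfl⟩ : ∃ R', g = ψ' + R' := ⟨g - ψ', by abel⟩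
  simp only [add_sub_cancel_left]
  -- The approximate equation subtracted from the exact one and solved for R'.
  have hR : R' = 𝒞.K Z - 𝒞.J F - (2 : ℝ) • 𝒞.J (𝒞.M (𝒞.J ψ') R + 𝒞.M (𝒞.J R') ψ
      + 𝒞.M (𝒞.J R') R) := by
    have : R' = (ψ' + R' + (2 : ℝ) • 𝒞.J (𝒞.M (𝒞.J (ψ' + R')) (ψ + R)))
      - (ψ' + (2 : ℝ) • 𝒞.J (𝒞.M (𝒞.J ψ') ψ)) - (2 : ℝ) • 𝒞.J (𝒞.M (𝒞.J ψ') R + 𝒞.M (𝒞.J R') ψ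
      + 𝒞.M (𝒞.J R') R) := by
      simp only [map_add, add_apply, smul_add]; abel
    refine this.trans ?_
    rw [hg, hψ, map_add]; abel
  have h1 : ⟪R, R'⟫ = ⟪R, 𝒞.K Z⟫ - ⟪𝒞.J R, F⟫ - 2 * (𝒞.tri ψ' R R + 𝒞.tri R' ψ R
      + 𝒞.tri R' R R) := by
    have ht : ∀ x y, ⟪R, 𝒞.J (𝒞.M (𝒞.J x) y)⟫ = 𝒞.tri x y R := fun x y => by
      rw [← 𝒞.inner_J, real_inner_comm]; rfl
    conv_lhs => rw [hR]
    rw [inner_sub_right, inner_sub_right, inner_smul_right, map_add, map_add, inner_add_right,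
      inner_add_right, ht, ht, ht, ← 𝒞.inner_J]
  have h2 : -(r⁻¹ • (Q + Z)) + 𝒞.K (ψ + R) - Q' = -(r⁻¹ • Z) + 𝒞.K R - G := by
    rw [hQ, map_add, smul_add]; abel
  have h3 : ⟪R, 𝒞.K Z⟫ = -⟪Z, 𝒞.K R⟫ := by
    rw [← neg_eq_iff_eq_neg, ← 𝒞.inner_K, real_inner_comm]
  -- The terms in K cancel by antisymmetry. Every cubic term containing R' is matched by one from
  -- the derivative of the energy, leaving a single ψ' term.
  rw [h1, h2, h3, 𝒞.tri_swap_left R' ψ R, 𝒞.tri_swap_left R' R R]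
  simp only [inner_sub_right, inner_add_right, inner_neg_right, inner_smul_right,
    real_inner_self_eq_norm_sq]
  ring

end BesselCalculus

/-! ### Energy estimates and existence on the long interval. -/

namespace BesselCalculus

variable {L : Type*} [NormedAddCommGroup L] [InnerProductSpace ℝ L] (𝒞 : BesselCalculus L)

/-- Coercivity: small sup norm of the approximation and small ‖R‖ make the cubic integrals a
perturbation, so the energy lies between 1/4 and 3/4 of ‖R‖² + ‖Z‖². -/
theorem abs_energy_sub_le {ψ R Z : L} {c η : ℝ} (hψ : ∀ a, ‖𝒞.M a ψ‖ ≤ c * ‖a‖)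
    (hc : c ≤ 1 / 8) (hη : (‖𝒞.M‖ + 1) * η ≤ 1 / 8) (hR : ‖R‖ ≤ η) :
    |𝒞.energy ψ R Z - 1 / 2 * (‖R‖ ^ 2 + ‖Z‖ ^ 2)| ≤ 1 / 4 * (‖R‖ ^ 2 + ‖Z‖ ^ 2) := by
  have h1 : |𝒞.tri ψ R R| ≤ 1 / 8 * ‖R‖ ^ 2 := by
    rw [tri_swap_left]
    refine (𝒞.abs_tri_le hψ).trans ?_
    rw [mul_assoc, ← sq]
    gcongr
  have h2 : |𝒞.tri R R R| ≤ 1 / 8 * ‖R‖ ^ 2 := by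
    refine (𝒞.abs_tri_le (c := ‖𝒞.M‖ * ‖R‖) fun a => ?_).trans ?_
    · rw [mul_right_comm]; exact 𝒞.M.le_opNorm₂ a R
    · rw [mul_assoc, ← sq]
      gcongr
      nlinarith [norm_nonneg 𝒞.M, norm_nonneg R]
  have e : 𝒞.energy ψ R Z - 1 / 2 * (‖R‖ ^ 2 + ‖Z‖ ^ 2) =
      𝒞.tri ψ R R + 2 / 3 * 𝒞.tri R R R := by
    simp only [energy, real_inner_self_eq_norm_sq]; ring
  rw [e, abs_le]
  rw [abs_le] at h1 h2
  constructor <;> nlinarith [sq_nonneg ‖R‖, sq_nonneg ‖Z‖]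

/-- The products with the residuals are split with weight ε³, the largest growth rate that an
interval of length ε⁻³ tolerates; this turns ε¹³ into ε¹⁰. The term with r⁻¹ is damping and is
dropped. -/
theorem energy_deriv_le {ψ' R Z F G : L} {C ε r : ℝ} (hC : 0 < C) (hε : 0 < ε) (hr : 0 < r)
    (hψ' : ∀ a, ‖𝒞.M a ψ'‖ ≤ C * ε ^ 3 * ‖a‖) (hF : ‖F‖ ^ 2 ≤ C * ε ^ 13)
    (hG : ‖G‖ ^ 2 ≤ C * ε ^ 13) :
    -𝒞.tri ψ' R R - r⁻¹ * ‖Z‖ ^ 2 - ⟪𝒞.J R, F⟫ - ⟪Z, G⟫ ≤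
      (C + 1) * ε ^ 3 * (‖R‖ ^ 2 + ‖Z‖ ^ 2) + C * ε ^ 10 := by
  have hε3 : 0 < ε ^ 3 := by positivity
  have h1 : -𝒞.tri ψ' R R ≤ C * ε ^ 3 * ‖R‖ ^ 2 := by
    rw [tri_swap_left]
    refine (neg_le_abs _).trans ((𝒞.abs_tri_le hψ').trans (le_of_eq (by ring)))
  have h2 : 0 ≤ r⁻¹ * ‖Z‖ ^ 2 := by positivity
  have amgm : ∀ x y : ℝ, y ^ 2 ≤ C * ε ^ 13 → 2 * (x * y) ≤ ε ^ 3 * x ^ 2 + C * ε ^ 10 := by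
    intro x y hy
    have : ε ^ 3 * (2 * (x * y)) ≤ ε ^ 3 * (ε ^ 3 * x ^ 2 + C * ε ^ 10) := by
      nlinarith [sq_nonneg (ε ^ 3 * x - y)]
    exact le_of_mul_le_mul_left this hε3
  have h3 : -⟪𝒞.J R, F⟫ ≤ ‖R‖ * ‖F‖ := (neg_le_abs _).trans
    ((abs_real_inner_le_norm _ _).trans (by gcongr; exact 𝒞.norm_J_le R))
  have h4 : -⟪Z, G⟫ ≤ ‖Z‖ * ‖G‖ := (neg_le_abs _).trans (abs_real_inner_le_norm _ _)
  have h5 := amgm ‖R‖ ‖F‖ hF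
  have h6 := amgm ‖Z‖ ‖G‖ hG
  have h7 : 0 ≤ ε ^ 3 * ‖R‖ ^ 2 := by positivity
  have h8 : 0 ≤ ε ^ 3 * ‖Z‖ ^ 2 := by positivity
  have h9 : 0 ≤ C * (ε ^ 3 * ‖Z‖ ^ 2) := by positivity
  nlinarith

set_option maxHeartbeats 800000 in
/-- Near an approximate solution with small residuals there is a solution, of any regularity. -/
theorem exists_solution_near [CompleteSpace L] {C ρ₀ ρ₁ : ℝ} (hC : 0 < C) (hρ₀ : 0 < ρ₀)
    (hρ₁ : ρ₀ < ρ₁) :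
    ∃ ε₀ > (0 : ℝ), ∃ C₀ > (0 : ℝ), ∀ ε ∈ Ioo 0 ε₀, ∀ a b : ℝ, a = ρ₀ * (ε ^ 3)⁻¹ →
      b = ρ₁ * (ε ^ 3)⁻¹ → ∀ ψ ψ' Q Q' F G : ℝ → L,
      (∀ r ∈ Icc a b, HasDerivWithinAt ψ (ψ' r) (Icc a b) r) →
      (∀ r ∈ Icc a b, HasDerivWithinAt Q (Q' r) (Icc a b) r) →
      (∀ r ∈ Icc a b,
        ψ' r + (2 : ℝ) • 𝒞.J (𝒞.M (𝒞.J (ψ' r)) (ψ r)) = 𝒞.K (Q r) + 𝒞.J (F r)) →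
      (∀ r ∈ Icc a b, Q' r = -(r⁻¹ • Q r) + 𝒞.K (ψ r) + G r) →
      (∀ r ∈ Icc a b, ∀ x, ‖𝒞.M x (ψ r)‖ ≤ C * ε ^ 2 * ‖x‖) →
      (∀ r ∈ Icc a b, ∀ x, ‖𝒞.M x (ψ' r)‖ ≤ C * ε ^ 3 * ‖x‖) →
      (∀ r ∈ Icc a b, ‖ψ r‖ ≤ C * ε) → (∀ r ∈ Icc a b, ‖Q r‖ ≤ C * ε) →
      (∀ r ∈ Icc a b, ‖F r‖ ^ 2 ≤ C * ε ^ 13) → (∀ r ∈ Icc a b, ‖G r‖ ^ 2 ≤ C * ε ^ 13) →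
      ∀ m : ℕ, ∃ f g q : ℝ → L, 𝒞.IsSolutionOn (Icc a b) f g q ∧
        𝒞.RegOn m (Icc a b) f ∧ 𝒞.RegOn m (Icc a b) g ∧
        ∀ r ∈ Icc a b, ‖f r - ψ r‖ ^ 2 ≤ C₀ * ε ^ 7 := by
  obtain ⟨δ, hδ, hsol⟩ := 𝒞.exists_solution_of_small
  -- An error below δ/2 plus an approximation below δ/2 keeps the truncation inactive; the second
  -- bound makes the cubic part of the energy small.
  set η : ℝ := min (δ / 2) (1 / (8 * (‖𝒞.M‖ + 1))) with hη
  have hη0 : 0 < η := by positivity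
  have hηδ : η ≤ δ / 2 := min_le_left _ _
  have hηM : (‖𝒞.M‖ + 1) * η ≤ 1 / 8 := by
    have h1 : η ≤ 1 / (8 * (‖𝒞.M‖ + 1)) := min_le_right _ _
    calc (‖𝒞.M‖ + 1) * η ≤ (‖𝒞.M‖ + 1) * (1 / (8 * (‖𝒞.M‖ + 1))) := by gcongr
      _ = 1 / 8 := by field_simp
  -- The Grönwall rate 4(C + 1)ε³ times the length (ρ₁ - ρ₀)ε⁻³.
  set Λ : ℝ := 4 * (C + 1) * (ρ₁ - ρ₀) with hΛ
  have hΛ0 : 0 < Λ := mul_pos (by positivity) (sub_pos.2 hρ₁)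
  have hexp1 : 1 ≤ Real.exp Λ := Real.one_le_exp hΛ0.le
  -- In turn: to compare powers of ε; Cε < δ/2; Cε² ≤ 1/8 for coercivity; and 8 exp(Λ) ε⁷ < η² to
  -- close the continuity argument.
  refine ⟨min (min 1 (δ / (2 * C))) (min (1 / (8 * C)) (η ^ 2 / (8 * Real.exp Λ))),
    by positivity, 8 * Real.exp Λ, by positivity, ?_⟩
  rintro ε ⟨hε, hεlt⟩ a b ha hb ψ ψ' Q Q' F G hψ hQ heq1 heq2 hMψ hMψ' hψb hQb hF hG m
  obtain ⟨⟨hε1, hε2⟩, hε3, hε4⟩ :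
      (ε < 1 ∧ ε < δ / (2 * C)) ∧ ε < 1 / (8 * C) ∧ ε < η ^ 2 / (8 * Real.exp Λ) := by
    simpa [lt_min_iff] using hεlt
  rw [lt_div_iff₀ (by positivity)] at hε2 hε3 hε4
  have hε7 : ε ^ 7 ≤ ε := by simpa using pow_le_pow_of_le_one hε.le hε1.le (show 1 ≤ 7 by norm_num)
  have hε22 : ε ^ 2 ≤ ε := by
    simpa using pow_le_pow_of_le_one hε.le hε1.le (show 1 ≤ 2 by norm_num)
  have hsmall : 8 * Real.exp Λ * ε ^ 7 < η ^ 2 := by nlinarith [Real.exp_pos Λ]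
  have hε3p : 0 < (ε ^ 3)⁻¹ := by positivity
  have ha0 : 0 < a := ha ▸ mul_pos hρ₀ hε3p
  have hab : a ≤ b := by rw [ha, hb]; gcongr
  have haI : a ∈ Icc a b := left_mem_Icc.2 hab
  -- Regular data at distance O(ε^(7/2)), within the error allowed at the end.
  have hdense : ∀ x : L, ∃ y ∈ Set.range (𝒞.J ^ m), ‖y - x‖ ^ 2 ≤ 1 / 2 * ε ^ 7 := by
    intro x
    obtain ⟨y, hy, hyx⟩ := Metric.dense_iff.1 (𝒞.denseRange_J_pow m) x (Real.sqrt (1 / 2 * ε ^ 7))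
      (by positivity)
    refine ⟨y, hyx, ?_⟩
    rw [mem_ball_iff_norm, Real.lt_sqrt (norm_nonneg _)] at hy
    exact hy.le
  obtain ⟨f₀, hf₀r, hf₀⟩ := hdense (ψ a)
  obtain ⟨q₀, hq₀r, hq₀⟩ := hdense (Q a)
  obtain ⟨f, g, q, hfa, hqa, hgc, hf', hq', himp⟩ := hsol a b ha0 hab f₀ q₀
  set N : ℝ → ℝ := fun r => ‖f r - ψ r‖ ^ 2 + ‖q r - Q r‖ ^ 2 with hN
  have hR' : ∀ r ∈ Icc a b, HasDerivWithinAt (fun r => f r - ψ r) (g r - ψ' r) (Icc a b) r :=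
    fun r hr => (hf' r hr).sub (hψ r hr)
  have hZ' : ∀ r ∈ Icc a b, HasDerivWithinAt (fun r => q r - Q r)
      ((-(r⁻¹ • q r) + 𝒞.K (f r)) - Q' r) (Icc a b) r :=
    fun r hr => (hq' r hr).sub (hQ r hr)
  have hNc : ContinuousOn N (Icc a b) := fun r hr =>
    ((hR' r hr).continuousWithinAt.norm.pow 2).add ((hZ' r hr).continuousWithinAt.norm.pow 2)
  have hNlt : ∀ r, N r < η ^ 2 → ‖f r - ψ r‖ ≤ η ∧ ‖q r - Q r‖ ≤ η := fun r h => by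
    simp only [hN] at h
    constructor <;> refine le_of_sq_le_sq ?_ hη0.le <;>
      nlinarith [sq_nonneg ‖f r - ψ r‖, sq_nonneg ‖q r - Q r‖]
  have hexact : ∀ r ∈ Icc a b, N r < η ^ 2 →
      g r + (2 : ℝ) • 𝒞.J (𝒞.M (𝒞.J (g r)) (f r)) = 𝒞.K (q r) := fun r hr h => by
    obtain ⟨h1, h2⟩ := hNlt r h
    refine himp r hr ?_ ?_
    · calc ‖f r‖ = ‖(f r - ψ r) + ψ r‖ := by rw [sub_add_cancel]
        _ ≤ η + C * ε := (norm_add_le _ _).trans (add_le_add h1 (hψb r hr))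
        _ ≤ δ := by linarith
    · calc ‖q r‖ = ‖(q r - Q r) + Q r‖ := by rw [sub_add_cancel]
        _ ≤ η + C * ε := (norm_add_le _ _).trans (add_le_add h2 (hQb r hr))
        _ ≤ δ := by linarith
  have hen : ∀ r ∈ Icc a b, N r < η ^ 2 →
      |𝒞.energy (ψ r) (f r - ψ r) (q r - Q r) - 1 / 2 * N r| ≤ 1 / 4 * N r := fun r hr h =>
    𝒞.abs_energy_sub_le (hMψ r hr) (by nlinarith) hηM (hNlt r h).1
  set E : ℝ → ℝ := fun r => 𝒞.energy (ψ r) (f r - ψ r) (q r - Q r) with hE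
  set E' : ℝ → ℝ := fun r => ⟪f r - ψ r, g r - ψ' r⟫ +
    ⟪q r - Q r, (-(r⁻¹ • q r) + 𝒞.K (f r)) - Q' r⟫ + 𝒞.tri (ψ' r) (f r - ψ r) (f r - ψ r)
    + 2 * 𝒞.tri (ψ r) (g r - ψ' r) (f r - ψ r)
    + 2 * 𝒞.tri (f r - ψ r) (g r - ψ' r) (f r - ψ r) with hE'
  have hEd : ∀ r ∈ Icc a b, HasDerivWithinAt E (E' r) (Icc a b) r := fun r hr =>
    hasDerivWithinAt_energy (hψ r hr) (hR' r hr) (hZ' r hr)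
  have hEc : ContinuousOn E (Icc a b) := fun r hr => (hEd r hr).continuousWithinAt
  have hNa : N a ≤ ε ^ 7 := by
    simp only [hN, hfa, hqa]; linarith
  have hNaη : N a < η ^ 2 := by nlinarith [pow_pos hε 7]
  have hmain : ∀ r ∈ Icc a b, (∀ s ∈ Ico a r, N s < η ^ 2) → E r ≤ 2 * Real.exp Λ * ε ^ 7 := by
    intro r hr hs
    have hsub : Icc a r ⊆ Icc a b := Icc_subset_Icc_right hr.2
    have hgr := gronwall_of_hasDerivWithinAt (a := a) (b := r) (c := 4 * (C + 1) * ε ^ 3)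
      (d := C * ε ^ 10) (by positivity) (E := E) (E' := E')
      (fun s hs => (hEd s (hsub hs)).mono hsub)
      (fun s hs' => by
        have hsI := hsub (Ico_subset_Icc_self hs')
        have h1 := 𝒞.energy_identity (hexact s hsI (hs s hs')) (heq1 s hsI) (heq2 s hsI)
        have h2 := 𝒞.energy_deriv_le (R := f s - ψ s) (Z := q s - Q s) hC hε
          (ha0.trans_le hsI.1) (hMψ' s hsI) (hF s hsI) (hG s hsI)
        rw [← h1] at h2
        have h3 := (abs_le.1 (hen s hsI (hs s hs'))).1
        have h4 : 1 / 4 * N s ≤ E s := by simp only [hE]; linarith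
        have h5 : 0 < (C + 1) * ε ^ 3 := by positivity
        have h6 : (C + 1) * ε ^ 3 * N s ≤ (C + 1) * ε ^ 3 * (4 * E s) := by gcongr; linarith
        calc E' s ≤ (C + 1) * ε ^ 3 * N s + C * ε ^ 10 := h2
          _ ≤ _ := by linarith) r (right_mem_Icc.2 hr.1)
    have hx : 4 * (C + 1) * ε ^ 3 * (r - a) ≤ Λ := by
      have h1 : ε ^ 3 * (r - a) ≤ ρ₁ - ρ₀ := by
        have : ε ^ 3 * (r - a) ≤ ε ^ 3 * (b - a) := by gcongr; exact hr.2
        have e : ε ^ 3 * (b - a) = ρ₁ - ρ₀ := by rw [ha, hb]; field_simp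
        exact this.trans e.le
      calc 4 * (C + 1) * ε ^ 3 * (r - a) = 4 * (C + 1) * (ε ^ 3 * (r - a)) := by ring
        _ ≤ _ := by rw [hΛ]; gcongr
    have hexp : Real.exp (4 * (C + 1) * ε ^ 3 * (r - a)) ≤ Real.exp Λ := Real.exp_le_exp.2 hx
    have hexp0 := Real.exp_pos (4 * (C + 1) * ε ^ 3 * (r - a))
    have hd : C * ε ^ 10 / (4 * (C + 1) * ε ^ 3) ≤ ε ^ 7 := by
      rw [div_le_iff₀ (by positivity)]
      have : 0 < ε ^ 10 := by positivity
      nlinarith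
    have hd0 : 0 ≤ C * ε ^ 10 / (4 * (C + 1) * ε ^ 3) := by positivity
    have hEa : E a ≤ ε ^ 7 := by
      have h3 := (abs_le.1 (hen a haI hNaη)).2
      have : 0 ≤ N a := by positivity
      simp only [hE]; linarith
    calc E r ≤ _ := hgr
      _ ≤ ε ^ 7 * Real.exp Λ + ε ^ 7 * Real.exp Λ := by
          refine add_le_add ?_ ?_
          · calc _ ≤ ε ^ 7 * Real.exp (4 * (C + 1) * ε ^ 3 * (r - a)) := by gcongr
              _ ≤ _ := by gcongr
          · calc _ ≤ C * ε ^ 10 / (4 * (C + 1) * ε ^ 3) * Real.exp Λ := by gcongr; linarith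
              _ ≤ _ := by gcongr
      _ = _ := by ring
  have hNall : ∀ r ∈ Icc a b, N r < η ^ 2 := by
    refine lt_of_continuity_method hNc fun r hr hs => ?_
    rcases eq_or_lt_of_le hr.1 with rfl | har
    · exact hNaη
    -- Coercivity is known only strictly before r, where N < η²; it passes to r by continuity.
    have hlim : N r ≤ 4 * E r := by
      have hcl : r ∈ closure (Ico a r) := by
        rw [closure_Ico har.ne]; exact right_mem_Icc.2 hr.1
      have hsub : Ico a r ⊆ Icc a b := fun s hs => ⟨hs.1, hs.2.le.trans hr.2⟩
      refine ContinuousWithinAt.closure_le hcl ((hNc r hr).mono hsub)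
        (((hEc r hr).mono hsub).const_mul 4) fun s hs' => ?_
      have h3 := (abs_le.1 (hen s (hsub hs') (hs s hs'))).1
      simp only [hE]; linarith
    have := hmain r hr hs
    linarith
  have hS : 𝒞.IsSolutionOn (Icc a b) f g q :=
    ⟨hf', hq', fun r hr => hexact r hr (hNall r hr)⟩
  obtain ⟨hregf, -, hregg⟩ := hS.regOn ha0 hab hgc (hfa ▸ hf₀r) (hqa ▸ hq₀r)
  refine ⟨f, g, q, hS, hregf, hregg, fun r hr => ?_⟩
  have h1 := hmain r hr fun s hs => hNall s ⟨hs.1, hs.2.le.trans hr.2⟩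
  have h3 := (abs_le.1 (hen r hr (hNall r hr))).1
  have h4 : N r ≤ 4 * E r := by simp only [hE]; linarith
  have h5 : ‖f r - ψ r‖ ^ 2 ≤ N r := le_add_of_nonneg_right (sq_nonneg _)
  linarith

end BesselCalculus

/-! ### The Plancherel transform of real functions. -/

section FourierL2

open scoped SchwartzMap

/-- Real `L²(ℝ)`. -/
abbrev RealL2 : Type := Lp ℝ 2 (volume : Measure ℝ)

/-- Complex `L²(ℝ)`. -/
abbrev ComplexL2 : Type := Lp ℂ 2 (volume : Measure ℝ)

/-- On `L¹ ∩ L²`, the inverse Fourier transform of `L²` is given by the integral. -/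
theorem coeFn_fourierInv_of_integrable (h : ComplexL2) (hi : Integrable (h : ℝ → ℂ)) :
    (𝓕⁻ h : ComplexL2) =ᵐ[volume] 𝓕⁻ (h : ℝ → ℂ) := by
  have hc : Continuous (𝓕⁻ (h : ℝ → ℂ)) := by
    have h1 : Continuous (𝓕 (h : ℝ → ℂ)) :=
      VectorFourier.fourierIntegral_continuous Real.continuous_fourierChar continuous_inner hi
    have : 𝓕⁻ (h : ℝ → ℂ) = fun w => 𝓕 (h : ℝ → ℂ) (-w) := by
      ext w; exact Real.fourierInv_eq_fourier_neg _ _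
    rw [this]; exact h1.comp continuous_neg
  -- Both sides are tested with smooth compactly supported functions, on which the inverse transform
  -- moves to the test function: by duality of tempered distributions on one side, by Fubini on the
  -- other.
  refine ae_eq_of_integral_contDiff_smul_eq
    ((Lp.memLp (𝓕⁻ h : ComplexL2)).locallyIntegrable (by norm_num)) hc.locallyIntegrable
    fun g hg hgs => ?_
  have hgc : ContDiff ℝ ∞ (fun x => (g x : ℂ)) := Complex.ofRealCLM.contDiff.comp hg
  have hgsc : HasCompactSupport (fun x => (g x : ℂ)) :=
    hgs.comp_left (g := Complex.ofReal) Complex.ofReal_zero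
  set G : 𝓢(ℝ, ℂ) := hgsc.toSchwartzMap hgc with hG
  have h1 : ((𝓕⁻ h : ComplexL2) : 𝓢'(ℝ, ℂ)) G = (h : 𝓢'(ℝ, ℂ)) (𝓕⁻ G) := by
    rw [← Lp.fourierInv_toTemperedDistribution_eq, TemperedDistribution.fourierInv_apply]
  rw [Lp.toTemperedDistribution_apply, Lp.toTemperedDistribution_apply] at h1
  have hGg : ∀ x, G x = g x := fun x => rfl
  have h2 : ∫ x, g x • (𝓕⁻ h : ComplexL2) x = ∫ x, G x • (𝓕⁻ h : ComplexL2) x := by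
    refine integral_congr_ae (.of_forall fun x => ?_)
    simp [hGg]
  have hflip : ∫ x, (𝓕⁻ G) x • h x = ∫ x, G x • (𝓕⁻ (h : ℝ → ℂ)) x := by
    have := VectorFourier.integral_fourierIntegral_smul_eq_flip (L := -(innerₗ ℝ))
      (μ := volume) (ν := volume) Real.continuous_fourierChar
      (continuous_inner (𝕜 := ℝ) (E := ℝ)).neg G.integrable hi
    refine Eq.trans ?_ (this.trans ?_)
    · rw [SchwartzMap.fourierInv_coe]; rfl
    · refine integral_congr_ae (.of_forall fun x => ?_)
      simp [Real.fourierInv_eq, VectorFourier.fourierIntegral, mul_comm]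
  rw [h2, h1, hflip]
  refine integral_congr_ae (.of_forall fun x => ?_)
  simp [hGg]

/-- Complex conjugation on `L²`. -/
noncomputable def conjL2 : ComplexL2 →L[ℝ] ComplexL2 :=
  (Complex.conjCLE : ℂ →L[ℝ] ℂ).compLpL 2 volume

theorem coeFn_conjL2 (f : ComplexL2) : conjL2 f =ᵐ[volume] fun x => starRingEnd ℂ (f x) := by
  filter_upwards [(Complex.conjCLE : ℂ →L[ℝ] ℂ).coeFn_compLpL f] with x hx
  simpa [conjL2] using hx

/-- The inclusion of real into complex `L²`. -/
noncomputable def ofRealL2 : RealL2 →L[ℝ] ComplexL2 := Complex.ofRealCLM.compLpL 2 volume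

/-- The real part on `L²`. -/
noncomputable def reL2 : ComplexL2 →L[ℝ] RealL2 := Complex.reCLM.compLpL 2 volume

theorem coeFn_ofRealL2 (f : RealL2) : ofRealL2 f =ᵐ[volume] fun x => (f x : ℂ) := by
  filter_upwards [Complex.ofRealCLM.coeFn_compLpL f] with x hx
  simpa [ofRealL2] using hx

theorem coeFn_reL2 (f : ComplexL2) : reL2 f =ᵐ[volume] fun x => (f x).re := by
  filter_upwards [Complex.reCLM.coeFn_compLpL f] with x hx
  simpa [reL2] using hx

theorem conjL2_ofRealL2 (f : RealL2) : conjL2 (ofRealL2 f) = ofRealL2 f := by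
  refine Lp.ext ?_
  filter_upwards [coeFn_conjL2 (ofRealL2 f), coeFn_ofRealL2 f] with x h1 h2
  rw [h1, h2, Complex.conj_ofReal]

theorem ofRealL2_reL2 {f : ComplexL2} (hf : conjL2 f = f) : ofRealL2 (reL2 f) = f := by
  refine Lp.ext ?_
  have h0 := coeFn_conjL2 f
  rw [hf] at h0
  filter_upwards [coeFn_ofRealL2 (reL2 f), coeFn_reL2 f, h0] with x h1 h2 h3
  rw [h1, h2]
  exact Complex.conj_eq_iff_re.1 h3.symm

theorem inner_ofRealL2 (f g : RealL2) :
    inner ℂ (ofRealL2 f) (ofRealL2 g) = ((⟪f, g⟫ : ℝ) : ℂ) := by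
  rw [L2.inner_def, L2.inner_def, ← integral_complex_ofReal]
  refine integral_congr_ae ?_
  filter_upwards [coeFn_ofRealL2 f, coeFn_ofRealL2 g] with x h1 h2
  rw [h1, h2]
  simp

/-- The reflection `x ↦ -x` followed by conjugation. -/
noncomputable def conjReflect (f : ComplexL2) : ComplexL2 :=
  conjL2 (Lp.compMeasurePreserving Neg.neg (Measure.measurePreserving_neg volume) f)

theorem coeFn_conjReflect (f : ComplexL2) :
    conjReflect f =ᵐ[volume] fun x => starRingEnd ℂ (f (-x)) := by
  filter_upwards [coeFn_conjL2 (Lp.compMeasurePreserving Neg.neg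
    (Measure.measurePreserving_neg volume) f), Lp.coeFn_compMeasurePreserving f
    (Measure.measurePreserving_neg volume)] with x h1 h2
  rw [conjReflect, h1, h2, Function.comp_apply]

/-- Conjugating the Fourier integral reflects the frequency. This is checked on Schwartz functions
and extended by density. -/
theorem fourier_conjL2 (f : ComplexL2) : 𝓕 (conjL2 f) = conjReflect (𝓕 f) := by
  refine DenseRange.induction_on (p := fun f : ComplexL2 => 𝓕 (conjL2 f) = conjReflect (𝓕 f))
    (SchwartzMap.denseRange_toLpCLM (E := ℝ) (F := ℂ) (p := 2) (μ := volume)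
      ENNReal.ofNat_ne_top) f ?_ ?_
  · refine isClosed_eq ((Lp.fourierTransformₗᵢ ℝ ℂ).continuous.comp conjL2.continuous) ?_
    exact conjL2.continuous.comp ((Lp.isometry_compMeasurePreserving
      (Measure.measurePreserving_neg volume)).continuous.comp
      (Lp.fourierTransformₗᵢ ℝ ℂ).continuous)
  · intro g
    set gc : 𝓢(ℝ, ℂ) := SchwartzMap.postcompCLM (𝕜 := ℝ) (Complex.conjCLE : ℂ →L[ℝ] ℂ) g with hgc
    have h1 : conjL2 (g.toLp 2) = gc.toLp 2 := by
      refine Lp.ext ?_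
      filter_upwards [coeFn_conjL2 (g.toLp 2), g.coeFn_toLp 2 volume, gc.coeFn_toLp 2 volume]
        with x h1 h2 h3
      rw [h1, h2, h3]; rfl
    change 𝓕 (conjL2 (g.toLp 2)) = conjReflect (𝓕 (g.toLp 2))
    rw [h1, SchwartzMap.toLp_fourier_eq, SchwartzMap.toLp_fourier_eq]
    refine Lp.ext ?_
    have h4 := (Measure.measurePreserving_neg (volume : Measure ℝ)).quasiMeasurePreserving.ae
      ((𝓕 g).coeFn_toLp 2 volume)
    filter_upwards [coeFn_conjReflect ((𝓕 g).toLp 2), h4, (𝓕 gc).coeFn_toLp 2 volume]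
      with x h1 h2 h3
    rw [h1, h2, h3, SchwartzMap.fourier_coe, SchwartzMap.fourier_coe, Real.fourier_eq,
      Real.fourier_eq, ← integral_conj]
    refine integral_congr_ae (.of_forall fun v => ?_)
    simp [hgc, Circle.smul_def, ← Circle.coe_inv_eq_conj, AddChar.map_neg_eq_inv]

/-- The Fourier transform of a real-valued function. -/
noncomputable def fhat (f : RealL2) : ComplexL2 := 𝓕 (ofRealL2 f)

theorem conjReflect_fhat (f : RealL2) : conjReflect (fhat f) = fhat f := by
  rw [fhat, ← fourier_conjL2, conjL2_ofRealL2]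

/-- Hermitian symmetry characterizes the transforms of real functions, so symmetric multipliers act
on real L². -/
theorem exists_fhat_eq {h : ComplexL2} (hh : conjReflect h = h) : ∃ f, fhat f = h := by
  have h1 : conjL2 (𝓕⁻ h) = 𝓕⁻ h := by
    have h2 := fourier_conjL2 (𝓕⁻ h)
    rw [FourierTransform.fourier_fourierInv_eq, hh] at h2
    calc conjL2 (𝓕⁻ h) = 𝓕⁻ (𝓕 (conjL2 (𝓕⁻ h))) :=
          (FourierTransform.fourierInv_fourier_eq _).symm
      _ = 𝓕⁻ h := by rw [h2]
  exact ⟨reL2 (𝓕⁻ h), by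
    rw [fhat, ofRealL2_reL2 h1, FourierTransform.fourier_fourierInv_eq]⟩

theorem inner_eq_re_inner_fhat (f g : RealL2) : ⟪f, g⟫ = (inner ℂ (fhat f) (fhat g)).re := by
  rw [fhat, fhat, Lp.inner_fourier_eq, inner_ofRealL2, Complex.ofReal_re]

theorem norm_fhat (f : RealL2) : ‖fhat f‖ = ‖f‖ := by
  have h := inner_eq_re_inner_fhat f f
  rw [real_inner_self_eq_norm_sq, inner_self_eq_norm_sq_to_K] at h
  have h2 : ‖f‖ ^ 2 = ‖fhat f‖ ^ 2 := by
    rw [h]; norm_cast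
  exact ((sq_eq_sq₀ (norm_nonneg _) (norm_nonneg _)).1 h2).symm

theorem fhat_add (f g : RealL2) : fhat (f + g) = fhat f + fhat g := by
  rw [fhat, map_add, FourierTransform.fourier_add]; rfl

theorem fhat_smul (c : ℝ) (f : RealL2) : fhat (c • f) = (c : ℂ) • fhat f := by
  have : ofRealL2 (c • f) = (c : ℂ) • ofRealL2 f := by
    rw [map_smul]; exact (Complex.coe_smul c _).symm
  rw [fhat, this, FourierTransform.fourier_smul]; rfl

theorem fhat_sub (f g : RealL2) : fhat (f - g) = fhat f - fhat g := by
  rw [sub_eq_add_neg, fhat_add, ← neg_one_smul ℝ g, fhat_smul]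
  simp [sub_eq_add_neg]

theorem fhat_injective {f g : RealL2} (h : fhat f = fhat g) : f = g := by
  rw [← sub_eq_zero, ← norm_eq_zero, ← norm_fhat, fhat_sub, h, sub_self, norm_zero]

end FourierL2

/-! ### Bounded Fourier multipliers on real L². -/

section Multiplier

/-- The symbol of a bounded Fourier multiplier that maps real functions to real functions. -/
structure IsSymbol (m : ℝ → ℂ) (B : ℝ) : Prop where
  measurable : Measurable m
  norm_le : ∀ ξ, ‖m ξ‖ ≤ B
  conj_neg : ∀ ξ, starRingEnd ℂ (m (-ξ)) = m ξ

variable {m : ℝ → ℂ} {B : ℝ}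

theorem exists_fhat_eq_mul {w : ℝ → ℂ} (hw : ∀ ξ, starRingEnd ℂ (w (-ξ)) = w ξ) (f : RealL2)
    (hf : MemLp (fun ξ => w ξ * fhat f ξ) 2 (volume : Measure ℝ)) :
    ∃ g : RealL2, fhat g = hf.toLp _ := by
  refine exists_fhat_eq (Lp.ext ?_)
  have hneg : Measure.QuasiMeasurePreserving Neg.neg (volume : Measure ℝ) volume :=
    (Measure.measurePreserving_neg (volume : Measure ℝ)).quasiMeasurePreserving
  have h3 := coeFn_conjReflect (fhat f)
  rw [conjReflect_fhat] at h3
  filter_upwards [coeFn_conjReflect (hf.toLp _), hf.coeFn_toLp, hneg.ae hf.coeFn_toLp, h3]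
    with ξ h0 h1 h2 h3
  rw [h0, h1, h2, map_mul, hw, ← h3]

theorem IsSymbol.memLp (hm : IsSymbol m B) (f : RealL2) :
    MemLp (fun ξ => m ξ * fhat f ξ) 2 (volume : Measure ℝ) :=
  (Lp.memLp (fhat f)).of_le_mul (c := B)
    (hm.measurable.aestronglyMeasurable.mul (Lp.aestronglyMeasurable _))
    (.of_forall fun ξ => by
      rw [norm_mul]; exact mul_le_mul_of_nonneg_right (hm.norm_le ξ) (norm_nonneg _))

theorem IsSymbol.exists_mult (hm : IsSymbol m B) : ∃ T : RealL2 →L[ℝ] RealL2,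
    ∀ f, fhat (T f) =ᵐ[volume] fun ξ => m ξ * fhat f ξ := by
  choose T hT using fun f => exists_fhat_eq_mul hm.conj_neg f (hm.memLp f)
  have hT' : ∀ f, fhat (T f) =ᵐ[volume] fun ξ => m ξ * fhat f ξ := fun f => by
    rw [hT]; exact (hm.memLp f).coeFn_toLp
  refine ⟨LinearMap.mkContinuous
    { toFun := T
      map_add' := fun f g => fhat_injective (Lp.ext ?_)
      map_smul' := fun c f => fhat_injective (Lp.ext ?_) } B fun f => ?_, hT'⟩
  · rw [fhat_add]
    have h5 := hT' (f + g)
    rw [fhat_add] at h5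
    filter_upwards [h5, hT' f, hT' g, Lp.coeFn_add (fhat (T f)) (fhat (T g)),
      Lp.coeFn_add (fhat f) (fhat g)] with ξ h1 h2 h3 h4 h5
    rw [h1, h4, h5, Pi.add_apply, Pi.add_apply, h2, h3, mul_add]
  · rw [RingHom.id_apply, fhat_smul]
    have h5 := hT' (c • f)
    rw [fhat_smul] at h5
    filter_upwards [h5, hT' f, Lp.coeFn_smul (c : ℂ) (fhat (T f)),
      Lp.coeFn_smul (c : ℂ) (fhat f)] with ξ h1 h2 h3 h4
    rw [h1, h3, h4, Pi.smul_apply, Pi.smul_apply, h2, smul_eq_mul, smul_eq_mul]; ring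
  · change ‖T f‖ ≤ B * ‖f‖
    rw [← norm_fhat, ← norm_fhat f]
    refine Lp.norm_le_mul_norm_of_ae_le_mul ?_
    filter_upwards [hT' f] with ξ h1
    rw [h1, norm_mul]; exact mul_le_mul_of_nonneg_right (hm.norm_le ξ) (norm_nonneg _)

/-- The Fourier multiplier with a given symbol. -/
noncomputable def mult (m : ℝ → ℂ) {B : ℝ} (hm : IsSymbol m B) : RealL2 →L[ℝ] RealL2 :=
  hm.exists_mult.choose

theorem fhat_mult (hm : IsSymbol m B) (f : RealL2) :
    fhat (mult m hm f) =ᵐ[volume] fun ξ => m ξ * fhat f ξ :=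
  hm.exists_mult.choose_spec f

theorem eq_of_fhat_ae {f g : RealL2} (h : fhat f =ᵐ[volume] fhat g) : f = g :=
  fhat_injective (Lp.ext h)

/-- By Plancherel, the adjoint of a multiplier has the conjugate symbol. -/
theorem inner_mult {m' : ℝ → ℂ} {B' : ℝ} (hm : IsSymbol m B) (hm' : IsSymbol m' B')
    (h : ∀ ξ, m' ξ = starRingEnd ℂ (m ξ)) (f g : RealL2) :
    ⟪mult m hm f, g⟫ = ⟪f, mult m' hm' g⟫ := by
  rw [inner_eq_re_inner_fhat, inner_eq_re_inner_fhat, L2.inner_def, L2.inner_def]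
  congr 1
  refine integral_congr_ae ?_
  filter_upwards [fhat_mult hm f, fhat_mult hm' g] with ξ h1 h2
  rw [h1, h2, h]
  simp only [RCLike.inner_apply, map_mul]; ring

end Multiplier

/-! ### The operators (1 - ∂²)^(-1/2) and ∂(1 - ∂²)^(-1/2). -/

section Symbols

/-- The symbol `(1 + k²)^(-1/2)`, `k = 2 π ξ`. -/
noncomputable def jsymR (ξ : ℝ) : ℝ := (Real.sqrt (1 + (2 * Real.pi * ξ) ^ 2))⁻¹

theorem jsymR_pos (ξ : ℝ) : 0 < jsymR ξ := by unfold jsymR; positivity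

theorem jsymR_sq (ξ : ℝ) : jsymR ξ ^ 2 = (1 + (2 * Real.pi * ξ) ^ 2)⁻¹ := by
  rw [jsymR, inv_pow, Real.sq_sqrt (by positivity)]

theorem jsymR_sq_mul (ξ : ℝ) : jsymR ξ ^ 2 * (1 + (2 * Real.pi * ξ) ^ 2) = 1 := by
  rw [jsymR_sq, inv_mul_cancel₀ (by positivity)]

theorem jsymR_le_one (ξ : ℝ) : jsymR ξ ≤ 1 := by
  have h := jsymR_sq_mul ξ
  nlinarith [sq_nonneg (jsymR ξ * (2 * Real.pi * ξ)), jsymR_pos ξ]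

theorem abs_mul_jsymR_le_one (ξ : ℝ) : |2 * Real.pi * ξ * jsymR ξ| ≤ 1 := by
  have h := jsymR_sq_mul ξ
  rw [← sq_le_one_iff_abs_le_one]
  nlinarith [sq_nonneg (jsymR ξ)]

theorem jsymR_neg (ξ : ℝ) : jsymR (-ξ) = jsymR ξ := by
  unfold jsymR; congr 3; ring

theorem continuous_jsymR : Continuous jsymR := by
  unfold jsymR
  exact Continuous.inv₀ (by fun_prop) fun ξ => by positivity

/-- The symbol of `(1 - ∂²)^(-1/2)`. -/
noncomputable def jsym (ξ : ℝ) : ℂ := jsymR ξ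

/-- The symbol of `∂ (1 - ∂²)^(-1/2)`. -/
noncomputable def ksym (ξ : ℝ) : ℂ := (2 * Real.pi * ξ : ℝ) * Complex.I * jsymR ξ

theorem norm_jsym (ξ : ℝ) : ‖jsym ξ‖ = jsymR ξ := by
  rw [jsym, Complex.norm_real, Real.norm_of_nonneg (jsymR_pos ξ).le]

theorem isSymbol_jsym : IsSymbol jsym 1 where
  measurable := (Complex.continuous_ofReal.comp continuous_jsymR).measurable
  norm_le ξ := (norm_jsym ξ).trans_le (jsymR_le_one ξ)
  conj_neg ξ := by rw [jsym, jsym, Complex.conj_ofReal, jsymR_neg]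

theorem isSymbol_ksym : IsSymbol ksym 1 where
  measurable := by
    have := continuous_jsymR
    exact Continuous.measurable (by unfold ksym; fun_prop)
  norm_le ξ := by
    have := abs_mul_jsymR_le_one ξ
    rw [ksym, mul_right_comm, norm_mul, Complex.norm_I, mul_one, ← Complex.ofReal_mul,
      Complex.norm_real]
    exact this
  conj_neg ξ := by
    rw [ksym, ksym, jsymR_neg, map_mul, map_mul, Complex.conj_ofReal, Complex.conj_I,
      Complex.conj_ofReal]
    push_cast; ring

theorem conj_jsym (ξ : ℝ) : jsym ξ = starRingEnd ℂ (jsym ξ) := by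
  rw [jsym, Complex.conj_ofReal]

theorem conj_ksym (ξ : ℝ) : starRingEnd ℂ (ksym ξ) = -ksym ξ := by
  rw [ksym, map_mul, map_mul, Complex.conj_ofReal, Complex.conj_I, Complex.conj_ofReal]; ring

theorem jsym_sq_sub_ksym_sq (ξ : ℝ) : jsym ξ * jsym ξ - ksym ξ * ksym ξ = 1 := by
  have h : ((jsymR ξ ^ 2 * (1 + (2 * Real.pi * ξ) ^ 2) : ℝ) : ℂ) = 1 := by
    rw [jsymR_sq_mul, Complex.ofReal_one]
  rw [← h, jsym, ksym]
  push_cast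
  linear_combination -((2 * Real.pi * ξ) ^ 2 * (jsymR ξ : ℂ) ^ 2) * Complex.I_sq

/-- `(1 - ∂²)^(-1/2)` on real `L²`. -/
noncomputable def opJ : RealL2 →L[ℝ] RealL2 := mult jsym isSymbol_jsym

/-- `∂ (1 - ∂²)^(-1/2)` on real `L²`. -/
noncomputable def opK : RealL2 →L[ℝ] RealL2 := mult ksym isSymbol_ksym

theorem fhat_opJ (f : RealL2) : fhat (opJ f) =ᵐ[volume] fun ξ => jsym ξ * fhat f ξ :=
  fhat_mult isSymbol_jsym f

theorem fhat_opK (f : RealL2) : fhat (opK f) =ᵐ[volume] fun ξ => ksym ξ * fhat f ξ :=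
  fhat_mult isSymbol_ksym f

theorem inner_opJ (f g : RealL2) : ⟪opJ f, g⟫ = ⟪f, opJ g⟫ :=
  inner_mult isSymbol_jsym isSymbol_jsym conj_jsym f g

theorem inner_opK (f g : RealL2) : ⟪opK f, g⟫ = -⟪f, opK g⟫ := by
  have hneg : IsSymbol (fun ξ => -ksym ξ) 1 :=
    ⟨isSymbol_ksym.measurable.neg, fun ξ => by simpa using isSymbol_ksym.norm_le ξ,
      fun ξ => by rw [map_neg, isSymbol_ksym.conj_neg]⟩
  rw [opK, inner_mult isSymbol_ksym hneg fun ξ => (conj_ksym ξ).symm, ← inner_neg_right]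
  congr 1
  refine eq_of_fhat_ae ?_
  have h : fhat (-(mult ksym isSymbol_ksym g)) = -fhat (mult ksym isSymbol_ksym g) := by
    have := fhat_smul (-1) (mult ksym isSymbol_ksym g)
    simpa using this
  rw [h]
  filter_upwards [fhat_mult hneg g, fhat_mult isSymbol_ksym g,
    Lp.coeFn_neg (fhat (mult ksym isSymbol_ksym g))] with ξ h1 h2 h3
  rw [h1, h3, Pi.neg_apply, h2, neg_mul]

theorem opJ_opK (f : RealL2) : opJ (opK f) = opK (opJ f) := by
  refine eq_of_fhat_ae ?_
  filter_upwards [fhat_opJ (opK f), fhat_opK f, fhat_opK (opJ f), fhat_opJ f] with ξ h1 h2 h3 h4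
  rw [h1, h2, h3, h4]; ring

theorem opJ_opJ_sub_opK_opK (f : RealL2) : opJ (opJ f) - opK (opK f) = f := by
  refine eq_of_fhat_ae ?_
  rw [fhat_sub]
  filter_upwards [fhat_opJ (opJ f), fhat_opJ f, fhat_opK (opK f), fhat_opK f,
    Lp.coeFn_sub (fhat (opJ (opJ f))) (fhat (opK (opK f)))] with ξ h1 h2 h3 h4 h5
  rw [h5, Pi.sub_apply, h1, h2, h3, h4]
  linear_combination (fhat f ξ) * jsym_sq_sub_ksym_sq ξ

theorem fhat_eq_zero_ae {f : RealL2} (h : ∀ᵐ ξ, fhat f ξ = 0) : f = 0 := by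
  rw [← norm_eq_zero, ← norm_fhat, norm_eq_zero]
  exact (Lp.eq_zero_iff_ae_eq_zero).2 h

theorem fhat_zero_ae : ∀ᵐ ξ, fhat (0 : RealL2) ξ = 0 := by
  have : fhat (0 : RealL2) = 0 := by
    have := fhat_smul 0 (0 : RealL2)
    simpa using this
  rw [this]
  exact Lp.coeFn_zero _ _ _

theorem opJ_injective (f : RealL2) (h : opJ f = 0) : f = 0 := by
  have h1 := fhat_opJ f
  rw [h] at h1
  refine fhat_eq_zero_ae ?_
  filter_upwards [h1, fhat_zero_ae] with ξ h1 h2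
  rw [h2] at h1
  exact (mul_eq_zero.1 h1.symm).resolve_left (Complex.ofReal_ne_zero.2 (jsymR_pos ξ).ne')

theorem opK_injective (f : RealL2) (h : opK f = 0) : f = 0 := by
  have h1 := fhat_opK f
  rw [h] at h1
  refine fhat_eq_zero_ae ?_
  have h0 : ∀ᵐ ξ : ℝ, ξ ≠ 0 := Measure.ae_ne volume 0
  filter_upwards [h1, fhat_zero_ae, h0] with ξ h1 h2 h3
  rw [h2] at h1
  refine (mul_eq_zero.1 h1.symm).resolve_left ?_
  have := (jsymR_pos ξ).ne'
  simp [ksym, h3, Real.pi_ne_zero, this]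

theorem denseRange_opJ : DenseRange opJ :=
  denseRange_of_symmetric_of_injective inner_opJ opJ_injective

end Symbols

/-! ### Point values and classical derivatives. -/

section Evaluation

/-- The source of the embedding of H¹ into bounded continuous functions: by Cauchy–Schwarz the
transform of J f is integrable. -/
theorem memLp_jsym : MemLp jsym 2 (volume : Measure ℝ) := by
  rw [memLp_two_iff_integrable_sq_norm isSymbol_jsym.measurable.aestronglyMeasurable]
  have h : Integrable (fun ξ : ℝ => (1 + (2 * Real.pi * ξ) ^ 2)⁻¹) :=
    integrable_inv_one_add_sq.comp_mul_left' (R := 2 * Real.pi) (by positivity)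
  refine h.congr (.of_forall fun ξ => ?_)
  simp only [norm_jsym, jsymR_sq]

theorem integrable_jsym_mul (h : ComplexL2) : Integrable (fun ξ => jsym ξ * h ξ) :=
  MemLp.integrable_mul (p := 2) (q := 2) memLp_jsym (Lp.memLp h)

theorem exists_integral_norm_jsym_mul_le : ∃ c : ℝ, 0 ≤ c ∧ ∀ h : ComplexL2,
    ∫ ξ, ‖jsym ξ * h ξ‖ ≤ c * ‖h‖ := by
  refine ⟨‖memLp_jsym.toLp jsym‖, norm_nonneg _, fun h => ?_⟩
  set a : Lp ℝ 2 (volume : Measure ℝ) := memLp_jsym.norm.toLp _ with ha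
  set b : Lp ℝ 2 (volume : Measure ℝ) := (Lp.memLp h).norm.toLp _ with hb
  have h1 : ∫ ξ, ‖jsym ξ * h ξ‖ = ⟪a, b⟫ := by
    rw [L2.inner_def]
    refine integral_congr_ae ?_
    filter_upwards [memLp_jsym.norm.coeFn_toLp, (Lp.memLp h).norm.coeFn_toLp] with ξ h1 h2
    rw [h1, h2, norm_mul]; simp [mul_comm]
  have ha' : ‖a‖ = ‖memLp_jsym.toLp jsym‖ := by
    rw [ha, Lp.norm_toLp, Lp.norm_toLp, eLpNorm_norm]
  have hb' : ‖b‖ = ‖h‖ := by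
    rw [hb, Lp.norm_toLp, eLpNorm_norm, Lp.norm_def]
  rw [h1, ← ha', ← hb']
  exact real_inner_le_norm _ _

/-- The constant of the embedding of `H¹(ℝ)` into the bounded functions. -/
noncomputable def evalConst : ℝ := exists_integral_norm_jsym_mul_le.choose

theorem evalConst_nonneg : 0 ≤ evalConst := exists_integral_norm_jsym_mul_le.choose_spec.1

theorem integral_norm_jsym_mul_le (h : ComplexL2) : ∫ ξ, ‖jsym ξ * h ξ‖ ≤ evalConst * ‖h‖ :=
  exists_integral_norm_jsym_mul_le.choose_spec.2 h

/-- The value at `t` of the continuous representative of `J f`. -/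
noncomputable def evalFun (t : ℝ) (f : RealL2) : ℝ := (𝓕⁻ (fun ξ => jsym ξ * fhat f ξ) t).re

theorem abs_evalFun_le (t : ℝ) (f : RealL2) : |evalFun t f| ≤ evalConst * ‖f‖ := by
  refine (Complex.abs_re_le_norm _).trans ?_
  rw [Real.fourierInv_eq, ← norm_fhat f]
  refine (norm_integral_le_integral_norm _).trans (le_trans (le_of_eq ?_)
    (integral_norm_jsym_mul_le (fhat f)))
  simp [Circle.norm_smul]

theorem fourierInv_integrand_integrable {h : ℝ → ℂ} (hh : Integrable h) (t : ℝ) :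
    Integrable (fun ξ => Real.fourierChar (inner ℝ ξ t) • h ξ) := by
  have := (Real.fourierIntegral_convergent_iff (μ := volume) (f := h) (-t)).2 hh
  simpa using this

/-- The value of `J f` at `t`, as a bounded functional of `f`. -/
noncomputable def evalJ (t : ℝ) : RealL2 →L[ℝ] ℝ :=
  LinearMap.mkContinuous
    { toFun := evalFun t
      map_add' := fun f g => by
        simp only [evalFun]
        rw [← Complex.add_re, Real.fourierInv_eq, Real.fourierInv_eq, Real.fourierInv_eq,
          ← integral_add (fourierInv_integrand_integrable (integrable_jsym_mul _) t)
            (fourierInv_integrand_integrable (integrable_jsym_mul _) t)]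
        congr 1
        refine integral_congr_ae ?_
        rw [fhat_add]
        filter_upwards [Lp.coeFn_add (fhat f) (fhat g)] with ξ h
        rw [h, Pi.add_apply, mul_add, smul_add]
      map_smul' := fun c f => by
        simp only [evalFun, RingHom.id_apply]
        rw [smul_eq_mul, ← Complex.re_ofReal_mul, Real.fourierInv_eq, Real.fourierInv_eq,
          ← integral_const_mul]
        congr 1
        refine integral_congr_ae ?_
        rw [fhat_smul]
        filter_upwards [Lp.coeFn_smul (c : ℂ) (fhat f)] with ξ h
        rw [h, Pi.smul_apply, smul_eq_mul, Circle.smul_def, Circle.smul_def, smul_eq_mul,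
          smul_eq_mul]
        ring } evalConst fun f => abs_evalFun_le t f

theorem evalJ_apply (t : ℝ) (f : RealL2) :
    evalJ t f = (𝓕⁻ (fun ξ => jsym ξ * fhat f ξ) t).re := rfl

theorem abs_evalJ_le (t : ℝ) (f : RealL2) : |evalJ t f| ≤ evalConst * ‖f‖ := abs_evalFun_le t f

theorem continuous_evalJ (f : RealL2) : Continuous fun t => evalJ t f := by
  have h1 : Continuous (𝓕 (fun ξ => jsym ξ * fhat f ξ)) :=
    VectorFourier.fourierIntegral_continuous Real.continuous_fourierChar continuous_inner
      (integrable_jsym_mul _)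
  have h2 : (fun t => evalJ t f) = fun t => (𝓕 (fun ξ => jsym ξ * fhat f ξ) (-t)).re := by
    ext t; rw [evalJ_apply, Real.fourierInv_eq_fourier_neg]
  rw [h2]
  exact Complex.continuous_re.comp (h1.comp continuous_neg)

theorem coeFn_opJ (f : RealL2) : opJ f =ᵐ[volume] fun t => evalJ t f := by
  have hi : Integrable (fhat (opJ f) : ℝ → ℂ) :=
    (integrable_jsym_mul (fhat f)).congr (fhat_opJ f).symm
  have h1 := coeFn_fourierInv_of_integrable (fhat (opJ f)) hi
  rw [fhat, FourierTransform.fourierInv_fourier_eq] at h1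
  filter_upwards [h1, coeFn_ofRealL2 (opJ f)] with t h1 h2
  rw [h2] at h1
  rw [evalJ_apply, ← Real.fourierInv_congr_ae (fhat_opJ f) t, fhat, ← h1, Complex.ofReal_re]

theorem eq_zero_of_evalJ_eq_zero (f : RealL2) (h : ∀ t, evalJ t f = 0) : f = 0 := by
  refine opJ_injective f ((Lp.eq_zero_iff_ae_eq_zero).2 ?_)
  filter_upwards [coeFn_opJ f] with t ht
  rw [ht, h t]; rfl

/-- With two powers of J the transform remains integrable after multiplication by the frequency, so
the inverse Fourier integral may be differentiated; the factor ik turns one J into K. -/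
theorem hasDerivAt_evalJ_opJ (f : RealL2) (t : ℝ) :
    HasDerivAt (fun t => evalJ t (opJ f)) (evalJ t (opK f)) t := by
  set g : ℝ → ℂ := fun ξ => jsym ξ * (jsym ξ * fhat f ξ) with hg
  have hgi : Integrable g := by
    refine (integrable_jsym_mul (fhat (opJ f))).congr ?_
    filter_upwards [fhat_opJ f] with ξ h
    rw [hg, h]
  have hk : (fun ξ => jsym ξ * fhat (opK f) ξ) =ᵐ[volume]
      fun ξ : ℝ => (2 * Real.pi * Complex.I * ξ) * g ξ := by
    filter_upwards [fhat_opK f] with ξ h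
    simp only [h, hg, ksym, jsym]; push_cast; ring
  have hgi' : Integrable (fun ξ : ℝ => ξ • g ξ) := by
    have h1 := ((integrable_jsym_mul (fhat (opK f))).congr hk).const_mul
      (2 * Real.pi * Complex.I)⁻¹
    refine h1.congr (.of_forall fun ξ => ?_)
    have : (2 * Real.pi * Complex.I : ℂ) ≠ 0 := by simp [Real.pi_ne_zero]
    simp only [Complex.real_smul]
    field_simp
  have h1 := Real.hasDerivAt_fourier hgi hgi' (-t)
  have h2 := h1.scomp t (hasDerivAt_neg t)
  have h3 := (Complex.reCLM.hasFDerivAt.comp_hasDerivAt t h2)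
  have e1 : (fun t => evalJ t (opJ f)) = Complex.reCLM ∘ (𝓕 g ∘ fun t => -t) := by
    ext t
    rw [evalJ_apply, Function.comp_apply, Function.comp_apply, Complex.reCLM_apply,
      ← Real.fourierInv_eq_fourier_neg]
    congr 1
    refine Real.fourierInv_congr_ae ?_ t
    filter_upwards [fhat_opJ f] with ξ h
    rw [hg, h]
  rw [e1]
  refine h3.congr_deriv ?_
  rw [evalJ_apply, Complex.reCLM_apply, Real.fourierInv_congr_ae hk t,
    Real.fourierInv_eq_fourier_neg, neg_one_smul]
  congr 1
  rw [Real.fourier_eq, Real.fourier_eq, ← integral_neg]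
  refine integral_congr_ae (.of_forall fun ξ => ?_)
  simp only [smul_eq_mul, Circle.smul_def]
  ring

/-- A continuously differentiable function that is square integrable with its derivative. -/
theorem opK_toLp_eq {G G' : ℝ → ℝ} (hd : ∀ t, HasDerivAt G (G' t) t)
    (hG : MemLp G 2 (volume : Measure ℝ)) (hG' : MemLp G' 2 (volume : Measure ℝ)) :
    opK (hG.toLp G) = opJ (hG'.toLp G') := by
  refine ext_inner_right ℝ fun z => ?_
  -- Against elements of the dense range of J the pairing involves continuously differentiable
  -- representatives, and the claim is integration by parts.
  refine denseRange_opJ.induction_on (p := fun z => ⟪opK (hG.toLp G), z⟫ = ⟪opJ (hG'.toLp G'), z⟫)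
    z (isClosed_eq (by fun_prop) (by fun_prop)) fun y => ?_
  rw [inner_opK, inner_opJ, L2.inner_def, L2.inner_def]
  have hY : MemLp (fun t => evalJ t (opJ y)) 2 (volume : Measure ℝ) :=
    (memLp_congr_ae (coeFn_opJ (opJ y))).1 (Lp.memLp _)
  have hY' : MemLp (fun t => evalJ t (opK y)) 2 (volume : Measure ℝ) :=
    (memLp_congr_ae (coeFn_opJ (opK y))).1 (Lp.memLp _)
  have key := integral_mul_deriv_eq_deriv_mul_of_integrable (u := G) (u' := G')
    (v := fun t => evalJ t (opJ y)) (v' := fun t => evalJ t (opK y))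
    (fun x _ => hd x) (fun x _ => hasDerivAt_evalJ_opJ y x)
    (MemLp.integrable_mul (p := 2) (q := 2) hG hY')
    (MemLp.integrable_mul (p := 2) (q := 2) hG' hY)
    (MemLp.integrable_mul (p := 2) (q := 2) hG hY)
  have e1 : ∫ t, inner ℝ (hG.toLp G t) (opK (opJ y) t) = ∫ t, G t * evalJ t (opK y) := by
    refine integral_congr_ae ?_
    rw [← opJ_opK]
    filter_upwards [hG.coeFn_toLp, coeFn_opJ (opK y)] with t h1 h2
    rw [h1, h2]; simp [mul_comm]
  have e2 : ∫ t, inner ℝ (hG'.toLp G' t) (opJ (opJ y) t) = ∫ t, G' t * evalJ t (opJ y) := by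
    refine integral_congr_ae ?_
    filter_upwards [hG'.coeFn_toLp, coeFn_opJ (opJ y)] with t h1 h2
    rw [h1, h2]; simp [mul_comm]
  rw [e1, e2, key, neg_neg]

end Evaluation

/-! ### Products and the Leibniz rule. -/

section Product

theorem memLp_mul_evalJ (a g : RealL2) :
    MemLp (fun t => a t * evalJ t g) 2 (volume : Measure ℝ) :=
  (Lp.memLp a).of_le_mul (c := evalConst * ‖g‖)
    ((Lp.aestronglyMeasurable a).mul (continuous_evalJ g).aestronglyMeasurable)
    (.of_forall fun t => by
      rw [norm_mul, mul_comm]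
      exact mul_le_mul_of_nonneg_right (abs_evalJ_le t g) (norm_nonneg _))

theorem exists_opM : ∃ M : RealL2 →L[ℝ] RealL2 →L[ℝ] RealL2,
    ∀ a g, M a g =ᵐ[volume] fun t => a t * evalJ t g := by
  set T : RealL2 → RealL2 → RealL2 := fun a g => (memLp_mul_evalJ a g).toLp _ with hT
  have hT' : ∀ a g, T a g =ᵐ[volume] fun t => a t * evalJ t g :=
    fun a g => (memLp_mul_evalJ a g).coeFn_toLp
  refine ⟨LinearMap.mkContinuous₂ (LinearMap.mk₂ ℝ T ?_ ?_ ?_ ?_) evalConst ?_, hT'⟩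
  · intro a b g
    refine Lp.ext ?_
    filter_upwards [hT' (a + b) g, hT' a g, hT' b g, Lp.coeFn_add (T a g) (T b g),
      Lp.coeFn_add a b] with t h1 h2 h3 h4 h5
    rw [h1, h4, Pi.add_apply, h2, h3, h5, Pi.add_apply, add_mul]
  · intro c a g
    refine Lp.ext ?_
    filter_upwards [hT' (c • a) g, hT' a g, Lp.coeFn_smul c (T a g), Lp.coeFn_smul c a]
      with t h1 h2 h3 h4
    rw [h1, h3, Pi.smul_apply, h2, h4, Pi.smul_apply, smul_eq_mul, smul_eq_mul, mul_assoc]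
  · intro a g h
    refine Lp.ext ?_
    filter_upwards [hT' a (g + h), hT' a g, hT' a h, Lp.coeFn_add (T a g) (T a h)]
      with t h1 h2 h3 h4
    rw [h1, h4, Pi.add_apply, h2, h3, map_add, mul_add]
  · intro c a g
    refine Lp.ext ?_
    filter_upwards [hT' a (c • g), hT' a g, Lp.coeFn_smul c (T a g)] with t h1 h2 h3
    rw [h1, h3, Pi.smul_apply, h2, map_smul, smul_eq_mul, smul_eq_mul]; ring
  · intro a g
    change ‖T a g‖ ≤ _
    have h : ‖T a g‖ ≤ (evalConst * ‖g‖) * ‖a‖ := by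
      refine Lp.norm_le_mul_norm_of_ae_le_mul ?_
      filter_upwards [hT' a g] with t h1
      rw [h1, norm_mul, mul_comm]
      exact mul_le_mul_of_nonneg_right (abs_evalJ_le t g) (norm_nonneg _)
    linarith [mul_right_comm evalConst ‖a‖ ‖g‖]

/-- The product `a · (J g)`. -/
noncomputable def opM : RealL2 →L[ℝ] RealL2 →L[ℝ] RealL2 := exists_opM.choose

theorem coeFn_opM (a g : RealL2) : opM a g =ᵐ[volume] fun t => a t * evalJ t g :=
  exists_opM.choose_spec a g

theorem norm_opM_le_of_bound {g : RealL2} {B : ℝ} (hB : ∀ᵐ t, |opJ g t| ≤ B) (a : RealL2) :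
    ‖opM a g‖ ≤ B * ‖a‖ := by
  refine Lp.norm_le_mul_norm_of_ae_le_mul ?_
  filter_upwards [coeFn_opM a g, hB, coeFn_opJ g] with t h1 h2 h3
  rw [h1, ← h3, norm_mul, mul_comm]
  exact mul_le_mul_of_nonneg_right h2 (norm_nonneg _)

theorem opM_opJ_comm (x y : RealL2) : opM (opJ x) y = opM (opJ y) x := by
  refine Lp.ext ?_
  filter_upwards [coeFn_opM (opJ x) y, coeFn_opM (opJ y) x, coeFn_opJ x, coeFn_opJ y]
    with t h1 h2 h3 h4
  rw [h1, h2, h3, h4, mul_comm]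

theorem inner_opM (a b g : RealL2) : ⟪opM a g, b⟫ = ⟪a, opM b g⟫ := by
  rw [L2.inner_def, L2.inner_def]
  refine integral_congr_ae ?_
  filter_upwards [coeFn_opM a g, coeFn_opM b g] with t h1 h2
  rw [h1, h2]
  simp only [RCLike.inner_apply, conj_trivial]; ring

/-- Both sides are continuous in x and in y, so these may be taken in the range of J, where the
classical product rule applies. -/
theorem opK_opM (x y : RealL2) : opK (opM (opJ x) y) = opJ (opM (opK x) y + opM (opK y) x) := by
  refine denseRange_opJ.induction_on
    (p := fun x => opK (opM (opJ x) y) = opJ (opM (opK x) y + opM (opK y) x))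
    x (isClosed_eq (by fun_prop) (by fun_prop)) fun x => ?_
  refine denseRange_opJ.induction_on
    (p := fun y => opK (opM (opJ (opJ x)) y) = opJ (opM (opK (opJ x)) y + opM (opK y) (opJ x)))
    y (isClosed_eq (by fun_prop) (by fun_prop)) fun y => ?_
  have h1 : opM (opJ (opJ x)) (opJ y) =ᵐ[volume] fun t => evalJ t (opJ x) * evalJ t (opJ y) := by
    filter_upwards [coeFn_opM (opJ (opJ x)) (opJ y), coeFn_opJ (opJ x)] with t h1 h2
    rw [h1, h2]
  have h2 : ((opM (opK (opJ x)) (opJ y) + opM (opK (opJ y)) (opJ x) : RealL2) : ℝ → ℝ) =ᵐ[volume]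
      fun t => evalJ t (opK x) * evalJ t (opJ y) + evalJ t (opJ x) * evalJ t (opK y) := by
    rw [← opJ_opK, ← opJ_opK]
    filter_upwards [coeFn_opM (opJ (opK x)) (opJ y), coeFn_opJ (opK x),
      coeFn_opM (opJ (opK y)) (opJ x), coeFn_opJ (opK y),
      Lp.coeFn_add (opM (opJ (opK x)) (opJ y)) (opM (opJ (opK y)) (opJ x))] with t h1 h2 h3 h4 h5
    rw [h5, Pi.add_apply, h1, h2, h3, h4]; ring
  have m1 := (memLp_congr_ae h1).1 (Lp.memLp _)
  have m2 := (memLp_congr_ae h2).1 (Lp.memLp _)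
  have key := opK_toLp_eq
    (fun t => (hasDerivAt_evalJ_opJ x t).mul (hasDerivAt_evalJ_opJ y t)) m1 m2
  have e1 : opM (opJ (opJ x)) (opJ y) = m1.toLp _ := Lp.ext (h1.trans m1.coeFn_toLp.symm)
  have e2 : opM (opK (opJ x)) (opJ y) + opM (opK (opJ y)) (opJ x) = m2.toLp _ :=
    Lp.ext (h2.trans m2.coeFn_toLp.symm)
  rw [e1, e2]
  exact key

/-- The Bessel calculus on real `L²(ℝ)`. -/
noncomputable def besselCalculus : BesselCalculus RealL2 where
  J := opJ
  K := opK
  M := opM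
  inner_J := inner_opJ
  inner_K := inner_opK
  J_K := opJ_opK
  J_J_sub_K_K := opJ_opJ_sub_opK_opK
  J_injective := opJ_injective
  M_J_comm := opM_opJ_comm
  inner_M := inner_opM
  K_M := opK_opM

end Product

/-! ### Sobolev norms and the ranges of powers of J. -/

section SobolevNorm

theorem toComplexL2_eq (f : ℝ → ℝ) (hf : MemLp f 2 (volume : Measure ℝ)) :
    toComplexL2 f hf = ofRealL2 (hf.toLp f) := by
  refine Lp.ext ?_
  rw [toComplexL2]
  filter_upwards [(hf.ofReal (K := ℂ)).coeFn_toLp, coeFn_ofRealL2 (hf.toLp f), hf.coeFn_toLp]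
    with t h1 h2 h3
  exact h1.trans (by rw [h2, h3]; rfl)

theorem sobolevSq_toComplexL2 (s : ℝ) (m : ℝ → ℂ) (f : ℝ → ℝ)
    (hf : MemLp f 2 (volume : Measure ℝ)) :
    sobolevSq s m (toComplexL2 f hf) = ∫⁻ ξ : ℝ, ENNReal.ofReal
      ((1 + (2 * Real.pi * ξ) ^ 2) ^ s * ‖m (2 * Real.pi * ξ) * fhat (hf.toLp f) ξ‖ ^ 2) := by
  rw [sobolevSq, toComplexL2_eq]; rfl

theorem lintegral_norm_sq_eq (h : ComplexL2) :
    ∫⁻ ξ, ENNReal.ofReal (‖h ξ‖ ^ 2) = ENNReal.ofReal (‖h‖ ^ 2) := by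
  have h1 : Integrable (fun ξ => ‖h ξ‖ ^ 2) :=
    (memLp_two_iff_integrable_sq_norm (Lp.aestronglyMeasurable h)).1 (Lp.memLp h)
  rw [← ofReal_integral_eq_lintegral_ofReal h1 (.of_forall fun ξ => by positivity)]
  congr 1
  have h2 : inner ℂ h h = ∫ ξ, inner ℂ (h ξ) (h ξ) := L2.inner_def h h
  simp only [inner_self_eq_norm_sq_to_K] at h2
  have h3 : ((‖h‖ ^ 2 : ℝ) : ℂ) = ((∫ ξ, ‖h ξ‖ ^ 2 : ℝ) : ℂ) := by
    rw [← integral_complex_ofReal]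
    push_cast
    exact h2
  exact_mod_cast h3.symm

theorem fhat_opJ_pow (m : ℕ) (x : RealL2) :
    fhat ((opJ ^ m) x) =ᵐ[volume] fun ξ => jsym ξ ^ m * fhat x ξ := by
  induction m with
  | zero => simp
  | succ m ih =>
    rw [pow_succ', mul_apply_eq_comp]
    filter_upwards [fhat_opJ ((opJ ^ m) x), ih] with ξ h1 h2
    rw [h1, h2]; ring

/-- The Sobolev norm of a function in the range of `J ^ m`. -/
theorem sobolevNorm_le_of_ae_eq {s : ℝ} {m : ℕ} (hs : s ≤ m) {f : ℝ → ℝ} {x : RealL2}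
    (h : f =ᵐ[volume] (opJ ^ m) x) : sobolevNorm s f ≤ ENNReal.ofReal ‖x‖ := by
  have hf : MemLp f 2 (volume : Measure ℝ) := (memLp_congr_ae h).2 (Lp.memLp _)
  have hfx : hf.toLp f = (opJ ^ m) x := Lp.ext (hf.coeFn_toLp.trans h)
  rw [sobolevNorm, dif_pos hf, sobolevSq_toComplexL2, hfx]
  have hle : (∫⁻ ξ : ℝ, ENNReal.ofReal ((1 + (2 * Real.pi * ξ) ^ 2) ^ s *
      ‖(1 : ℂ) * fhat ((opJ ^ m) x) ξ‖ ^ 2)) ≤ ENNReal.ofReal (‖x‖ ^ 2) := by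
    rw [← norm_fhat, ← lintegral_norm_sq_eq]
    refine lintegral_mono_ae ?_
    filter_upwards [fhat_opJ_pow m x] with ξ hξ
    refine ENNReal.ofReal_le_ofReal ?_
    rw [hξ, one_mul, norm_mul, norm_pow, norm_jsym, mul_pow (jsymR ξ ^ m), ← mul_assoc]
    refine mul_le_of_le_one_left (by positivity) ?_
    have h1 : (1 : ℝ) ≤ 1 + (2 * Real.pi * ξ) ^ 2 := by nlinarith [sq_nonneg (2 * Real.pi * ξ)]
    rw [← pow_mul, mul_comm m, pow_mul, jsymR_sq, inv_pow, mul_inv_le_iff₀ (by positivity), one_mul,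
      ← Real.rpow_natCast _ m]
    exact Real.rpow_le_rpow_of_exponent_le h1 hs
  calc _ ≤ ENNReal.ofReal (‖x‖ ^ 2) ^ (1 / 2 : ℝ) := ENNReal.rpow_le_rpow hle (by norm_num)
    _ = ENNReal.ofReal ‖x‖ := by
        rw [ENNReal.ofReal_rpow_of_nonneg (by positivity) (by norm_num), ← Real.sqrt_eq_rpow,
          Real.sqrt_sq (norm_nonneg _)]

/-- Applies an unbounded symbol w to f when the Sobolev weight controls w. It is used with (1 +
k²)^(m/2), to invert J^m, and with 1/(ik), to integrate. -/
theorem exists_fhat_eq_of_sobolevSq_lt_top {s : ℝ} {m w : ℝ → ℂ} (hw : Measurable w)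
    (hwc : ∀ ξ, starRingEnd ℂ (w (-ξ)) = w ξ) {f : ℝ → ℝ}
    (hf : MemLp f 2 (volume : Measure ℝ))
    (hwm : ∀ ξ, ‖w ξ‖ ^ 2 ≤ (1 + (2 * Real.pi * ξ) ^ 2) ^ s * ‖m (2 * Real.pi * ξ)‖ ^ 2)
    (hfin : sobolevSq s m (toComplexL2 f hf) ^ (1 / 2 : ℝ) < ⊤) :
    ∃ g : RealL2, fhat g =ᵐ[volume] (fun ξ => w ξ * fhat (hf.toLp f) ξ) ∧
      ENNReal.ofReal ‖g‖ ≤ sobolevSq s m (toComplexL2 f hf) ^ (1 / 2 : ℝ) := by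
  have hle : ∫⁻ ξ, ENNReal.ofReal (‖w ξ * fhat (hf.toLp f) ξ‖ ^ 2) ≤
      sobolevSq s m (toComplexL2 f hf) := by
    rw [sobolevSq_toComplexL2]
    refine lintegral_mono fun ξ => ENNReal.ofReal_le_ofReal ?_
    rw [norm_mul, norm_mul, mul_pow ‖w ξ‖, mul_pow ‖m _‖, ← mul_assoc]
    exact mul_le_mul_of_nonneg_right (hwm ξ) (by positivity)
  have hlt : sobolevSq s m (toComplexL2 f hf) < ⊤ := by
    by_contra hcon
    rw [not_lt_top_iff] at hcon
    rw [hcon, ENNReal.top_rpow_of_pos (by norm_num)] at hfin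
    exact lt_irrefl _ hfin
  have hmeas : AEStronglyMeasurable (fun ξ => w ξ * fhat (hf.toLp f) ξ) volume :=
    hw.aestronglyMeasurable.mul (Lp.aestronglyMeasurable _)
  have hmem : MemLp (fun ξ => w ξ * fhat (hf.toLp f) ξ) 2 (volume : Measure ℝ) := by
    rw [memLp_two_iff_integrable_sq_norm hmeas]
    refine ⟨hmeas.norm.pow 2, ?_⟩
    rw [hasFiniteIntegral_iff_ofReal (.of_forall fun ξ => by positivity)]
    exact hle.trans_lt hlt
  obtain ⟨g, hg⟩ := exists_fhat_eq_mul hwc _ hmem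
  have hgae : fhat g =ᵐ[volume] fun ξ => w ξ * fhat (hf.toLp f) ξ := by
    rw [hg]; exact hmem.coeFn_toLp
  refine ⟨g, hgae, ?_⟩
  have h1 : ENNReal.ofReal (‖g‖ ^ 2) ≤ sobolevSq s m (toComplexL2 f hf) := by
    rw [← norm_fhat, ← lintegral_norm_sq_eq]
    refine le_trans (le_of_eq (lintegral_congr_ae ?_)) hle
    filter_upwards [hgae] with ξ hξ
    rw [hξ]
  calc ENNReal.ofReal ‖g‖ = ENNReal.ofReal (‖g‖ ^ 2) ^ (1 / 2 : ℝ) := by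
        rw [ENNReal.ofReal_rpow_of_nonneg (by positivity) (by norm_num), ← Real.sqrt_eq_rpow,
          Real.sqrt_sq (norm_nonneg _)]
    _ ≤ _ := ENNReal.rpow_le_rpow h1 (by norm_num)

theorem memLp_of_sobolevNorm_lt_top {s : ℝ} {f : ℝ → ℝ} (h : sobolevNorm s f < ⊤) :
    MemLp f 2 (volume : Measure ℝ) := by
  by_contra hf
  rw [sobolevNorm, dif_neg hf] at h
  exact lt_irrefl _ h

/-- A function of finite Sobolev norm is in the range of a power of `J`. -/
theorem exists_opJ_pow_eq {s : ℝ} {m : ℕ} (hm : (m : ℝ) ≤ s) {f : ℝ → ℝ}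
    (hf : MemLp f 2 (volume : Measure ℝ)) (hfs : sobolevNorm s f < ⊤) :
    ∃ x : RealL2, (opJ ^ m) x = hf.toLp f ∧ ENNReal.ofReal ‖x‖ ≤ sobolevNorm s f := by
  rw [sobolevNorm, dif_pos hf] at hfs ⊢
  obtain ⟨g, hg, hgn⟩ := exists_fhat_eq_of_sobolevSq_lt_top (w := fun ξ => (jsym ξ ^ m)⁻¹)
    (by have := isSymbol_jsym.measurable; fun_prop)
    (fun ξ => by rw [map_inv₀, map_pow, isSymbol_jsym.conj_neg]) hf
    (fun ξ => by
      have h1 : (1 : ℝ) ≤ 1 + (2 * Real.pi * ξ) ^ 2 := by nlinarith [sq_nonneg (2 * Real.pi * ξ)]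
      rw [norm_inv, norm_pow, norm_jsym, inv_pow, ← pow_mul, mul_comm m, pow_mul, jsymR_sq,
        inv_pow, inv_inv, norm_one, one_pow, mul_one, ← Real.rpow_natCast _ m]
      exact Real.rpow_le_rpow_of_exponent_le h1 hm) hfs
  refine ⟨g, eq_of_fhat_ae ?_, hgn⟩
  filter_upwards [fhat_opJ_pow m g, hg] with ξ h1 h2
  have h3 : jsym ξ ≠ 0 := Complex.ofReal_ne_zero.2 (jsymR_pos ξ).ne'
  rw [h1, h2, ← mul_assoc, mul_inv_cancel₀ (pow_ne_zero m h3), one_mul]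

/-- A function whose antiderivative has finite Sobolev norm has an antiderivative in `L²`. -/
theorem exists_antideriv {s : ℝ} (hs : 0 ≤ s) {f : ℝ → ℝ} (hf : MemLp f 2 (volume : Measure ℝ))
    (hfs : sobolevNormAntideriv s f < ⊤) :
    ∃ D : RealL2, opK D = opJ (hf.toLp f) ∧ ENNReal.ofReal ‖D‖ ≤ sobolevNormAntideriv s f := by
  rw [sobolevNormAntideriv, dif_pos hf] at hfs ⊢
  obtain ⟨g, hg, hgn⟩ := exists_fhat_eq_of_sobolevSq_lt_top
    (w := fun ξ : ℝ => (Complex.I * ((2 * Real.pi * ξ : ℝ) : ℂ))⁻¹)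
    (by fun_prop)
    (fun ξ => by
      rw [map_inv₀, map_mul, Complex.conj_I, Complex.conj_ofReal]; push_cast; congr 1; ring) hf
    (fun ξ => by
      have h1 : (1 : ℝ) ≤ 1 + (2 * Real.pi * ξ) ^ 2 := by nlinarith [sq_nonneg (2 * Real.pi * ξ)]
      exact le_mul_of_one_le_left (by positivity) (Real.one_le_rpow h1 hs)) hfs
  refine ⟨g, eq_of_fhat_ae ?_, hgn⟩
  have h0 : ∀ᵐ ξ : ℝ, ξ ≠ 0 := Measure.ae_ne volume 0
  filter_upwards [fhat_opK g, hg, fhat_opJ (hf.toLp f), h0] with ξ h1 h2 h3 h4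
  have h5 : ((2 * Real.pi * ξ : ℝ) : ℂ) ≠ 0 :=
    Complex.ofReal_ne_zero.2 (mul_ne_zero (by positivity) h4)
  rw [h1, h2, h3, ksym, jsym, mul_inv]
  field_simp [Complex.I_ne_zero]

end SobolevNorm

/-! ### Translations and moving frames. -/

section Translation

/-- Translation by `a` on `L²(ℝ)`. -/
noncomputable def shift (a : ℝ) : RealL2 →L[ℝ] RealL2 :=
  (Lp.compMeasurePreservingₗᵢ ℝ (fun τ => τ - a)
    (measurePreserving_sub_right volume a)).toContinuousLinearMap

theorem coeFn_shift (a : ℝ) (f : RealL2) : shift a f =ᵐ[volume] fun τ => f (τ - a) :=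
  Lp.coeFn_compMeasurePreserving f (measurePreserving_sub_right volume a)

theorem norm_shift (a : ℝ) (f : RealL2) : ‖shift a f‖ = ‖f‖ :=
  Lp.norm_compMeasurePreserving f (measurePreserving_sub_right volume a)

theorem tendsto_shift {ι : Type*} {l : Filter ι} {a : ι → ℝ} {f : ι → RealL2} {a₀ : ℝ}
    {f₀ : RealL2} (ha : Tendsto a l (𝓝 a₀)) (hf : Tendsto f l (𝓝 f₀)) :
    Tendsto (fun i => shift (a i) (f i)) l (𝓝 (shift a₀ f₀)) := by
  have hg : Tendsto (fun i => (⟨fun τ : ℝ => τ - a i, by fun_prop⟩ : C(ℝ, ℝ))) l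
      (𝓝 ⟨fun τ : ℝ => τ - a₀, by fun_prop⟩) := by
    have hc : Continuous fun b : ℝ => (⟨fun τ : ℝ => τ - b, by fun_prop⟩ : C(ℝ, ℝ)) :=
      ContinuousMap.continuous_of_continuous_uncurry _ (by
        simp only [Function.uncurry_def, ContinuousMap.coe_mk]; fun_prop)
    exact (hc.tendsto a₀).comp ha
  exact hf.compMeasurePreservingLp hg (fun i => measurePreserving_sub_right volume (a i))
    (measurePreserving_sub_right volume a₀) (by norm_num)

theorem ae_comp_sub {p : ℝ → Prop} (h : ∀ᵐ τ, p τ) (a : ℝ) : ∀ᵐ τ, p (τ - a) :=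
  (measurePreserving_sub_right (volume : Measure ℝ) a).quasiMeasurePreserving.ae h

theorem evalJ_eq_of_ae {x : RealL2} {G : ℝ → ℝ} (hG : Continuous G)
    (h : opJ x =ᵐ[volume] G) (t : ℝ) : evalJ t x = G t :=
  congr_fun (((continuous_evalJ x).ae_eq_iff_eq volume hG).1 ((coeFn_opJ x).symm.trans h)) t

theorem shift_opJ (a : ℝ) (x : RealL2) :
    shift a (opJ x) =ᵐ[volume] fun τ => evalJ (τ - a) x := by
  filter_upwards [coeFn_shift a (opJ x), ae_comp_sub (coeFn_opJ x) a] with τ h1 h2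
  rw [h1, h2]

theorem memLp_evalJ (x : RealL2) : MemLp (fun t => evalJ t x) 2 (volume : Measure ℝ) :=
  (memLp_congr_ae (coeFn_opJ x)).1 (Lp.memLp _)

theorem opK_shift_opJ (a : ℝ) (y : RealL2) :
    opK (shift a (opJ y)) = opJ (shift a (opK y)) := by
  refine denseRange_opJ.induction_on
    (p := fun y => opK (shift a (opJ y)) = opJ (shift a (opK y)))
    y (isClosed_eq (by fun_prop) (by fun_prop)) fun z => ?_
  have h1 := shift_opJ a (opJ z)
  have h2 := shift_opJ a (opK z)
  have m1 := (memLp_congr_ae h1).1 (Lp.memLp _)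
  have m2 := (memLp_congr_ae h2).1 (Lp.memLp _)
  have key := opK_toLp_eq (fun t => (hasDerivAt_evalJ_opJ z (t - a)).comp_sub_const t a) m1 m2
  rw [← opJ_opK z]
  convert key using 2
  · exact Lp.ext (h1.trans m1.coeFn_toLp.symm)
  · exact Lp.ext (h2.trans m2.coeFn_toLp.symm)

theorem opK_shift {g g' : RealL2} (h : opK g = opJ g') (a : ℝ) :
    opK (shift a g) = opJ (shift a g') := by
  have h' : besselCalculus.IsDeriv g g' := h
  have := opK_shift_opJ a (opJ g - opK g')
  rwa [show opJ (opJ g - opK g') = g from h'.J_lift,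
    show opK (opJ g - opK g') = g' from h'.K_lift] at this

/-- J² is the inverse of 1 - ∂², and translation commutes with ∂. In terms of bounded operators this
is J² - K² = 1 inserted before and after two uses of `opK_shift_opJ`. -/
theorem opJ_opJ_shift (a : ℝ) (x : RealL2) :
    opJ (opJ (shift a x)) = shift a (opJ (opJ x)) := by
  have h1 := opK_shift_opJ a (opJ x)
  have h2 := opK_shift_opJ a (opK x)
  calc opJ (opJ (shift a x))
      = opJ (opJ (shift a (opJ (opJ x)))) - opJ (opJ (shift a (opK (opK x)))) := by
        rw [← map_sub, ← map_sub, ← map_sub, opJ_opJ_sub_opK_opK]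
    _ = opJ (opJ (shift a (opJ (opJ x)))) - opK (opK (shift a (opJ (opJ x)))) := by
        rw [← h2, opJ_opK, h1, opJ_opK x]
    _ = _ := opJ_opJ_sub_opK_opK _

theorem evalJ_opJ_shift (t a : ℝ) (x : RealL2) :
    evalJ t (opJ (shift a x)) = evalJ (t - a) (opJ x) := by
  refine evalJ_eq_of_ae ((continuous_evalJ (opJ x)).comp (continuous_sub_right a)) ?_ t
  rw [opJ_opJ_shift]
  exact shift_opJ a (opJ x)

/-- The generator of the translation group. -/
theorem hasDerivAt_shift {g g' : RealL2} (h : opK g = opJ g') (a : ℝ) :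
    HasDerivAt (fun a => shift a g) (-shift a g') a := by
  have hc : Continuous fun a => -shift a g' := by
    refine Continuous.neg (continuous_iff_continuousAt.2 fun b => ?_)
    exact tendsto_shift tendsto_id tendsto_const_nhds
  have key := hasDerivWithinAt_of_separating (fun t : ℝ => (evalJ t).comp opJ)
    (fun x hx => opJ_injective x (eq_zero_of_evalJ_eq_zero _ hx))
    (F := fun a => shift a g) (F' := fun a => -shift a g') (a := a - 1) (b := a + 1)
    hc.continuousOn (fun t b _ => by
      simp only [ContinuousLinearMap.comp_apply, map_neg, evalJ_opJ_shift]
      rw [← h]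
      exact ((hasDerivAt_evalJ_opJ g (t - b)).comp_const_sub t b).hasDerivWithinAt)
    a ⟨by linarith, by linarith⟩
  exact key.hasDerivAt (Icc_mem_nhds (by linarith) (by linarith))

/-- The derivative of a curve in a uniformly moving frame. -/
theorem hasDerivWithinAt_shift (c : ℝ) {y : ℝ → RealL2} {y' z : RealL2} {I : Set ℝ} {r : ℝ}
    (hy : HasDerivWithinAt y y' I r) (hz : opK (y r) = opJ z) :
    HasDerivWithinAt (fun r => shift (c * r) (y r))
      (shift (c * r) y' - c • shift (c * r) z) I r := by
  -- The curve is the translate of the fixed y(r), differentiated by the generator, plus the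
  -- translate of the increment, whose slopes converge by strong continuity of translations. Only
  -- y(r) needs a derivative in L².
  have h1 : HasDerivWithinAt (fun r' => shift (c * r') (y r))
      (-(c • shift (c * r) z)) I r := by
    have := (hasDerivAt_shift hz (c * r)).scomp r ((hasDerivAt_id r).const_mul c)
    refine this.hasDerivWithinAt.congr_deriv ?_
    simp
  have h2 : HasDerivWithinAt (fun r' => shift (c * r') (y r' - y r))
      (shift (c * r) y') I r := by
    rw [hasDerivWithinAt_iff_tendsto_slope] at hy ⊢
    have ha : Tendsto (fun r' => c * r') (𝓝[I \ {r}] r) (𝓝 (c * r)) :=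
      ((continuous_const_mul c).tendsto r).mono_left nhdsWithin_le_nhds
    refine (tendsto_shift ha hy).congr fun r' => ?_
    simp [slope_def_module]
  refine ((h2.add h1).congr_deriv (by abel)).congr (fun r' _ => ?_) ?_
  · simp
  · simp

end Translation

/-! ### The slow variable ε(t - r). -/

section Scaling

variable {ε : ℝ}

theorem quasiMeasurePreserving_mul_left (hε : 0 < ε) :
    Measure.QuasiMeasurePreserving (fun t : ℝ => ε * t) volume volume :=
  ⟨by fun_prop, by
    rw [Real.map_volume_mul_left hε.ne']
    exact Measure.smul_absolutelyContinuous⟩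

theorem ae_comp_mul_left (hε : 0 < ε) {p : ℝ → Prop} (h : ∀ᵐ τ, p τ) : ∀ᵐ t, p (ε * t) :=
  (quasiMeasurePreserving_mul_left hε).ae h

theorem memLp_comp_mul_left (hε : 0 < ε) (f : RealL2) :
    MemLp (fun t => f (ε * t)) 2 (volume : Measure ℝ) := by
  have h : MemLp f 2 (Measure.map (fun t : ℝ => ε * t) volume) := by
    rw [Real.map_volume_mul_left hε.ne']
    exact (Lp.memLp f).smul_measure ENNReal.ofReal_ne_top
  exact h.comp_of_map (by fun_prop)

theorem norm_sq_eq_integral (f : RealL2) : ‖f‖ ^ 2 = ∫ t, f t ^ 2 := by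
  rw [← real_inner_self_eq_norm_sq, L2.inner_def]
  refine integral_congr_ae (.of_forall fun t => ?_)
  simp [sq]

theorem exists_dilate (hε : 0 < ε) : ∃ T : RealL2 →L[ℝ] RealL2,
    (∀ f, T f =ᵐ[volume] fun t => f (ε * t)) ∧ ∀ f, ‖T f‖ ^ 2 = ε⁻¹ * ‖f‖ ^ 2 := by
  set T : RealL2 → RealL2 := fun f => (memLp_comp_mul_left hε f).toLp _ with hT
  have hT' : ∀ f, T f =ᵐ[volume] fun t => f (ε * t) :=
    fun f => (memLp_comp_mul_left hε f).coeFn_toLp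
  have hn : ∀ f, ‖T f‖ ^ 2 = ε⁻¹ * ‖f‖ ^ 2 := by
    intro f
    rw [norm_sq_eq_integral, norm_sq_eq_integral]
    have h1 : ∫ t, T f t ^ 2 = ∫ t, (fun τ => f τ ^ 2) (ε * t) := by
      refine integral_congr_ae ?_
      filter_upwards [hT' f] with t h
      rw [h]
    rw [h1, Measure.integral_comp_mul_left (fun τ => f τ ^ 2) ε, abs_of_pos (inv_pos.2 hε),
      smul_eq_mul]
  refine ⟨LinearMap.mkContinuous
    { toFun := T, map_add' := fun f g => ?_, map_smul' := fun c f => ?_ } (Real.sqrt ε⁻¹)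
    fun f => ?_, hT', hn⟩
  · refine Lp.ext ?_
    filter_upwards [hT' (f + g), hT' f, hT' g, Lp.coeFn_add (T f) (T g),
      ae_comp_mul_left hε (Lp.coeFn_add f g)] with t h1 h2 h3 h4 h5
    rw [h1, h4, Pi.add_apply, h2, h3, h5, Pi.add_apply]
  · refine Lp.ext ?_
    filter_upwards [hT' (c • f), hT' f, Lp.coeFn_smul c (T f),
      ae_comp_mul_left hε (Lp.coeFn_smul c f)] with t h1 h2 h3 h4
    rw [RingHom.id_apply, h1, h3, Pi.smul_apply, h2, h4, Pi.smul_apply]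
  · change ‖T f‖ ≤ _
    rw [← Real.sqrt_sq (norm_nonneg (T f)), hn, Real.sqrt_mul (by positivity),
      Real.sqrt_sq (norm_nonneg f)]

/-- The operator `f ↦ f(ε ·)` on `L²(ℝ)`. -/
noncomputable def dilate (hε : 0 < ε) : RealL2 →L[ℝ] RealL2 := (exists_dilate hε).choose

theorem coeFn_dilate (hε : 0 < ε) (f : RealL2) : dilate hε f =ᵐ[volume] fun t => f (ε * t) :=
  (exists_dilate hε).choose_spec.1 f

theorem norm_sq_dilate (hε : 0 < ε) (f : RealL2) : ‖dilate hε f‖ ^ 2 = ε⁻¹ * ‖f‖ ^ 2 :=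
  (exists_dilate hε).choose_spec.2 f

theorem opK_dilate_opJ (hε : 0 < ε) (y : RealL2) :
    opK (dilate hε (opJ y)) = opJ (ε • dilate hε (opK y)) := by
  refine denseRange_opJ.induction_on
    (p := fun y => opK (dilate hε (opJ y)) = opJ (ε • dilate hε (opK y)))
    y (isClosed_eq (by fun_prop) (by fun_prop)) fun z => ?_
  have h0 : ∀ x, dilate hε (opJ x) =ᵐ[volume] fun t => evalJ (ε * t) x := fun x => by
    filter_upwards [coeFn_dilate hε (opJ x), ae_comp_mul_left hε (coeFn_opJ x)] with t h1 h2
    rw [h1, h2]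
  have h1 := h0 (opJ z)
  have h2 : (ε • dilate hε (opJ (opK z)) : RealL2) =ᵐ[volume]
      fun t => ε * evalJ (ε * t) (opK z) := by
    filter_upwards [h0 (opK z), Lp.coeFn_smul ε (dilate hε (opJ (opK z)))] with t h1 h2
    rw [h2, Pi.smul_apply, h1, smul_eq_mul]
  have m1 := (memLp_congr_ae h1).1 (Lp.memLp _)
  have m2 := (memLp_congr_ae h2).1 (Lp.memLp _)
  have key := opK_toLp_eq (fun t => by
    have := (hasDerivAt_evalJ_opJ z (ε * t)).scomp t ((hasDerivAt_id t).const_mul ε)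
    refine this.congr_deriv ?_
    simp) m1 m2
  rw [← opJ_opK z]
  convert key using 2
  · exact Lp.ext (h1.trans m1.coeFn_toLp.symm)
  · exact Lp.ext (h2.trans m2.coeFn_toLp.symm)

theorem opK_dilate (hε : 0 < ε) {g g' : RealL2} (h : opK g = opJ g') :
    opK (dilate hε g) = opJ (ε • dilate hε g') := by
  have h' : besselCalculus.IsDeriv g g' := h
  have := opK_dilate_opJ hε (opJ g - opK g')
  rwa [show opJ (opJ g - opK g') = g from h'.J_lift,
    show opK (opJ g - opK g') = g' from h'.K_lift] at this

/-- The operator `f ↦ f(ε (· - r))` on `L²(ℝ)`. -/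
noncomputable def frame (hε : 0 < ε) (r : ℝ) : RealL2 →L[ℝ] RealL2 :=
  (dilate hε).comp (shift (ε * r))

variable (hε : 0 < ε) (r : ℝ)

theorem norm_sq_frame (f : RealL2) : ‖frame hε r f‖ ^ 2 = ε⁻¹ * ‖f‖ ^ 2 := by
  rw [frame, ContinuousLinearMap.comp_apply, norm_sq_dilate, norm_shift]

theorem coeFn_frame (f : RealL2) : frame hε r f =ᵐ[volume] fun t => f (ε * (t - r)) := by
  filter_upwards [coeFn_dilate hε (shift (ε * r) f),
    ae_comp_mul_left hε (coeFn_shift (ε * r) f)] with t h1 h2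
  rw [frame, ContinuousLinearMap.comp_apply, h1, h2, mul_sub]

theorem ae_comp_frame {ε : ℝ} (hε : 0 < ε) (r : ℝ) {p : ℝ → Prop} (h : ∀ᵐ τ, p τ) : ∀ᵐ t, p (ε * (t - r)) :=
  ae_comp_sub (ae_comp_mul_left hε h) r

theorem isDeriv_frame {g g' : RealL2} (h : besselCalculus.IsDeriv g g') :
    besselCalculus.IsDeriv (frame hε r g) (ε • frame hε r g') :=
  opK_dilate hε (opK_shift h (ε * r))

theorem frame_opJ (x : RealL2) :
    frame hε r (opJ x) =ᵐ[volume] fun t => evalJ (ε * (t - r)) x := by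
  filter_upwards [coeFn_frame hε r (opJ x), ae_comp_frame hε r (coeFn_opJ x)] with t h1 h2
  rw [h1, h2]

/-- Products in the moving frame. -/
theorem opM_frame (a x y : RealL2) (h : opJ y = frame hε r (opJ x)) :
    opM (frame hε r a) y = frame hε r (opM a x) := by
  refine Lp.ext ?_
  filter_upwards [coeFn_opM (frame hε r a) y, coeFn_opJ y, frame_opJ hε r x, coeFn_frame hε r a,
    coeFn_frame hε r (opM a x), ae_comp_frame hε r (coeFn_opM a x)] with t h1 h2 h3 h4 h5 h6
  rw [h1, h4, h5, h6, ← h2, h, h3]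

/-- The derivative of a slowly varying curve in the moving frame. -/
theorem hasDerivWithinAt_frame {y : ℝ → RealL2} {y' z : RealL2} {a b c d : ℝ}
    (hmaps : MapsTo (fun r => ε ^ 3 * r) (Icc a b) (Icc c d)) {r : ℝ}
    (hy : HasDerivWithinAt y y' (Icc c d) (ε ^ 3 * r))
    (hz : besselCalculus.IsDeriv (y (ε ^ 3 * r)) z) :
    HasDerivWithinAt (fun r => frame hε r (y (ε ^ 3 * r)))
      (ε ^ 3 • frame hε r y' - ε • frame hε r z) (Icc a b) r := by
  have h1 : HasDerivWithinAt (fun r => y (ε ^ 3 * r)) (ε ^ 3 • y') (Icc a b) r := by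
    have := hy.scomp r ((hasDerivAt_id r).const_mul (ε ^ 3)).hasDerivWithinAt hmaps
    exact this.congr_deriv (by simp)
  have h2 := (dilate hε).hasFDerivAt.comp_hasDerivWithinAt r (hasDerivWithinAt_shift ε h1 hz)
  refine h2.congr_deriv ?_
  simp [frame]

end Scaling

/-! ### The KdV ansatz and its residuals. -/

/-- A solution `A = J² α` of the cylindrical KdV equation as a curve in `L²(ℝ)`, with
`∂_ρ A = J² n`, `∂_τ³ A = A₃` and `∂_τ⁻¹ A = D`. -/
structure IsSlowProfile (C ρ₀ ρ₁ : ℝ) (α n A₃ D : ℝ → RealL2) : Prop where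
  hasDeriv : ∀ ρ ∈ Icc ρ₀ ρ₁, HasDerivWithinAt α (n ρ) (Icc ρ₀ ρ₁) ρ
  third : ∀ ρ ∈ Icc ρ₀ ρ₁, opK (opK (opK (α ρ))) = opJ (A₃ ρ)
  equation : ∀ ρ ∈ Icc ρ₀ ρ₁, (2 : ℝ) • opJ (opJ (n ρ)) + ρ⁻¹ • opJ (opJ (α ρ)) + A₃ ρ =
    (2 : ℝ) • opM (opJ (opK (α ρ))) (opJ (α ρ))
  antideriv : ∀ ρ ∈ Icc ρ₀ ρ₁, opK (D ρ) = opJ (opJ (opJ (α ρ)))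
  hasDeriv_antideriv : ∀ ρ ∈ Icc ρ₀ ρ₁, HasDerivWithinAt D
    (-((2 * ρ)⁻¹ • D ρ) + (2⁻¹ : ℝ) • (opM (opJ (opJ (α ρ))) (opJ (α ρ)) - opK (opK (α ρ))))
    (Icc ρ₀ ρ₁) ρ
  norm_le : ∀ ρ ∈ Icc ρ₀ ρ₁, ‖α ρ‖ ≤ C
  norm_deriv_le : ∀ ρ ∈ Icc ρ₀ ρ₁, ‖n ρ‖ ≤ C
  norm_antideriv_le : ∀ ρ ∈ Icc ρ₀ ρ₁, ‖D ρ‖ ≤ C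

section FluxCorrection

/-- The correction `(∂_τ² A - A² - ρ⁻¹ ∂_τ⁻¹ A) / 2` of the flux, for `A = J² α`. -/
noncomputable def fluxCorr (ρ : ℝ) (α D : RealL2) : RealL2 :=
  (2⁻¹ : ℝ) • opK (opK α) - (2⁻¹ : ℝ) • opM (opJ (opJ α)) (opJ α) - (2 * ρ)⁻¹ • D

/-- The `τ`-derivative of the flux correction. -/
noncomputable def fluxCorrTau (ρ : ℝ) (α A₃ : RealL2) : RealL2 :=
  (2⁻¹ : ℝ) • A₃ - opM (opJ (opK α)) (opJ α) - (2 * ρ)⁻¹ • opJ (opJ α)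

/-- The `ρ`-derivative of the flux correction. -/
noncomputable def fluxCorrRho (ρ : ℝ) (α n D : RealL2) : RealL2 :=
  (2⁻¹ : ℝ) • opK (opK n) - opM (opJ (opJ n)) (opJ α) + (2 * ρ ^ 2)⁻¹ • D -
    (2 * ρ)⁻¹ • (-((2 * ρ)⁻¹ • D) + (2⁻¹ : ℝ) • (opM (opJ (opJ α)) (opJ α) - opK (opK α)))

theorem isDeriv_fluxCorr {ρ : ℝ} {α A₃ D : RealL2} (h3 : opK (opK (opK α)) = opJ A₃)
    (hD : opK D = opJ (opJ (opJ α))) :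
    besselCalculus.IsDeriv (fluxCorr ρ α D) (fluxCorrTau ρ α A₃) := by
  have h2 : opK (opM (opJ (opJ α)) (opJ α)) = (2 : ℝ) • opJ (opM (opJ (opK α)) (opJ α)) := by
    rw [opK_opM, ← opJ_opK, map_add, two_smul]
  change opK _ = opJ _
  rw [fluxCorr, fluxCorrTau]
  simp only [map_sub, map_smul, h3, h2, hD]
  module

theorem IsSlowProfile.hasDerivWithinAt_fluxCorr {C ρ₀ ρ₁ : ℝ} {α n A₃ D : ℝ → RealL2}
    (h : IsSlowProfile C ρ₀ ρ₁ α n A₃ D) (hρ₀ : 0 < ρ₀) {ρ : ℝ} (hρ : ρ ∈ Icc ρ₀ ρ₁) :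
    HasDerivWithinAt (fun ρ => fluxCorr ρ (α ρ) (D ρ)) (fluxCorrRho ρ (α ρ) (n ρ) (D ρ))
      (Icc ρ₀ ρ₁) ρ := by
  have hρ0 : ρ ≠ 0 := (hρ₀.trans_le hρ.1).ne'
  have hα := h.hasDeriv ρ hρ
  have h1 := (opK ∘L opK).hasFDerivAt.comp_hasDerivWithinAt ρ hα
  have h2 := ((opM ∘L (opJ ∘L opJ)).hasFDerivAt.comp_hasDerivWithinAt ρ hα).clm_apply
    (opJ.hasFDerivAt.comp_hasDerivWithinAt ρ hα)
  have h3 : HasDerivWithinAt (fun ρ : ℝ => (2 * ρ)⁻¹) (-(2 * ρ ^ 2)⁻¹) (Icc ρ₀ ρ₁) ρ := by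
    have := (((hasDerivAt_id ρ).const_mul 2).inv (by simpa using hρ0)).hasDerivWithinAt
      (s := Icc ρ₀ ρ₁)
    refine this.congr_deriv ?_
    simp only [id]
    field_simp
  have h4 := h3.smul (h.hasDeriv_antideriv ρ hρ)
  refine (((h1.const_smul (2⁻¹ : ℝ)).sub (h2.const_smul (2⁻¹ : ℝ))).sub h4).congr_deriv ?_
  have hc := opM_opJ_comm (opJ (α ρ)) (opJ (n ρ))
  simp only [ContinuousLinearMap.comp_apply, fluxCorrRho, hc, Function.comp_apply]
  module

end FluxCorrection

section Approximation

variable {ε : ℝ} (hε : 0 < ε) (r : ℝ)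

/-- The sharp factor is ε^(-1/2). The cruder ε⁻¹ keeps powers integral and suffices where only
smallness of ψ and of the flux is needed. -/
theorem norm_frame_le (hε1 : ε ≤ 1) (y : RealL2) : ‖frame hε r y‖ ≤ ε⁻¹ * ‖y‖ := by
  refine le_of_pow_le_pow_left₀ two_ne_zero (by positivity) ?_
  rw [norm_sq_frame, mul_pow]
  have h1 : (1 : ℝ) ≤ ε⁻¹ := one_le_inv_iff₀.2 ⟨hε, hε1⟩
  have h2 : ε⁻¹ ≤ ε⁻¹ ^ 2 := by nlinarith
  gcongr

/-- The element whose image under `J` is `x(ε (· - r))`, if `x'` is the derivative of `x`. -/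
noncomputable def frameLift (x x' : RealL2) : RealL2 :=
  opJ (frame hε r x) - ε • opK (frame hε r x')

variable {x x' : RealL2}

theorem opJ_frameLift (h : opK x = opJ x') : opJ (frameLift hε r x x') = frame hε r x := by
  have := (isDeriv_frame hε r (show besselCalculus.IsDeriv x x' from h)).J_lift
  rwa [map_smul] at this

theorem opK_frameLift (h : opK x = opJ x') : opK (frameLift hε r x x') = ε • frame hε r x' := by
  have := (isDeriv_frame hε r (show besselCalculus.IsDeriv x x' from h)).K_lift
  rwa [map_smul] at this

theorem norm_frameLift_le (hε1 : ε ≤ 1) {B : ℝ} (hx : ‖x‖ ≤ B) (hx' : ‖x'‖ ≤ B) :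
    ‖frameLift hε r x x'‖ ≤ 2 * B * ε⁻¹ := by
  have h1 : ‖opJ (frame hε r x)‖ ≤ ε⁻¹ * B :=
    (besselCalculus.norm_J_le _).trans ((norm_frame_le hε r hε1 x).trans (by gcongr))
  have h2 : ‖opK (frame hε r x')‖ ≤ ε⁻¹ * B :=
    (besselCalculus.norm_K_le _).trans ((norm_frame_le hε r hε1 x').trans (by gcongr))
  have hB : 0 ≤ B := (norm_nonneg _).trans hx
  have h3 : 0 ≤ ε⁻¹ * B := by positivity
  rw [frameLift]
  refine (norm_sub_le _ _).trans ?_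
  rw [norm_smul, Real.norm_of_nonneg hε.le]
  nlinarith

/-- The approximate solution. -/
noncomputable def approxSol (α : RealL2) : RealL2 :=
  ε ^ 2 • frameLift hε r (opJ (opJ α)) (opJ (opK α))

/-- The derivative of the approximate solution. -/
noncomputable def approxSolDeriv (α n : RealL2) : RealL2 :=
  ε ^ 5 • frameLift hε r (opJ (opJ n)) (opJ (opK n)) -
    ε ^ 3 • frameLift hε r (opJ (opK α)) (opK (opK α))

/-- The flux of the approximate solution. -/
noncomputable def approxFlux (α k : RealL2) : RealL2 :=
  ε ^ 4 • frame hε r k - ε ^ 2 • frame hε r (opJ (opJ α))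

/-- The derivative of the flux of the approximate solution. -/
noncomputable def approxFluxDeriv (α n kτ kρ : RealL2) : RealL2 :=
  ε ^ 4 • (ε ^ 3 • frame hε r kρ - ε • frame hε r kτ) -
    ε ^ 2 • (ε ^ 3 • frame hε r (opJ (opJ n)) - ε • frame hε r (opJ (opK α)))

theorem opK_opJ_opJ (α : RealL2) : opK (opJ (opJ α)) = opJ (opJ (opK α)) := by
  rw [← opJ_opK, ← opJ_opK]

theorem opK_opJ_opK (α : RealL2) : opK (opJ (opK α)) = opJ (opK (opK α)) := (opJ_opK _).symm

theorem opJ_approxSol (α : RealL2) :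
    opJ (approxSol hε r α) = ε ^ 2 • frame hε r (opJ (opJ α)) := by
  rw [approxSol, map_smul, opJ_frameLift hε r (opK_opJ_opJ α)]

theorem opJ_approxSolDeriv (α n : RealL2) : opJ (approxSolDeriv hε r α n) =
    ε ^ 5 • frame hε r (opJ (opJ n)) - ε ^ 3 • frame hε r (opJ (opK α)) := by
  rw [approxSolDeriv, map_sub, map_smul, map_smul, opJ_frameLift hε r (opK_opJ_opJ n),
    opJ_frameLift hε r (opK_opJ_opK α)]

/-- The residual of the approximate solution in the implicit equation. -/
theorem approx_implicit {ρ : ℝ} {α n A₃ D : RealL2} (h3 : opK (opK (opK α)) = opJ A₃)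
    (heq : (2 : ℝ) • opJ (opJ n) + ρ⁻¹ • opJ (opJ α) + A₃ = (2 : ℝ) • opM (opJ (opK α)) (opJ α))
    (hD : opK D = opJ (opJ (opJ α))) :
    approxSolDeriv hε r α n +
      (2 : ℝ) • opJ (opM (opJ (approxSolDeriv hε r α n)) (approxSol hε r α)) =
    opK (approxFlux hε r α (fluxCorr ρ α D)) +
      opJ (ε ^ 7 • frame hε r ((2 : ℝ) • opM (opJ (opJ n)) (opJ α) - opK (opK n))) := by
  have e1 : opK (frame hε r (opK (opK α))) = ε • opJ (frame hε r A₃) := by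
    rw [← map_smul]; exact isDeriv_frame hε r h3
  have e2 : opK (frame hε r (opJ (opK n))) = ε • opJ (frame hε r (opK (opK n))) := by
    rw [← map_smul]; exact isDeriv_frame hε r (opK_opJ_opK n)
  have e3 : opK (frame hε r (opJ (opJ α))) = ε • opJ (frame hε r (opJ (opK α))) := by
    rw [← map_smul]; exact isDeriv_frame hε r (opK_opJ_opJ α)
  have e4 : opK (frame hε r (fluxCorr ρ α D)) = ε • opJ (frame hε r (fluxCorrTau ρ α A₃)) := by
    rw [← map_smul]; exact isDeriv_frame hε r (isDeriv_fluxCorr h3 hD)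
  have eM : ∀ a, opM (frame hε r a) (frameLift hε r (opJ (opJ α)) (opJ (opK α))) =
      frame hε r (opM a (opJ α)) := fun a =>
    opM_frame hε r a (opJ α) _ (opJ_frameLift hε r (opK_opJ_opJ α))
  have hs := congrArg (fun x => opJ (frame hε r x)) heq
  simp only [map_add, map_smul] at hs
  have l1 : frameLift hε r (opJ (opJ n)) (opJ (opK n)) =
      opJ (frame hε r (opJ (opJ n))) - ε • opK (frame hε r (opJ (opK n))) := rfl
  have l2 : frameLift hε r (opJ (opK α)) (opK (opK α)) =
      opJ (frame hε r (opJ (opK α))) - ε • opK (frame hε r (opK (opK α))) := rfl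
  rw [opJ_approxSolDeriv, approxSolDeriv, approxSol, approxFlux, l1, l2]
  simp only [map_sub, map_smul, e1, e2, e3, e4, eM, sub_apply,
    smul_apply, fluxCorrTau]
  -- The ε³ terms cancel identically and the ε⁵ terms add up to half of the cylindrical KdV
  -- equation.
  linear_combination (norm := module) (ε ^ 5 / 2) • hs

/-- The residual of the approximate solution in the equation for the flux. -/
theorem approx_flux {ρ : ℝ} (hr : r ≠ 0) (hρ : ρ = ε ^ 3 * r) {α n A₃ D kρ : RealL2}
    (heq : (2 : ℝ) • opJ (opJ n) + ρ⁻¹ • opJ (opJ α) + A₃ =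
      (2 : ℝ) • opM (opJ (opK α)) (opJ α)) :
    approxFluxDeriv hε r α n (fluxCorrTau ρ α A₃) kρ =
      -(r⁻¹ • approxFlux hε r α (fluxCorr ρ α D)) + opK (approxSol hε r α) +
      ε ^ 7 • frame hε r (kρ + ρ⁻¹ • fluxCorr ρ α D) := by
  have hs := congrArg (fun x => frame hε r x) heq
  simp only [map_add, map_smul] at hs
  have hr' : r⁻¹ = ε ^ 3 * ρ⁻¹ := by rw [hρ]; field_simp
  rw [approxFluxDeriv, approxFlux, approxSol, map_smul, opK_frameLift hε r (opK_opJ_opJ α), hr',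
    fluxCorrTau]
  simp only [map_add, map_sub, map_smul]
  -- Here r⁻¹ = ε³ρ⁻¹ puts the term Q/r at the order of the slow derivative; the ε⁵ terms are minus
  -- half of the KdV equation.
  linear_combination (norm := module) (-(ε ^ 5 / 2)) • hs

end Approximation

/-! ### Bounds for the flux correction. -/

section Bounds

theorem norm_opJ_le (x : RealL2) : ‖opJ x‖ ≤ ‖x‖ := besselCalculus.norm_J_le x

theorem norm_opK_le (x : RealL2) : ‖opK x‖ ≤ ‖x‖ := besselCalculus.norm_K_le x

theorem norm_opM_opJ_opJ_le {x y : RealL2} {C : ℝ} (hx : ‖x‖ ≤ C) (hy : ‖y‖ ≤ C) :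
    ‖opM (opJ (opJ x)) (opJ y)‖ ≤ ‖opM‖ * C ^ 2 := by
  have hC : 0 ≤ C := (norm_nonneg _).trans hx
  calc ‖opM (opJ (opJ x)) (opJ y)‖ ≤ ‖opM‖ * ‖opJ (opJ x)‖ * ‖opJ y‖ := opM.le_opNorm₂ _ _
    _ ≤ ‖opM‖ * C * C := by
        gcongr
        · exact (norm_opJ_le _).trans ((norm_opJ_le _).trans hx)
        · exact (norm_opJ_le _).trans hy
    _ = _ := by ring

variable {C ρ₀ ρ : ℝ} {α n D : RealL2}

theorem norm_fluxCorr_le (hρ₀ : 0 < ρ₀) (hρ : ρ₀ ≤ ρ) (hα : ‖α‖ ≤ C) (hD : ‖D‖ ≤ C) :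
    ‖fluxCorr ρ α D‖ ≤ C + ‖opM‖ * C ^ 2 + ρ₀⁻¹ * C := by
  have hC : 0 ≤ C := (norm_nonneg _).trans hα
  have hρ0 : 0 < ρ := hρ₀.trans_le hρ
  have h1 : ‖opK (opK α)‖ ≤ C := (norm_opK_le _).trans ((norm_opK_le _).trans hα)
  have h2 := norm_opM_opJ_opJ_le hα hα
  have h3 : ‖(2 * ρ)⁻¹ • D‖ ≤ ρ₀⁻¹ * C := by
    rw [norm_smul, Real.norm_of_nonneg (by positivity)]
    gcongr
    linarith
  have h4 : ‖(2⁻¹ : ℝ) • opK (opK α)‖ ≤ C := by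
    rw [norm_smul, Real.norm_of_nonneg (by norm_num)]; linarith [norm_nonneg (opK (opK α))]
  have h5 : ‖(2⁻¹ : ℝ) • opM (opJ (opJ α)) (opJ α)‖ ≤ ‖opM‖ * C ^ 2 := by
    rw [norm_smul, Real.norm_of_nonneg (by norm_num)]
    linarith [norm_nonneg (opM (opJ (opJ α)) (opJ α))]
  refine (norm_sub_le _ _).trans (add_le_add ((norm_sub_le _ _).trans (add_le_add h4 h5)) h3)

theorem norm_fluxCorrRho_add_le (hρ₀ : 0 < ρ₀) (hρ : ρ₀ ≤ ρ) (hα : ‖α‖ ≤ C) (hn : ‖n‖ ≤ C)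
    (hD : ‖D‖ ≤ C) : ‖fluxCorrRho ρ α n D + ρ⁻¹ • fluxCorr ρ α D‖ ≤
      C + ‖opM‖ * C ^ 2 + ρ₀⁻¹ ^ 2 * C + 2 * (ρ₀⁻¹ * (C + ‖opM‖ * C ^ 2 + ρ₀⁻¹ * C)) := by
  have hC : 0 ≤ C := (norm_nonneg _).trans hα
  have hρ0 : 0 < ρ := hρ₀.trans_le hρ
  have hk := norm_fluxCorr_le hρ₀ hρ hα hD
  have h0 : 0 ≤ C + ‖opM‖ * C ^ 2 + ρ₀⁻¹ * C := (norm_nonneg _).trans hk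
  have hk' : ‖ρ⁻¹ • fluxCorr ρ α D‖ ≤ ρ₀⁻¹ * (C + ‖opM‖ * C ^ 2 + ρ₀⁻¹ * C) := by
    rw [norm_smul, Real.norm_of_nonneg (by positivity)]
    gcongr
  have h1 : ‖(2⁻¹ : ℝ) • opK (opK n)‖ ≤ C := by
    have : ‖opK (opK n)‖ ≤ C := (norm_opK_le _).trans ((norm_opK_le _).trans hn)
    rw [norm_smul, Real.norm_of_nonneg (by norm_num)]; linarith [norm_nonneg (opK (opK n))]
  have h2 := norm_opM_opJ_opJ_le hn hα
  have h3 : ‖(2 * ρ ^ 2)⁻¹ • D‖ ≤ ρ₀⁻¹ ^ 2 * C := by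
    rw [norm_smul, Real.norm_of_nonneg (by positivity), inv_pow]
    gcongr
    nlinarith
  have h4 : ‖(2 * ρ)⁻¹ • (-((2 * ρ)⁻¹ • D) +
      (2⁻¹ : ℝ) • (opM (opJ (opJ α)) (opJ α) - opK (opK α)))‖ ≤
      ρ₀⁻¹ * (C + ‖opM‖ * C ^ 2 + ρ₀⁻¹ * C) := by
    rw [norm_smul, Real.norm_of_nonneg (by positivity)]
    gcongr
    · linarith
    · have h5 := norm_opM_opJ_opJ_le hα hα
      have h6 : ‖opK (opK α)‖ ≤ C := (norm_opK_le _).trans ((norm_opK_le _).trans hα)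
      have h7 : ‖(2 * ρ)⁻¹ • D‖ ≤ ρ₀⁻¹ * C := by
        rw [norm_smul, Real.norm_of_nonneg (by positivity)]
        gcongr
        linarith
      refine (norm_add_le _ _).trans ?_
      rw [norm_neg, norm_smul (2⁻¹ : ℝ), Real.norm_of_nonneg (by norm_num : (0 : ℝ) ≤ 2⁻¹)]
      have h8 := norm_sub_le (opM (opJ (opJ α)) (opJ α)) (opK (opK α))
      nlinarith [norm_nonneg (opM (opJ (opJ α)) (opJ α)), norm_nonneg (opK (opK α)),
        norm_nonneg (opM (opJ (opJ α)) (opJ α) - opK (opK α))]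
  rw [fluxCorrRho]
  refine (norm_add_le _ _).trans ?_
  refine (add_le_add ((norm_sub_le _ _).trans (add_le_add ((norm_add_le _ _).trans
    (add_le_add ((norm_sub_le _ _).trans (add_le_add h1 h2)) h3)) h4)) hk').trans (le_of_eq ?_)
  ring

end Bounds

/-! ### Size of the ansatz and the solution near it. -/

section Approximation

variable {ε : ℝ} (hε : 0 < ε) {C ρ₀ ρ₁ : ℝ} {α n A₃ D : ℝ → RealL2}

theorem mapsTo_scale {ε : ℝ} (hε : 0 < ε) (ρ₀ ρ₁ : ℝ) : MapsTo (fun r => ε ^ 3 * r)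
    (Icc (ρ₀ * (ε ^ 3)⁻¹) (ρ₁ * (ε ^ 3)⁻¹)) (Icc ρ₀ ρ₁) := by
  rintro r ⟨h1, h2⟩
  have h3 : 0 < ε ^ 3 := by positivity
  constructor
  · rwa [← div_eq_mul_inv, div_le_iff₀' h3] at h1
  · rwa [← div_eq_mul_inv, le_div_iff₀' h3] at h2

variable {r : ℝ}

theorem IsSlowProfile.hasDerivWithinAt_approxSol (h : IsSlowProfile C ρ₀ ρ₁ α n A₃ D)
    (hr : r ∈ Icc (ρ₀ * (ε ^ 3)⁻¹) (ρ₁ * (ε ^ 3)⁻¹)) :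
    HasDerivWithinAt (fun r => approxSol hε r (α (ε ^ 3 * r)))
      (approxSolDeriv hε r (α (ε ^ 3 * r)) (n (ε ^ 3 * r)))
      (Icc (ρ₀ * (ε ^ 3)⁻¹) (ρ₁ * (ε ^ 3)⁻¹)) r := by
  have hmaps := mapsTo_scale hε ρ₀ ρ₁
  have hα := h.hasDeriv _ (hmaps hr)
  have h1 := hasDerivWithinAt_frame hε hmaps
    ((opJ ∘L opJ).hasFDerivAt.comp_hasDerivWithinAt _ hα) (opK_opJ_opJ (α (ε ^ 3 * r)))
  have h2 := hasDerivWithinAt_frame hε hmaps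
    ((opJ ∘L opK).hasFDerivAt.comp_hasDerivWithinAt _ hα) (opK_opJ_opK (α (ε ^ 3 * r)))
  have h3 := ((opJ.hasFDerivAt.comp_hasDerivWithinAt r h1).sub
    ((opK.hasFDerivAt.comp_hasDerivWithinAt r h2).const_smul ε)).const_smul (ε ^ 2)
  refine h3.congr_deriv ?_
  simp only [approxSolDeriv, frameLift, map_sub, map_smul, ContinuousLinearMap.comp_apply]
  module

theorem IsSlowProfile.hasDerivWithinAt_approxFlux (h : IsSlowProfile C ρ₀ ρ₁ α n A₃ D)
    (hρ₀ : 0 < ρ₀) (hr : r ∈ Icc (ρ₀ * (ε ^ 3)⁻¹) (ρ₁ * (ε ^ 3)⁻¹)) :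
    HasDerivWithinAt (fun r => approxFlux hε r (α (ε ^ 3 * r))
        (fluxCorr (ε ^ 3 * r) (α (ε ^ 3 * r)) (D (ε ^ 3 * r))))
      (approxFluxDeriv hε r (α (ε ^ 3 * r)) (n (ε ^ 3 * r))
        (fluxCorrTau (ε ^ 3 * r) (α (ε ^ 3 * r)) (A₃ (ε ^ 3 * r)))
        (fluxCorrRho (ε ^ 3 * r) (α (ε ^ 3 * r)) (n (ε ^ 3 * r)) (D (ε ^ 3 * r))))
      (Icc (ρ₀ * (ε ^ 3)⁻¹) (ρ₁ * (ε ^ 3)⁻¹)) r := by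
  have hmaps := mapsTo_scale hε ρ₀ ρ₁
  have hα := h.hasDeriv _ (hmaps hr)
  have h1 := hasDerivWithinAt_frame hε hmaps
    ((opJ ∘L opJ).hasFDerivAt.comp_hasDerivWithinAt _ hα) (opK_opJ_opJ (α (ε ^ 3 * r)))
  have h2 := hasDerivWithinAt_frame hε hmaps
    (h.hasDerivWithinAt_fluxCorr hρ₀ (hmaps hr))
    (isDeriv_fluxCorr (h.third _ (hmaps hr)) (h.antideriv _ (hmaps hr)))
  exact (h2.const_smul (ε ^ 4)).sub (h1.const_smul (ε ^ 2))

/-- The exact scaling is used: the square of ε⁷, times ε⁻¹ from the stretched variable, is ε¹³. This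
half power is what produces the exponent 7/2. -/
theorem norm_sq_smul_frame_le (r : ℝ) {y : RealL2} {B : ℝ} (hy : ‖y‖ ≤ B) :
    ‖ε ^ 7 • frame hε r y‖ ^ 2 ≤ B ^ 2 * ε ^ 13 := by
  rw [norm_smul, mul_pow, norm_sq_frame, Real.norm_of_nonneg (by positivity)]
  have h1 : (ε ^ 7) ^ 2 * (ε⁻¹ * ‖y‖ ^ 2) = ‖y‖ ^ 2 * ε ^ 13 := by field_simp
  rw [h1]
  gcongr

/-- The moving frame leaves sup norms unchanged, so no negative power of ε appears. -/
theorem norm_opM_approxSol_le (r : ℝ) {α : RealL2} (hα : ‖α‖ ≤ C) (x : RealL2) :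
    ‖opM x (approxSol hε r α)‖ ≤ evalConst * C * ε ^ 2 * ‖x‖ := by
  refine norm_opM_le_of_bound ?_ x
  rw [opJ_approxSol]
  filter_upwards [Lp.coeFn_smul (ε ^ 2) (frame hε r (opJ (opJ α))), frame_opJ hε r (opJ α)]
    with t h1 h2
  rw [h1, Pi.smul_apply, h2, smul_eq_mul, abs_mul, abs_of_nonneg (by positivity), mul_comm]
  have h3 := abs_evalJ_le (ε * (t - r)) (opJ α)
  have h4 := evalConst_nonneg
  gcongr
  refine h3.trans ?_
  gcongr
  exact (norm_opJ_le _).trans hα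

theorem norm_opM_approxSolDeriv_le (hε1 : ε ≤ 1) (r : ℝ) {α n : RealL2} (hα : ‖α‖ ≤ C)
    (hn : ‖n‖ ≤ C) (x : RealL2) :
    ‖opM x (approxSolDeriv hε r α n)‖ ≤ 2 * evalConst * C * ε ^ 3 * ‖x‖ := by
  refine norm_opM_le_of_bound ?_ x
  rw [opJ_approxSolDeriv]
  have h4 := evalConst_nonneg
  have hC : 0 ≤ C := (norm_nonneg _).trans hα
  filter_upwards [Lp.coeFn_smul (ε ^ 5) (frame hε r (opJ (opJ n))), frame_opJ hε r (opJ n),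
    Lp.coeFn_smul (ε ^ 3) (frame hε r (opJ (opK α))), frame_opJ hε r (opK α),
    Lp.coeFn_sub (ε ^ 5 • frame hε r (opJ (opJ n))) (ε ^ 3 • frame hε r (opJ (opK α)))]
    with t h1 h2 h3 h5 h6
  rw [h6, Pi.sub_apply, h1, h3, Pi.smul_apply, Pi.smul_apply, h2, h5, smul_eq_mul, smul_eq_mul]
  have h7 : |evalJ (ε * (t - r)) (opJ n)| ≤ evalConst * C :=
    (abs_evalJ_le _ _).trans (by gcongr; exact (norm_opJ_le _).trans hn)
  have h8 : |evalJ (ε * (t - r)) (opK α)| ≤ evalConst * C :=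
    (abs_evalJ_le _ _).trans (by gcongr; exact (norm_opK_le _).trans hα)
  have h9 : ε ^ 5 ≤ ε ^ 3 := pow_le_pow_of_le_one hε.le hε1 (by norm_num)
  refine (abs_sub _ _).trans ?_
  rw [abs_mul, abs_mul, abs_of_nonneg (by positivity : 0 ≤ ε ^ 5),
    abs_of_nonneg (by positivity : 0 ≤ ε ^ 3)]
  calc _ ≤ ε ^ 3 * (evalConst * C) + ε ^ 3 * (evalConst * C) := by gcongr
    _ = _ := by ring

theorem norm_approxSol_le (hε1 : ε ≤ 1) (r : ℝ) {α : RealL2} (hα : ‖α‖ ≤ C) :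
    ‖approxSol hε r α‖ ≤ 2 * C * ε := by
  rw [approxSol, norm_smul, Real.norm_of_nonneg (by positivity)]
  have h1 := norm_frameLift_le hε r hε1 (x := opJ (opJ α)) (x' := opJ (opK α)) (B := C)
    ((norm_opJ_le _).trans ((norm_opJ_le _).trans hα))
    ((norm_opJ_le _).trans ((norm_opK_le _).trans hα))
  calc _ ≤ ε ^ 2 * (2 * C * ε⁻¹) := by gcongr
    _ = 2 * C * ε := by field_simp

theorem norm_approxFlux_le (hε1 : ε ≤ 1) (r : ℝ) {α k : RealL2} {B : ℝ} (hα : ‖α‖ ≤ C)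
    (hk : ‖k‖ ≤ B) : ‖approxFlux hε r α k‖ ≤ (B + C) * ε := by
  have h1 : ‖frame hε r (opJ (opJ α))‖ ≤ ε⁻¹ * C := (norm_frame_le hε r hε1 _).trans
    (by gcongr; exact (norm_opJ_le _).trans ((norm_opJ_le _).trans hα))
  have h2 : ‖frame hε r k‖ ≤ ε⁻¹ * B := (norm_frame_le hε r hε1 _).trans (by gcongr)
  have h3 : ε ^ 4 ≤ ε ^ 2 := pow_le_pow_of_le_one hε.le hε1 (by norm_num)
  have hB : 0 ≤ B := (norm_nonneg _).trans hk
  rw [approxFlux]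
  refine (norm_sub_le _ _).trans ?_
  rw [norm_smul, norm_smul, Real.norm_of_nonneg (by positivity), Real.norm_of_nonneg (by positivity)]
  calc _ ≤ ε ^ 2 * (ε⁻¹ * B) + ε ^ 2 * (ε⁻¹ * C) := by gcongr
    _ = _ := by field_simp

/-- Existence of a solution close to the approximate one. -/
theorem exists_solution_near_profile (hC : 0 < C) (hρ₀ : 0 < ρ₀) (hρ₁ : ρ₀ < ρ₁) :
    ∃ ε₀ > (0 : ℝ), ∃ C₀ > (0 : ℝ), ∀ ε ∈ Ioo 0 ε₀, ∀ α n A₃ D : ℝ → RealL2,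
      IsSlowProfile C ρ₀ ρ₁ α n A₃ D → ∀ m : ℕ, ∃ f g q : ℝ → RealL2,
        besselCalculus.IsSolutionOn (Icc (ρ₀ * (ε ^ 3)⁻¹) (ρ₁ * (ε ^ 3)⁻¹)) f g q ∧
        besselCalculus.RegOn m (Icc (ρ₀ * (ε ^ 3)⁻¹) (ρ₁ * (ε ^ 3)⁻¹)) f ∧
        besselCalculus.RegOn m (Icc (ρ₀ * (ε ^ 3)⁻¹) (ρ₁ * (ε ^ 3)⁻¹)) g ∧
        ∀ r ∈ Icc (ρ₀ * (ε ^ 3)⁻¹) (ρ₁ * (ε ^ 3)⁻¹), ∀ t,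
          |evalJ t (f r) - ε ^ 2 * evalJ (ε * (t - r)) (opJ (α (ε ^ 3 * r)))| ≤
            C₀ * ε ^ (7 / 2 : ℝ) := by
  set B₁ : ℝ := C + ‖opM‖ * C ^ 2 + ρ₀⁻¹ * C with hB₁
  set B₂ : ℝ := C + ‖opM‖ * C ^ 2 + ρ₀⁻¹ ^ 2 * C + 2 * (ρ₀⁻¹ * B₁) with hB₂
  set B₃ : ℝ := 2 * (‖opM‖ * C ^ 2) + C with hB₃
  have hE := evalConst_nonneg
  have hB₁0 : 0 ≤ B₁ := by positivity
  -- A sum dominating all the constants required of the ansatz: B₁ bounds the flux correction, B₂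
  -- and B₃ the profiles of the two residuals.
  set C' : ℝ := 2 * C + B₁ + B₂ ^ 2 + B₃ ^ 2 + 2 * evalConst * C with hC'
  have hEC : 0 ≤ evalConst * C := by positivity
  have hC'0 : 0 < C' := by positivity
  obtain ⟨ε₁, hε₁, C₀, hC₀, key⟩ := besselCalculus.exists_solution_near hC'0 hρ₀ hρ₁
  refine ⟨min 1 ε₁, by positivity, (evalConst + 1) * Real.sqrt C₀, by positivity, ?_⟩
  rintro ε ⟨hε, hεlt⟩ α n A₃ D hp m
  have hε1 : ε ≤ 1 := hεlt.le.trans (min_le_left _ _)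
  set I := Icc (ρ₀ * (ε ^ 3)⁻¹) (ρ₁ * (ε ^ 3)⁻¹) with hI
  have hmaps : ∀ r ∈ I, ε ^ 3 * r ∈ Icc ρ₀ ρ₁ := fun r hr => mapsTo_scale hε ρ₀ ρ₁ hr
  have hε3 : 0 < ε ^ 3 := by positivity
  have hmono : ∀ {b c : ℝ}, b ≤ C' → 0 ≤ c → b * c ≤ C' * c := fun h1 h2 =>
    mul_le_mul_of_nonneg_right h1 h2
  obtain ⟨f, g, q, hsol, hf, hg, hnear⟩ := key ε ⟨hε, hεlt.trans_le (min_le_right _ _)⟩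
    (ρ₀ * (ε ^ 3)⁻¹) (ρ₁ * (ε ^ 3)⁻¹) rfl rfl
    (fun r => approxSol hε r (α (ε ^ 3 * r)))
    (fun r => approxSolDeriv hε r (α (ε ^ 3 * r)) (n (ε ^ 3 * r)))
    (fun r => approxFlux hε r (α (ε ^ 3 * r))
      (fluxCorr (ε ^ 3 * r) (α (ε ^ 3 * r)) (D (ε ^ 3 * r))))
    (fun r => approxFluxDeriv hε r (α (ε ^ 3 * r)) (n (ε ^ 3 * r))
      (fluxCorrTau (ε ^ 3 * r) (α (ε ^ 3 * r)) (A₃ (ε ^ 3 * r)))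
      (fluxCorrRho (ε ^ 3 * r) (α (ε ^ 3 * r)) (n (ε ^ 3 * r)) (D (ε ^ 3 * r))))
    (fun r => ε ^ 7 • frame hε r ((2 : ℝ) • opM (opJ (opJ (n (ε ^ 3 * r))))
      (opJ (α (ε ^ 3 * r))) - opK (opK (n (ε ^ 3 * r)))))
    (fun r => ε ^ 7 • frame hε r (fluxCorrRho (ε ^ 3 * r) (α (ε ^ 3 * r)) (n (ε ^ 3 * r))
      (D (ε ^ 3 * r)) + (ε ^ 3 * r)⁻¹ • fluxCorr (ε ^ 3 * r) (α (ε ^ 3 * r)) (D (ε ^ 3 * r))))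
    (fun r hr => hp.hasDerivWithinAt_approxSol hε hr)
    (fun r hr => hp.hasDerivWithinAt_approxFlux hε hρ₀ hr)
    (fun r hr => approx_implicit hε r (hp.third _ (hmaps r hr)) (hp.equation _ (hmaps r hr))
      (hp.antideriv _ (hmaps r hr)))
    (fun r hr => approx_flux hε r (by
        have := hρ₀.trans_le (hmaps r hr).1
        rintro rfl; simp at this) rfl (hp.equation _ (hmaps r hr)))
    (fun r hr x => (norm_opM_approxSol_le hε r (hp.norm_le _ (hmaps r hr)) x).trans (by
      refine mul_le_mul_of_nonneg_right (hmono ?_ (by positivity)) (norm_nonneg _)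
      nlinarith [sq_nonneg B₂, sq_nonneg B₃]))
    (fun r hr x => (norm_opM_approxSolDeriv_le hε hε1 r (hp.norm_le _ (hmaps r hr))
      (hp.norm_deriv_le _ (hmaps r hr)) x).trans (by
      refine mul_le_mul_of_nonneg_right (hmono ?_ (by positivity)) (norm_nonneg _)
      nlinarith [sq_nonneg B₂, sq_nonneg B₃]))
    (fun r hr => (norm_approxSol_le hε hε1 r (hp.norm_le _ (hmaps r hr))).trans
      (hmono (by nlinarith [sq_nonneg B₂, sq_nonneg B₃]) hε.le))
    (fun r hr => (norm_approxFlux_le hε hε1 r (hp.norm_le _ (hmaps r hr))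
      (norm_fluxCorr_le hρ₀ (hmaps r hr).1 (hp.norm_le _ (hmaps r hr))
        (hp.norm_antideriv_le _ (hmaps r hr)))).trans
      (hmono (by nlinarith [sq_nonneg B₂, sq_nonneg B₃]) hε.le))
    (fun r hr => (norm_sq_smul_frame_le hε r (B := B₃) (by
        have h1 := norm_opM_opJ_opJ_le (hp.norm_deriv_le _ (hmaps r hr))
          (hp.norm_le _ (hmaps r hr))
        refine (norm_sub_le _ _).trans (add_le_add ?_ ((norm_opK_le _).trans
          ((norm_opK_le _).trans (hp.norm_deriv_le _ (hmaps r hr)))))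
        rw [norm_smul, Real.norm_ofNat]
        gcongr)).trans
      (hmono (by nlinarith [sq_nonneg B₂, sq_nonneg B₃]) (by positivity)))
    (fun r hr => (norm_sq_smul_frame_le hε r (B := B₂) (norm_fluxCorrRho_add_le hρ₀
        (hmaps r hr).1 (hp.norm_le _ (hmaps r hr)) (hp.norm_deriv_le _ (hmaps r hr))
        (hp.norm_antideriv_le _ (hmaps r hr)))).trans
      (hmono (by nlinarith [sq_nonneg B₂, sq_nonneg B₃]) (by positivity))) m
  refine ⟨f, g, q, hsol, hf, hg, fun r hr t => ?_⟩
  have h1 : evalJ t (approxSol hε r (α (ε ^ 3 * r))) =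
      ε ^ 2 * evalJ (ε * (t - r)) (opJ (α (ε ^ 3 * r))) := by
    refine evalJ_eq_of_ae (G := fun t => ε ^ 2 * evalJ (ε * (t - r)) (opJ (α (ε ^ 3 * r))))
      (((continuous_evalJ _).comp (by fun_prop)).const_mul _) ?_ t
    rw [opJ_approxSol]
    filter_upwards [Lp.coeFn_smul (ε ^ 2) (frame hε r (opJ (opJ (α (ε ^ 3 * r))))),
      frame_opJ hε r (opJ (α (ε ^ 3 * r)))] with t h1 h2
    rw [h1, Pi.smul_apply, h2, smul_eq_mul]
  rw [← h1, ← map_sub]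
  have h2 : ‖f r - approxSol hε r (α (ε ^ 3 * r))‖ ≤ Real.sqrt C₀ * ε ^ (7 / 2 : ℝ) := by
    refine le_of_pow_le_pow_left₀ two_ne_zero (by positivity) ((hnear r hr).trans (le_of_eq ?_))
    rw [mul_pow, Real.sq_sqrt hC₀.le, ← Real.rpow_natCast (ε ^ (7 / 2 : ℝ)), ← Real.rpow_mul hε.le,
      ← Real.rpow_natCast]
    norm_num
  refine (abs_evalJ_le _ _).trans ?_
  have h3 : 0 ≤ Real.sqrt C₀ * ε ^ (7 / 2 : ℝ) := by positivity
  nlinarith [norm_nonneg (f r - approxSol hε r (α (ε ^ 3 * r)))]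

end Approximation

/-! ### From cylindrical KdV solutions to curves in L². -/

section Profile

theorem ofReal_norm_le_sobolevNorm {s : ℝ} {m : ℕ} (hm : (m : ℝ) ≤ s) {f : ℝ → ℝ} {x : RealL2}
    (h : f =ᵐ[volume] (opJ ^ m) x) : ENNReal.ofReal ‖x‖ ≤ sobolevNorm s f := by
  rcases lt_or_eq_of_le (le_top (a := sobolevNorm s f)) with hlt | heq
  · have hf := memLp_of_sobolevNorm_lt_top hlt
    obtain ⟨y, hy, hyn⟩ := exists_opJ_pow_eq hm hf hlt
    have h1 : (opJ ^ m) y = (opJ ^ m) x := by rw [hy]; exact Lp.ext (hf.coeFn_toLp.trans h)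
    have h2 : y = x := sub_eq_zero.1 (besselCalculus.J_pow_injective m (y - x) (by
      change (opJ ^ m) (y - x) = 0
      rw [map_sub, h1, sub_self]))
    rwa [← h2]
  · rw [heq]; exact le_top

/-- J^m is injective, so lifts are unique and the lift of a difference is the difference of the
lifts. Sobolev norms of differences dominate the norms of lifted differences, hence continuity
transfers. -/
theorem exists_regular_lift {s : ℝ} {m : ℕ} (hm : (m : ℝ) ≤ s) {I : Set ℝ} {A : ℝ → ℝ → ℝ}
    (hA : ContinuousInSobolev s I A) : ∃ a : ℝ → RealL2, ContinuousOn a I ∧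
      (∀ ρ ∈ I, A ρ =ᵐ[volume] (opJ ^ m) (a ρ)) ∧
      ∀ ρ ∈ I, ENNReal.ofReal ‖a ρ‖ ≤ sobolevNorm s (A ρ) := by
  have h1 : ∀ ρ, ∃ x : RealL2, ρ ∈ I → A ρ =ᵐ[volume] (opJ ^ m) x := by
    intro ρ
    by_cases hρ : ρ ∈ I
    · have hf := memLp_of_sobolevNorm_lt_top (hA ρ hρ).1
      obtain ⟨x, hx, -⟩ := exists_opJ_pow_eq hm hf (hA ρ hρ).1
      exact ⟨x, fun _ => by rw [hx]; exact hf.coeFn_toLp.symm⟩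
    · exact ⟨0, fun h => absurd h hρ⟩
  choose a ha using h1
  refine ⟨a, fun ρ hρ => ?_, ha, fun ρ hρ => ofReal_norm_le_sobolevNorm hm (ha ρ hρ)⟩
  have h2 : Tendsto (fun ρ' => ENNReal.ofReal ‖a ρ' - a ρ‖) (𝓝[I] ρ) (𝓝 0) := by
    refine tendsto_of_tendsto_of_tendsto_of_le_of_le' tendsto_const_nhds (hA ρ hρ).2
      (.of_forall fun _ => bot_le) ?_
    filter_upwards [self_mem_nhdsWithin] with ρ' hρ'
    refine ofReal_norm_le_sobolevNorm hm ?_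
    rw [map_sub]
    filter_upwards [ha ρ hρ, ha ρ' hρ', Lp.coeFn_sub ((opJ ^ m) (a ρ')) ((opJ ^ m) (a ρ))]
      with t h1 h2 h3
    rw [h3, Pi.sub_apply, ← h1, ← h2]
  have h3 := (ENNReal.tendsto_toReal ENNReal.zero_ne_top).comp h2
  rw [ContinuousWithinAt, tendsto_iff_norm_sub_tendsto_zero]
  refine h3.congr fun ρ' => ?_
  simp

theorem iteratedDeriv_three_evalJ (a : RealL2) (τ : ℝ) :
    iteratedDeriv 3 (fun τ => evalJ τ (opJ (opJ (opJ (opJ a))))) τ =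
      evalJ τ (opJ (opK (opK (opK a)))) := by
  have h : ∀ b, deriv (fun τ => evalJ τ (opJ b)) = fun τ => evalJ τ (opK b) :=
    fun b => funext fun τ => (hasDerivAt_evalJ_opJ b τ).deriv
  rw [iteratedDeriv_succ', iteratedDeriv_succ', iteratedDeriv_one, h]
  simp only [← opJ_opK, h]

theorem deriv_sq_evalJ (b : RealL2) (τ : ℝ) :
    deriv (fun τ => evalJ τ (opJ b) ^ 2) τ = 2 * (evalJ τ (opK b) * evalJ τ (opJ b)) := by
  have := (hasDerivAt_evalJ_opJ b τ).pow 2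
  exact this.deriv.trans (by push_cast; ring)

theorem evalJ_eq_mul {y p q : RealL2} (h : opJ y = opM (opJ p) q) (τ : ℝ) :
    evalJ τ y = evalJ τ p * evalJ τ q := by
  refine evalJ_eq_of_ae (G := fun τ => evalJ τ p * evalJ τ q)
    ((continuous_evalJ p).mul (continuous_evalJ q)) ?_ τ
  rw [h]
  filter_upwards [coeFn_opM (opJ p) q, coeFn_opJ p] with t h1 h2
  rw [h1, h2]

/-- The evolution of the antiderivative of a solution of the cylindrical KdV equation. -/
theorem hasDerivWithinAt_antideriv {ρ₀ ρ₁ : ℝ} (hρ₀ : 0 < ρ₀) {α n A₃ D : ℝ → RealL2}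
    (hα : ∀ ρ ∈ Icc ρ₀ ρ₁, HasDerivWithinAt α (n ρ) (Icc ρ₀ ρ₁) ρ)
    (h3 : ∀ ρ ∈ Icc ρ₀ ρ₁, opK (opK (opK (α ρ))) = opJ (A₃ ρ))
    (heq : ∀ ρ ∈ Icc ρ₀ ρ₁, (2 : ℝ) • opJ (opJ (n ρ)) + ρ⁻¹ • opJ (opJ (α ρ)) + A₃ ρ =
      (2 : ℝ) • opM (opJ (opK (α ρ))) (opJ (α ρ)))
    (hD : ∀ ρ ∈ Icc ρ₀ ρ₁, opK (D ρ) = opJ (opJ (opJ (α ρ)))) :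
    ∀ ρ ∈ Icc ρ₀ ρ₁, HasDerivWithinAt D
      (-((2 * ρ)⁻¹ • D ρ) + (2⁻¹ : ℝ) • (opM (opJ (opJ (α ρ))) (opJ (α ρ)) - opK (opK (α ρ))))
      (Icc ρ₀ ρ₁) ρ := by
  have hpos : ∀ ρ ∈ Icc ρ₀ ρ₁, 0 < ρ := fun ρ hρ => hρ₀.trans_le hρ.1
  have hαc : ContinuousOn α (Icc ρ₀ ρ₁) := fun ρ hρ => (hα ρ hρ).continuousWithinAt
  set X : ℝ → RealL2 := fun ρ =>
    (2⁻¹ : ℝ) • (opM (opJ (opJ (α ρ))) (opJ (α ρ)) - opK (opK (α ρ))) with hX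
  have hXc : ContinuousOn X (Icc ρ₀ ρ₁) := by
    have h1 : Continuous fun y : RealL2 =>
      (2⁻¹ : ℝ) • (opM (opJ (opJ y)) (opJ y) - opK (opK y)) := by fun_prop
    exact h1.comp_continuousOn hαc
  have hKX : ∀ ρ ∈ Icc ρ₀ ρ₁, opK (X ρ) =
      opJ (opJ (opJ (n ρ))) + (2 * ρ)⁻¹ • opJ (opJ (opJ (α ρ))) := by
    intro ρ hρ
    have h2 : opK (opM (opJ (opJ (α ρ))) (opJ (α ρ))) =
        (2 : ℝ) • opJ (opM (opJ (opK (α ρ))) (opJ (α ρ))) := by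
      rw [opK_opM, ← opJ_opK, map_add, two_smul]
    have h4 := congrArg opJ (heq ρ hρ)
    simp only [map_add, map_smul] at h4
    simp only [hX, map_smul, map_sub, h2, h3 ρ hρ, mul_inv]
    linear_combination (norm := module) (-(2⁻¹ : ℝ)) • h4
  -- The factor √ρ absorbs the term D/(2ρ). The candidate derivative √ρ X then involves only the
  -- continuous curve α and not D, whose continuity is not known beforehand. Injectivity of K lifts
  -- the derivative of K(√ρ D).
  have hW := hasDerivWithinAt_of_separating (fun _ : Unit => opK)
    (fun x hx => opK_injective x (hx ())) (F := fun ρ => Real.sqrt ρ • D ρ)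
    (F' := fun ρ => Real.sqrt ρ • X ρ) (a := ρ₀) (b := ρ₁)
    (Real.continuous_sqrt.continuousOn.smul hXc) (fun _ ρ hρ => by
      have hs := (Real.hasDerivAt_sqrt (hpos ρ hρ).ne').hasDerivWithinAt (s := Icc ρ₀ ρ₁)
      have h1 := hs.smul ((opJ ∘L opJ ∘L opJ).hasFDerivAt.comp_hasDerivWithinAt ρ (hα ρ hρ))
      refine (h1.congr_deriv ?_).congr (fun ρ' hρ' => ?_) ?_
      · simp only [ContinuousLinearMap.comp_apply, map_smul, hKX ρ hρ, Function.comp_apply, smul_add,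
          smul_smul]
        congr 2
        have h5 : Real.sqrt ρ ≠ 0 := (Real.sqrt_pos.2 (hpos ρ hρ)).ne'
        have h6 : ρ ≠ 0 := (hpos ρ hρ).ne'
        field_simp
        exact (Real.sq_sqrt (hpos ρ hρ).le).symm
      · rw [map_smul, hD ρ' hρ']; rfl
      · rw [map_smul, hD ρ hρ]; rfl)
  intro ρ hρ
  have hs0 : Real.sqrt ρ ≠ 0 := (Real.sqrt_pos.2 (hpos ρ hρ)).ne'
  have hs := ((Real.hasDerivAt_sqrt (hpos ρ hρ).ne').inv hs0).hasDerivWithinAt (s := Icc ρ₀ ρ₁)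
  refine ((hs.smul (hW ρ hρ)).congr_deriv ?_).congr (fun ρ' hρ' => ?_) ?_
  · have h6 : Real.sqrt ρ ^ 2 = ρ := Real.sq_sqrt (hpos ρ hρ).le
    simp only [Pi.inv_apply, smul_smul, inv_mul_cancel₀ hs0, one_smul]
    rw [add_comm]
    congr 1
    rw [← neg_smul]
    congr 1
    rw [h6]
    have h7 : ρ ≠ 0 := (hpos ρ hρ).ne'
    field_simp
  · have : Real.sqrt ρ' ≠ 0 := (Real.sqrt_pos.2 (hpos ρ' hρ')).ne'
    simp only [Pi.smul_apply', Pi.inv_apply, smul_smul, inv_mul_cancel₀ this, one_smul]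
  · simp only [Pi.smul_apply', Pi.inv_apply, smul_smul, inv_mul_cancel₀ hs0, one_smul]

/-- Solutions of the cylindrical KdV equation are profiles, with uniform bounds. -/
theorem exists_isSlowProfile {sA ρ₀ ρ₁ C₁ : ℝ} (hsA : 17 / 2 < sA) (hρ₀ : 0 < ρ₀)
    (hC₁ : 0 < C₁) : ∃ C > (0 : ℝ), ∀ A : ℝ → ℝ → ℝ, IsCKdVSolution sA ρ₀ ρ₁ A →
      (∀ ρ ∈ Icc ρ₀ ρ₁,
        sobolevNorm sA (A ρ) + sobolevNormAntideriv (sA - 2) (A ρ) ≤ ENNReal.ofReal C₁) →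
      ∃ α n A₃ D : ℝ → RealL2, IsSlowProfile C ρ₀ ρ₁ α n A₃ D ∧
        ∀ ρ ∈ Icc ρ₀ ρ₁, ∀ τ, A ρ τ = evalJ τ (opJ (α ρ)) := by
  -- H² is an algebra: this writes A ∂_τA as J² of an element of L², as the equation for ∂_ρA = J² n
  -- requires.
  obtain ⟨N, hN⟩ := besselCalculus.exists_M_J_pow 2
  replace hN : ∀ a g, opM (opJ (opJ a)) (opJ (opJ g)) = opJ (opJ (N a g)) := by
    intro a g
    have := hN a g
    simp only [pow_two, mul_apply_eq_comp] at this
    exact this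
  refine ⟨C₁ + ρ₀⁻¹ * C₁ + ‖N‖ * C₁ ^ 2, by positivity, fun A hA hb => ?_⟩
  have hpos : ∀ ρ ∈ Icc ρ₀ ρ₁, 0 < ρ := fun ρ hρ => hρ₀.trans_le hρ.1
  have hle : C₁ ≤ C₁ + ρ₀⁻¹ * C₁ + ‖N‖ * C₁ ^ 2 := by
    have : 0 ≤ ρ₀⁻¹ * C₁ + ‖N‖ * C₁ ^ 2 := by positivity
    linarith
  -- Two powers of J are kept in A = J² α; the other three are spent on ∂_τ³.
  obtain ⟨a, hac, haA, han⟩ := exists_regular_lift (m := 5) (s := sA) (by norm_num; linarith)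
    hA.continuous_curve
  have han' : ∀ ρ ∈ Icc ρ₀ ρ₁, ‖a ρ‖ ≤ C₁ := fun ρ hρ =>
    (ENNReal.ofReal_le_ofReal_iff hC₁.le).1
      ((han ρ hρ).trans (le_self_add.trans (hb ρ hρ)))
  have hJ3 : ∀ x, ‖opJ (opJ (opJ x))‖ ≤ ‖x‖ := fun x =>
    (norm_opJ_le _).trans ((norm_opJ_le _).trans (norm_opJ_le _))
  have hK3 : ∀ x, ‖opK (opK (opK x))‖ ≤ ‖x‖ := fun x =>
    (norm_opK_le _).trans ((norm_opK_le _).trans (norm_opK_le _))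
  set α : ℝ → RealL2 := fun ρ => opJ (opJ (opJ (a ρ))) with hα
  -- The KdV equation solved for ∂_ρA, with two powers of J removed.
  set n : ℝ → RealL2 := fun ρ => N (opJ (opJ (opK (a ρ)))) (opJ (opJ (a ρ))) -
    (2 * ρ)⁻¹ • α ρ - (2⁻¹ : ℝ) • opK (opK (opK (a ρ))) with hn
  set A₃ : ℝ → RealL2 := fun ρ => opJ (opJ (opK (opK (opK (a ρ))))) with hA₃
  have hAeq : ∀ ρ ∈ Icc ρ₀ ρ₁, A ρ =ᵐ[volume] opJ (opJ (α ρ)) := by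
    intro ρ hρ
    have := haA ρ hρ
    simpa only [show (5 : ℕ) = 4 + 1 from rfl, pow_succ, pow_zero, one_mul, mul_apply_eq_comp]
      using this
  have hAval : ∀ ρ ∈ Icc ρ₀ ρ₁, ∀ τ, A ρ τ = evalJ τ (opJ (α ρ)) := fun ρ hρ τ =>
    (evalJ_eq_of_ae (hA.contDiff ρ hρ).continuous (hAeq ρ hρ).symm τ).symm
  have hnc : ContinuousOn n (Icc ρ₀ ρ₁) := by
    have h1 : ContinuousOn (fun ρ : ℝ => (2 * ρ)⁻¹) (Icc ρ₀ ρ₁) :=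
      (continuous_const_mul (2 : ℝ)).continuousOn.inv₀ fun ρ hρ => by
        have := hpos ρ hρ; positivity
    have h2 : Continuous fun x => N (opJ (opJ (opK x))) (opJ (opJ x)) := by fun_prop
    have h3 : Continuous fun x => opJ (opJ (opJ x)) := by fun_prop
    have h4 : Continuous fun x => (2⁻¹ : ℝ) • opK (opK (opK x)) := by fun_prop
    exact ((h2.comp_continuousOn hac).sub (h1.smul (h3.comp_continuousOn hac))).sub
      (h4.comp_continuousOn hac)
  have h3 : ∀ ρ, opK (opK (opK (α ρ))) = opJ (A₃ ρ) := fun ρ => by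
    simp only [hα, hA₃, ← opJ_opK]
  have hprod : ∀ ρ, opM (opJ (opK (α ρ))) (opJ (α ρ)) =
      opJ (opJ (N (opJ (opJ (opK (a ρ)))) (opJ (opJ (a ρ))))) := fun ρ => by
    rw [← hN]; simp only [hα, ← opJ_opK]
  have heq : ∀ ρ, (2 : ℝ) • opJ (opJ (n ρ)) + ρ⁻¹ • opJ (opJ (α ρ)) + A₃ ρ =
      (2 : ℝ) • opM (opJ (opK (α ρ))) (opJ (α ρ)) := fun ρ => by
    rw [hprod]
    simp only [hn, hA₃, map_sub, map_smul, mul_inv]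
    module
  have hderiv : ∀ ρ ∈ Icc ρ₀ ρ₁, HasDerivWithinAt α (n ρ) (Icc ρ₀ ρ₁) ρ := by
    -- The equation holds pointwise in τ. Point values separate L² elements and n is continuous, so
    -- the pointwise ρ-derivatives upgrade to a derivative in L².
    refine hasDerivWithinAt_of_separating (fun τ : ℝ => (evalJ τ).comp opJ)
      (fun x hx => opJ_injective x (eq_zero_of_evalJ_eq_zero _ hx)) hnc fun τ ρ hρ => ?_
    obtain ⟨Aρ, h1, h2⟩ := hA.equation ρ hρ τ
    refine (h1.congr_deriv ?_).congr (fun ρ' hρ' => (hAval ρ' hρ' τ).symm) (hAval ρ hρ τ).symm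
    have hfun : A ρ = fun τ => evalJ τ (opJ (α ρ)) := funext (hAval ρ hρ)
    rw [hfun, iteratedDeriv_three_evalJ, deriv_sq_evalJ] at h2
    have h4 : evalJ τ (opJ (N (opJ (opJ (opK (a ρ)))) (opJ (opJ (a ρ))))) =
        evalJ τ (opK (α ρ)) * evalJ τ (opJ (α ρ)) := evalJ_eq_mul (hprod ρ).symm τ
    simp only [ContinuousLinearMap.comp_apply, hn, map_sub, map_smul, h4, smul_eq_mul, mul_inv]
    linear_combination h2 / 2
  have hDex : ∀ ρ, ∃ D : RealL2, ρ ∈ Icc ρ₀ ρ₁ → opK D = opJ (opJ (opJ (α ρ))) ∧ ‖D‖ ≤ C₁ := by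
    intro ρ
    by_cases hρ : ρ ∈ Icc ρ₀ ρ₁
    · have hf := memLp_of_sobolevNorm_lt_top (hA.continuous_curve ρ hρ).1
      have hle' : sobolevNormAntideriv (sA - 2) (A ρ) ≤ ENNReal.ofReal C₁ :=
        le_add_self.trans (hb ρ hρ)
      obtain ⟨D, hD, hDn⟩ := exists_antideriv (s := sA - 2) (by linarith) hf
        (hle'.trans_lt ENNReal.ofReal_lt_top)
      refine ⟨D, fun _ => ⟨?_, (ENNReal.ofReal_le_ofReal_iff hC₁.le).1 (hDn.trans hle')⟩⟩
      rw [hD]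
      congr 1
      exact Lp.ext (hf.coeFn_toLp.trans (hAeq ρ hρ))
    · exact ⟨0, fun h => absurd h hρ⟩
  choose D hD using hDex
  refine ⟨α, n, A₃, D, ⟨hderiv, fun ρ _ => h3 ρ, fun ρ _ => heq ρ, fun ρ hρ => (hD ρ hρ).1,
    hasDerivWithinAt_antideriv hρ₀ hderiv (fun ρ _ => h3 ρ) (fun ρ _ => heq ρ)
      fun ρ hρ => (hD ρ hρ).1,
    fun ρ hρ => (hJ3 _).trans ((han' ρ hρ).trans hle), fun ρ hρ => ?_,
    fun ρ hρ => (hD ρ hρ).2.trans hle⟩, hAval⟩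
  · have ha := han' ρ hρ
    have hρ0 := hpos ρ hρ
    have b1 : ‖N (opJ (opJ (opK (a ρ)))) (opJ (opJ (a ρ)))‖ ≤ ‖N‖ * C₁ ^ 2 := by
      refine (N.le_opNorm₂ _ _).trans ?_
      rw [pow_two, ← mul_assoc]
      gcongr
      · exact (norm_opJ_le _).trans ((norm_opJ_le _).trans ((norm_opK_le _).trans ha))
      · exact (norm_opJ_le _).trans ((norm_opJ_le _).trans ha)
    have b2 : ‖(2 * ρ)⁻¹ • α ρ‖ ≤ ρ₀⁻¹ * C₁ := by
      rw [norm_smul, Real.norm_of_nonneg (by positivity)]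
      gcongr
      · linarith [hρ.1]
      · exact (hJ3 _).trans ha
    have b3 : ‖(2⁻¹ : ℝ) • opK (opK (opK (a ρ)))‖ ≤ C₁ := by
      rw [norm_smul, Real.norm_of_nonneg (by norm_num)]
      linarith [(hK3 (a ρ)).trans ha, norm_nonneg (opK (opK (opK (a ρ))))]
    refine ((norm_sub_le _ _).trans (add_le_add ((norm_sub_le _ _).trans
      (add_le_add b1 b2)) b3)).trans (le_of_eq ?_)
    ring

end Profile

/-! ### Back to the radial Boussinesq equation. -/

section Solution

theorem evalJ_ae_eq_opJ_pow {m : ℕ} {x X : RealL2} (h : x = (opJ ^ m) X) :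
    (fun t => evalJ t x) =ᵐ[volume] (opJ ^ (m + 1)) X := by
  rw [pow_succ', mul_apply_eq_comp, ← h]
  exact (coeFn_opJ x).symm

theorem sobolevNorm_evalJ_le {s : ℝ} {m : ℕ} (hs : s ≤ m) {x X : RealL2} (h : x = (opJ ^ m) X) :
    sobolevNorm s (fun t => evalJ t x) ≤ ENNReal.ofReal ‖X‖ :=
  sobolevNorm_le_of_ae_eq (m := m + 1) (by push_cast; linarith) (evalJ_ae_eq_opJ_pow h)

theorem continuousInSobolev_evalJ {s : ℝ} {m : ℕ} (hs : s ≤ m) {I : Set ℝ} {f : ℝ → RealL2}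
    (hf : besselCalculus.RegOn m I f) : ContinuousInSobolev s I fun r t => evalJ t (f r) := by
  obtain ⟨F, hF, hfF⟩ := hf
  refine fun r hr => ⟨(sobolevNorm_evalJ_le hs (hfF r hr)).trans_lt ENNReal.ofReal_lt_top, ?_⟩
  have h1 : Tendsto (fun r' => ENNReal.ofReal ‖F r' - F r‖) (𝓝[I] r) (𝓝 0) := by
    have := ENNReal.tendsto_ofReal (tendsto_iff_norm_sub_tendsto_zero.1 (hF r hr))
    rwa [ENNReal.ofReal_zero] at this
  refine tendsto_of_tendsto_of_tendsto_of_le_of_le' tendsto_const_nhds h1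
    (.of_forall fun _ => bot_le) ?_
  filter_upwards [self_mem_nhdsWithin] with r' hr'
  simp only [← map_sub]
  refine sobolevNorm_evalJ_le hs ?_
  rw [hfF r hr, hfF r' hr', map_sub]
  rfl

/-- The derivative is known in L² for f only. As J^m is injective and the lift of g is continuous,
it holds for the lifts too, and the norm of a lift controls the Sobolev norm. -/
theorem hasDerivInSobolev_evalJ {s : ℝ} {m : ℕ} (hs : s ≤ m) {a b : ℝ} {f g : ℝ → RealL2}
    (hf : besselCalculus.RegOn m (Icc a b) f) (hg : besselCalculus.RegOn m (Icc a b) g)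
    (hfg : ∀ r ∈ Icc a b, HasDerivWithinAt f (g r) (Icc a b) r) :
    HasDerivInSobolev s (Icc a b) (fun r t => evalJ t (f r)) fun r t => evalJ t (g r) := by
  obtain ⟨F, hF, hfF⟩ := hf
  obtain ⟨G, hG, hgG⟩ := hg
  have hFG : ∀ r ∈ Icc a b, HasDerivWithinAt F (G r) (Icc a b) r := by
    refine hasDerivWithinAt_of_separating (fun _ : Unit => besselCalculus.J ^ m)
      (fun x hx => besselCalculus.J_pow_injective m x (hx ())) hG fun _ r hr => ?_
    rw [← hgG r hr]
    exact (hfg r hr).congr (fun r' hr' => (hfF r' hr').symm) (hfF r hr).symm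
  intro r hr
  have h1 : Tendsto (fun r' => ENNReal.ofReal ‖slope F r r' - G r‖)
      (𝓝[Icc a b \ {r}] r) (𝓝 0) := by
    have := ENNReal.tendsto_ofReal (tendsto_iff_norm_sub_tendsto_zero.1
      (hasDerivWithinAt_iff_tendsto_slope.1 (hFG r hr)))
    rwa [ENNReal.ofReal_zero] at this
  refine tendsto_of_tendsto_of_tendsto_of_le_of_le' tendsto_const_nhds h1
    (.of_forall fun _ => bot_le) ?_
  filter_upwards [self_mem_nhdsWithin] with r' hr'
  have h2 : (fun t => (evalJ t (f r') - evalJ t (f r)) / (r' - r) - evalJ t (g r)) =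
      fun t => evalJ t ((r' - r)⁻¹ • (f r' - f r) - g r) := by
    ext t
    rw [map_sub, map_smul, map_sub, smul_eq_mul, div_eq_inv_mul]
  rw [h2]
  refine sobolevNorm_evalJ_le hs ?_
  rw [hfF r hr, hfF r' hr'.1, hgG r hr, slope_def_module, map_sub, map_smul, map_sub]
  rfl

theorem inner_toLp_eq {x : RealL2} {h G : ℝ → ℝ} (hx : x =ᵐ[volume] h)
    (hG : MemLp G 2 (volume : Measure ℝ)) : ⟪x, hG.toLp G⟫ = ∫ t, h t * G t := by
  rw [L2.inner_def]
  refine integral_congr_ae ?_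
  filter_upwards [hx, hG.coeFn_toLp] with t h1 h2
  rw [h1, h2]; simp [mul_comm]

theorem isRadialBoussinesqSolution_evalJ {s a b : ℝ} {m : ℕ} (hs : s ≤ m) {f g q : ℝ → RealL2}
    (hsol : besselCalculus.IsSolutionOn (Icc a b) f g q)
    (hf : besselCalculus.RegOn m (Icc a b) f) (hg : besselCalculus.RegOn m (Icc a b) g) :
    IsRadialBoussinesqSolution 1 s a b fun r t => evalJ t (f r) where
  continuous_rep r _ := continuous_evalJ (f r)
  continuous_curve := continuousInSobolev_evalJ hs hf
  deriv_curve := ⟨fun r t => evalJ t (g r), continuousInSobolev_evalJ hs hg,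
    hasDerivInSobolev_evalJ hs hf hg hsol.deriv_fst⟩
  equation φ hφ hφc := by
    have hc1 : HasCompactSupport (deriv φ) := hφc.deriv
    have hd1 : ContDiff ℝ ∞ (deriv φ) := (contDiff_infty_iff_deriv.1 hφ).2
    have hd2 : ContDiff ℝ ∞ (deriv (deriv φ)) := (contDiff_infty_iff_deriv.1 hd1).2
    have it2 : iteratedDeriv 2 φ = deriv (deriv φ) := by
      rw [iteratedDeriv_succ', iteratedDeriv_one]
    have m0 : MemLp φ 2 (volume : Measure ℝ) := hφ.continuous.memLp_of_hasCompactSupport hφc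
    have m1 : MemLp (deriv φ) 2 (volume : Measure ℝ) :=
      hd1.continuous.memLp_of_hasCompactSupport hc1
    have m2 : MemLp (deriv (deriv φ)) 2 (volume : Measure ℝ) :=
      hd2.continuous.memLp_of_hasCompactSupport hc1.deriv
    have k0 : opK (m0.toLp φ) = opJ (m1.toLp (deriv φ)) :=
      opK_toLp_eq (fun t => (hφ.differentiable (by simp) t).hasDerivAt) m0 m1
    have k1 : opK (m1.toLp (deriv φ)) = opJ (m2.toLp (deriv (deriv φ))) :=
      opK_toLp_eq (fun t => (hd1.differentiable (by simp) t).hasDerivAt) m1 m2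
    set p₀ := m0.toLp φ
    set p₁ := m1.toLp (deriv φ)
    set p₂ := m2.toLp (deriv (deriv φ))
    have hd : besselCalculus.IsDeriv p₀ p₁ := k0
    have l0 : opJ (opJ p₀ - opK p₁) = p₀ := hd.J_lift
    have l1 : opK (opJ p₀ - opK p₁) = p₁ := hd.K_lift
    have hweak : ∀ x : RealL2, ∫ t, evalJ t x * deriv (deriv φ) t = ⟪x, opK p₁⟫ := fun x => by
      rw [← inner_toLp_eq (coeFn_opJ x) m2, inner_opJ, k1]
    -- The test function is J p with p = J p₀ - K p₁. This cancels the negative power of J in (1 -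
    -- ∂²)u = J⁻¹ f and leaves a pairing in L².
    have hpair : ∀ x : RealL2, ∫ t, ((evalJ t x + evalJ t x ^ 2) * φ t -
        1 * evalJ t x * iteratedDeriv 2 φ t) =
        ⟪x + opJ (opM (opJ x) x), opJ p₀ - opK p₁⟫ := by
      intro x
      have e1 : ((opJ x + opM (opJ x) x : RealL2) : ℝ → ℝ) =ᵐ[volume]
          fun t => evalJ t x + evalJ t x ^ 2 := by
        filter_upwards [Lp.coeFn_add (opJ x) (opM (opJ x) x), coeFn_opJ x,
          coeFn_opM (opJ x) x] with t h1 h2 h3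
        rw [h1, Pi.add_apply, h3, h2, sq]
      have i1 : Integrable fun t => (evalJ t x + evalJ t x ^ 2) * φ t :=
        MemLp.integrable_mul (p := 2) (q := 2) ((memLp_congr_ae e1).1 (Lp.memLp _)) m0
      have i2 : Integrable fun t => evalJ t x * deriv (deriv φ) t :=
        MemLp.integrable_mul (p := 2) (q := 2) (memLp_evalJ x) m2
      simp only [one_mul, it2]
      rw [integral_sub i1 i2, hweak, ← inner_toLp_eq e1 m0, inner_add_left, inner_add_left,
        inner_opJ (opM (opJ x) x), l0, inner_opJ, inner_sub_right]
      ring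
    -- The first derivative is ∂_t q tested with φ, that is, minus q paired with φ'.
    refine ⟨fun r => -⟪q r, p₁⟫, fun r hr => ⟨?_, r⁻¹ * ⟪q r, p₁⟫ + ⟪f r, opK p₁⟫, ?_, ?_⟩⟩
    · have h1 := (hsol.hasDerivWithinAt hr).inner ℝ
        (hasDerivWithinAt_const r (Icc a b) (opJ p₀ - opK p₁))
      refine (h1.congr_deriv ?_).congr (fun r' _ => hpair (f r')) (hpair (f r))
      rw [inner_zero_right, zero_add]
      exact (inner_opK _ _).trans (by rw [l1])
    · have h1 := ((hsol.deriv_snd r hr).inner ℝ (hasDerivWithinAt_const r (Icc a b) p₁)).neg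
      refine h1.congr_deriv ?_
      have h2 : ⟪besselCalculus.K (f r), p₁⟫ = -⟪f r, opK p₁⟫ := inner_opK _ _
      rw [inner_zero_right, zero_add, inner_add_left, inner_neg_left, inner_smul_left, h2,
        conj_trivial]
      ring
    · simp only [it2]
      rw [hweak]
      ring

end Solution

theorem theorem1p2 (sA ρ₀ ρ₁ C₁ : ℝ) (hsA : 17 / 2 < sA) (hρ₀ : 0 < ρ₀) (hρ₁ : ρ₀ < ρ₁)
    (hC₁ : 0 < C₁) :
    ∃ ε₀ > (0 : ℝ), ∃ C₀ > (0 : ℝ), ∀ ε ∈ Set.Ioo 0 ε₀, ∀ A : ℝ → ℝ → ℝ,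
      IsCKdVSolution sA ρ₀ ρ₁ A →
      (∀ ρ ∈ Set.Icc ρ₀ ρ₁,
        sobolevNorm sA (A ρ) + sobolevNormAntideriv (sA - 2) (A ρ) ≤ ENNReal.ofReal C₁) →
      ∀ s : ℝ, 1 / 2 < s → ∃ u : ℝ → ℝ → ℝ,
        IsRadialBoussinesqSolution 1 s (ρ₀ * (ε ^ 3)⁻¹) (ρ₁ * (ε ^ 3)⁻¹) u ∧
        ∀ r ∈ Set.Icc (ρ₀ * (ε ^ 3)⁻¹) (ρ₁ * (ε ^ 3)⁻¹), ∀ t : ℝ,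
          |u r t - ε ^ 2 * A (ε ^ 3 * r) (ε * (t - r))| ≤ C₀ * ε ^ (7 / 2 : ℝ) := by
  obtain ⟨C, hC, hprof⟩ := exists_isSlowProfile (ρ₁ := ρ₁) hsA hρ₀ hC₁
  obtain ⟨ε₀, hε₀, C₀, hC₀, hsol⟩ := exists_solution_near_profile hC hρ₀ hρ₁
  refine ⟨ε₀, hε₀, C₀, hC₀, fun ε hε A hA hb s _ => ?_⟩
  obtain ⟨α, n, A₃, D, hp, hAα⟩ := hprof A hA hb
  -- Chosen after ε₀ and C₀, which therefore do not depend on s.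
  obtain ⟨m, hm⟩ := exists_nat_ge s
  obtain ⟨f, g, q, hfgq, hf, hg, hnear⟩ := hsol ε hε α n A₃ D hp m
  refine ⟨fun r t => evalJ t (f r), isRadialBoussinesqSolution_evalJ hm hfgq hf hg,
    fun r hr t => ?_⟩
  rw [hAα _ (mapsTo_scale hε.1 ρ₀ ρ₁ hr)]
  exact hnear r hr t
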